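/- **Setting.** Let $d\ge 1$ be an integer, $\mathbb S^d\subset\mathbb R^{d+1}$ the unit sphere with surface measure $\nu$, and $\mu$ the normalized Haar measure on $SO(d+1)$. For $l\ge 0$ let $\mathfrak B^l$ be the space of spherical harmonics of order $l$ (restrictions to $\mathbb S^d$ of complex harmonic homogeneous polynomials of degree $l$ in $d+1$ variables), $N(d,l)=\frac{(2l+d-1)(l+d-2)!}{l!\,(d-1)!}$ for $l\ge1$ and $N(d,0)=1$ its dimension, and $\{B^l_q:1\le q\le N(d,l)\}$ an orthonormal basis of $\mathfrak B^l$ in $L^2((\mathbb S^d,\nu),\mathbb C)$. For $f:\mathbb S^d\to\mathbb C$ and $g:SO(d+1)\to\mathbb R$ put $$\phi^l_q(f)=\int f\,\overline{B^l_q}\,d\nu,\qquad D^l_{qr}(u)=\int \overline{B^l_q(ux)}\,B^l_r(x)\,d\nu(x),\qquad \tilde\phi^l_{qr}(g)=\int g(u)D^l_{qr}(u)\,d\mu(u),$$ and let $\tilde\phi^l(g)=(\tilde\phi^l_{qr}(g))_{1\le q,r\le N(d,l)}$. Let $X$ be a random element of $\mathbb S^d$ with density $f_X$ with respect to $\nu$,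 and $U$ a random element of $SO(d+1)$, independent of $X$, with square integrable density $f_U$ with respect to $\mu$; assume that $\tilde\phi^l(f_U)$ is invertible for every $l\ge0$. Let $Z=UX$ and let $Z_1,Z_2,\dots$ be i.i.d. copies of $Z$. For $T>0$ and a sequence $(T_n)$ of truncation levels put $$K_{T}(x,z)=\sum_{l=0}^{[T]}\sum_{q=1}^{N(d,l)}\Big(\sum_{r=1}^{N(d,l)}\big((\tilde\phi^l(f_U))^{-1}\big)_{qr}\overline{B^l_r(z)}\Big)B^l_q(x),$$ $$\hat f_X(x)=\frac1n\sum_{i=1}^n\mathrm{Re}\,K_{T_n}(x,Z_i),\qquad \hat s_1^2(x)=\frac1n\sum_{i=1}^n\big(\mathrm{Re}\,K_{T_n}(x,Z_i)\big)^2-\hat f_X(x)^2,\quad \hat s_1(x)\ge0.$$ **Theorem.** Let $\beta\ge0$ and let $k\in\mathbb N$ with $k>d/4$. Assume: 1. (ordinary smoothness of order $\beta$) there is $c_1>0$ with $\|(\tilde\phi^l(f_U))^{-1}\|_{\rm op}\le c_1 l^\beta$ for all $l\ge1$; 2. $f_X$ is $2k$ times continuously differentiable on $\mathbb S^d$; 3.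 $T_n\asymp n^{1/(4k+2\beta+d)}$, i.e. there are $c,C>0$ with $c\,n^{1/(4k+2\beta+d)}\le T_n\le C\,n^{1/(4k+2\beta+d)}$ for all $n\ge1$; 4. for each $x\in\mathbb S^d$ there is $c_x>0$ with $\mathbb E\big[(\mathrm{Re}\,K_{T_n}(x,Z))^2\big]\ge c_x\,T_n^{2\beta+d}$ for all $n\ge1$; 5. with $\Delta$ the Laplace–Beltrami operator of $\mathbb S^d$, the Fourier–Laplace series $\sum_{l}\big(\sum_{q}\phi^l_q(\Delta^kf_X)B^l_q(x)\big)$ converges absolutely, as a series in $l$, for every $x\in\mathbb S^d$. Then, for every $x\in\mathbb S^d$, $$\sqrt n\,\frac{\hat f_X(x)-f_X(x)}{\hat s_1(x)}\ \overset{d}{\longrightarrow}\ N(0,1)\qquad(n\to\infty).$$ Consequently, for every $x\in\mathbb S^d$ and $\alpha\in(0,1)$, with $z_{\alpha/2}$ the upper $\alpha/2$-quantile of $N(0,1)$, $$P\Big(\hat f_X(x)-z_{\alpha/2}\tfrac{\hat s_1(x)}{\sqrt n}<f_X(x)<\hat f_X(x)+z_{\alpha/2}\tfrac{\hat s_1(x)}{\sqrt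 n}\Big)\longrightarrow 1-\alpha .$$ (The quotient is read as $0$ on the event $\hat s_1(x)=0$, whose probability tends to $0$.) -/

import Mathlib

open MeasureTheory ProbabilityTheory Filter Topology
open scoped Manifold ENNReal EuclideanSpace

noncomputable section

namespace SphereDeconv

/-! ## The sphere and the rotation group -/

/-- The Euclidean space `ℝ^{d+1}`. -/
abbrev Amb (d : ℕ) : Type := EuclideanSpace ℝ (Fin (d + 1))

/-- The unit hypersphere `S^d` in `ℝ^{d+1}`. -/
abbrev Sph (d : ℕ) : Type := Metric.sphere (0 : Amb d) 1

/-- The spherical (surface) measure `ν` on `S^d`: the measure of `A` is `d + 1` times the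
Lebesgue measure of the cone over `A`; note that `d + 1 = area(S^d) / Leb(B(0,1))`. -/
def surfaceMeasure (d : ℕ) : Measure (Sph d) := (volume : Measure (Amb d)).toSphere

/-- The special orthogonal group `SO(d+1)`. -/
abbrev Rot (d : ℕ) : Type := Matrix.specialOrthogonalGroup (Fin (d + 1)) ℝ

/-- The underlying matrix of a rotation. -/
abbrev Rot.mat {d : ℕ} (u : Rot d) : Matrix (Fin (d + 1)) (Fin (d + 1)) ℝ := u.1

lemma Rot.transpose_mul {d : ℕ} (u : Rot d) : u.mat.transpose * u.mat = 1 :=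
  (Matrix.mem_orthogonalGroup_iff' (Fin (d + 1)) ℝ).1 u.2.1

instance instMeasurableSpaceRot (d : ℕ) : MeasurableSpace (Rot d) := borel _

instance instBorelSpaceRot (d : ℕ) : BorelSpace (Rot d) := ⟨rfl⟩

instance instIsTopologicalGroupRot (d : ℕ) : IsTopologicalGroup (Rot d) where
  continuous_inv := by
    refine Continuous.subtype_mk (f := fun u : Rot d => u.mat.transpose) ?_ _
    exact continuous_subtype_val.matrix_transpose

lemma Rot.isCompact_carrier (d : ℕ) :
    IsCompact {A : Matrix (Fin (d + 1)) (Fin (d + 1)) ℝ |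
      A ∈ Matrix.specialOrthogonalGroup (Fin (d + 1)) ℝ} := by
  have hK : IsCompact {A : Matrix (Fin (d + 1)) (Fin (d + 1)) ℝ |
      ∀ i j, A i j ∈ Set.Icc (-1 : ℝ) 1} := by
    have h := isCompact_univ_pi (fun _ : Fin (d + 1) =>
      isCompact_univ_pi (fun _ : Fin (d + 1) => isCompact_Icc (a := (-1 : ℝ)) (b := 1)))
    convert! h using 1
    ext A
    exact ⟨fun hA i _ j _ => hA i j, fun hA i j => hA i trivial j trivial⟩
  refine hK.of_isClosed_subset ?_ ?_
  · have h : {A : Matrix (Fin (d + 1)) (Fin (d + 1)) ℝ |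
        A ∈ Matrix.specialOrthogonalGroup (Fin (d + 1)) ℝ}
        = {A | A.transpose * A = 1} ∩ {A | A.det = 1} := by
      ext A
      exact and_congr (Matrix.mem_orthogonalGroup_iff' (Fin (d + 1)) ℝ) Iff.rfl
    rw [h]
    refine IsClosed.inter (isClosed_eq ?_ continuous_const) (isClosed_eq ?_ continuous_const)
    · exact continuous_id.matrix_transpose.matrix_mul continuous_id
    · exact continuous_id.matrix_det
  · intro A hA i j
    have h1 : (A.transpose * A) j j = 1 := by
      rw [(Matrix.mem_orthogonalGroup_iff' (Fin (d + 1)) ℝ).1 hA.1, Matrix.one_apply_eq]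
    rw [Matrix.mul_apply] at h1
    have h2 : A i j * A i j ≤ 1 := by
      rw [← h1]
      exact Finset.single_le_sum (f := fun i => A.transpose j i * A i j)
        (fun i _ => mul_self_nonneg (A i j)) (Finset.mem_univ i)
    exact ⟨by nlinarith, by nlinarith⟩

instance instCompactSpaceRot (d : ℕ) : CompactSpace (Rot d) :=
  isCompact_iff_compactSpace.1 (Rot.isCompact_carrier d)

/-- The normalized Haar measure `μ` on `SO(d+1)`. -/
def haarRot (d : ℕ) : Measure (Rot d) := Measure.haarMeasure ⊤

/-- The point `u x` of `S^d`, for a rotation `u` and `x ∈ S^d` (matrix times vector). -/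
def rotate {d : ℕ} (u : Rot d) (x : Sph d) : Sph d :=
  ⟨WithLp.toLp 2 (u.mat.mulVec x.1.ofLp), by
    have hx : ‖x.1‖ = 1 := by simp
    have h1 : ‖x.1‖ ^ 2 = dotProduct x.1.ofLp x.1.ofLp := by
      rw [EuclideanSpace.norm_sq_eq]
      simp [dotProduct, sq]
    have h2 : ‖(WithLp.toLp 2 (u.mat.mulVec x.1.ofLp) : Amb d)‖ ^ 2
        = dotProduct (u.mat.mulVec x.1.ofLp) (u.mat.mulVec x.1.ofLp) := by
      rw [EuclideanSpace.norm_sq_eq]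
      simp [dotProduct, sq]
    have h3 : dotProduct (u.mat.mulVec x.1.ofLp) (u.mat.mulVec x.1.ofLp)
        = dotProduct x.1.ofLp x.1.ofLp := by
      rw [Matrix.dotProduct_mulVec, ← Matrix.mulVec_transpose, Matrix.mulVec_mulVec,
        Rot.transpose_mul, Matrix.one_mulVec]
    rw [mem_sphere_zero_iff_norm]
    rw [h3, ← h1, hx] at h2
    nlinarith [norm_nonneg (WithLp.toLp 2 (u.mat.mulVec x.1.ofLp) : Amb d)]⟩

/-! ## Spherical harmonics -/

/-- The Laplacian `∑ᵢ ∂²p/∂tᵢ²` of a polynomial in `d + 1` variables, as a linear map. -/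
def polyLaplacian (d : ℕ) :
    MvPolynomial (Fin (d + 1)) ℂ →ₗ[ℂ] MvPolynomial (Fin (d + 1)) ℂ :=
  ∑ i : Fin (d + 1),
    (MvPolynomial.pderiv i).toLinearMap ∘ₗ (MvPolynomial.pderiv (R := ℂ) i).toLinearMap

/-- Restriction of a complex polynomial in `d + 1` variables to a function on `S^d`. -/
def restrictToSphere (d : ℕ) : MvPolynomial (Fin (d + 1)) ℂ →ₗ[ℂ] (Sph d → ℂ) :=
  LinearMap.pi fun x => (MvPolynomial.aeval fun i => ((x.1 i : ℝ) : ℂ)).toLinearMap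

/-- The space of spherical harmonics of order `l` in `d + 1` variables: restrictions to `S^d` of
complex harmonic homogeneous polynomials of degree `l`. -/
def harmonicSpace (d l : ℕ) : Submodule ℂ (Sph d → ℂ) :=
  (MvPolynomial.homogeneousSubmodule (Fin (d + 1)) ℂ l ⊓
    LinearMap.ker (polyLaplacian d)).map (restrictToSphere d)

/-- `N(d,l) = (2l+d-1) (l+d-2)! / (l! (d-1)!)`, with `N(d,0) = 1`. -/
def harmonicDim (d l : ℕ) : ℕ :=
  if l = 0 then 1
  else (2 * l + d - 1) * (l + d - 2).factorial / (l.factorial * (d - 1).factorial)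

/-- `(B_q)`, `1 ≤ q ≤ N(d,l)`, is an orthonormal basis of the space of spherical harmonics of
order `l` for the inner product of `L²(S^d, ν; ℂ)`. -/
structure IsHarmonicBasis (d l : ℕ) (B : Fin (harmonicDim d l) → Sph d → ℂ) : Prop where
  orthonormal : ∀ q r, ∫ x, B q x * star (B r x) ∂(surfaceMeasure d) = if q = r then 1 else 0
  span_eq : Submodule.span ℂ (Set.range B) = harmonicSpace d l

/-- A family of functions `B^l_q` on `S^d`, `l ≥ 0`, `1 ≤ q ≤ N(d,l)`. -/
abbrev HarmonicFamily (d : ℕ) : Type := (l : ℕ) → Fin (harmonicDim d l) → Sph d → ℂ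

/-! ## Fourier transforms -/

/-- The hyperspherical Fourier transform `φ^l_q(f) = ∫ f(x) conj(B^l_q(x)) dν(x)`. -/
def sphFourier {d : ℕ} (B : HarmonicFamily d) (f : Sph d → ℂ) (l : ℕ)
    (q : Fin (harmonicDim d l)) : ℂ :=
  ∫ x, f x * star (B l q x) ∂(surfaceMeasure d)

/-- The degree-`l` term `∑_q φ^l_q(f) B^l_q(x)` of the Fourier-Laplace series of a real function
`f` at `x`. -/
def fourierLaplaceTerm {d : ℕ} (B : HarmonicFamily d) (f : Sph d → ℝ) (l : ℕ) (x : Sph d) : ℂ :=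
  ∑ q, sphFourier B (fun y => (f y : ℂ)) l q * B l q x

/-- `D^l_{qr}(u) = ∫ conj(B^l_q(u x)) B^l_r(x) dν(x)`. -/
def rotCoeff {d : ℕ} (B : HarmonicFamily d) (l : ℕ) (u : Rot d)
    (q r : Fin (harmonicDim d l)) : ℂ :=
  ∫ x, star (B l q (rotate u x)) * B l r x ∂(surfaceMeasure d)

/-- The rotational Fourier transform of `g` at degree `l`, the matrix with entries
`∫ g(u) D^l_{qr}(u) dμ(u)`. -/
def rotFourier {d : ℕ} (B : HarmonicFamily d) (g : Rot d → ℝ) (l : ℕ) :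
    Matrix (Fin (harmonicDim d l)) (Fin (harmonicDim d l)) ℂ :=
  Matrix.of fun q r => ∫ u, (g u : ℂ) * rotCoeff B l u q r ∂(haarRot d)

/-- The operator norm of a complex square matrix with respect to the standard Hermitian norm. -/
def opNorm {N : ℕ} (A : Matrix (Fin N) (Fin N) ℂ) : ℝ :=
  ‖Matrix.toEuclideanCLM (𝕜 := ℂ) A‖

/-! ## The Laplace-Beltrami operator -/

/-- The extension `y ↦ f(y / ‖y‖)` of `f : S^d → ℝ` to `ℝ^{d+1}` (with value `0` at the origin). -/
def radialExtension {d : ℕ} (f : Sph d → ℝ) (y : Amb d) : ℝ :=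
  Function.extend (Subtype.val : Sph d → Amb d) f 0 (‖y‖⁻¹ • y)

/-- The Laplace-Beltrami operator of `S^d`: the restriction to `S^d` of the Euclidean Laplacian
of the extension of `f` that is homogeneous of degree `0`. -/
def laplaceBeltrami {d : ℕ} (f : Sph d → ℝ) (x : Sph d) : ℝ :=
  Laplacian.laplacian (radialExtension f) x.1

/-! ## The estimators -/

/-- The deconvolution kernel `K_T(x,z)`, the sum over `0 ≤ l ≤ [T]` of
`∑_q (∑_r ((φ̃^l(f_U))⁻¹)_{qr} conj(B^l_r(z))) B^l_q(x)`. -/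
def deconvKernel {d : ℕ} (B : HarmonicFamily d) (fU : Rot d → ℝ) (T : ℝ) (x z : Sph d) : ℂ :=
  ∑ l ∈ Finset.range (⌊T⌋₊ + 1), ∑ q, (∑ r, (rotFourier B fU l)⁻¹ q r * star (B l r z)) * B l q x

/-- The deconvolution density estimator `f̂_X(x) = n⁻¹ ∑_{i<n} Re K_T(x, z_i)`. -/
def densityEst {d : ℕ} (B : HarmonicFamily d) (fU : Rot d → ℝ) (T : ℝ) (n : ℕ)
    (z : ℕ → Sph d) (x : Sph d) : ℝ :=
  (n : ℝ)⁻¹ * ∑ i ∈ Finset.range n, (deconvKernel B fU T x (z i)).re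

/-- The plug-in estimator `ŝ₁(x)`, the square root of
`n⁻¹ ∑_{i<n} (Re K_T(x, z_i))² - f̂_X(x)²`. -/
def sdEst {d : ℕ} (B : HarmonicFamily d) (fU : Rot d → ℝ) (T : ℝ) (n : ℕ)
    (z : ℕ → Sph d) (x : Sph d) : ℝ :=
  Real.sqrt ((n : ℝ)⁻¹ * ∑ i ∈ Finset.range n, (deconvKernel B fU T x (z i)).re ^ 2
    - densityEst B fU T n z x ^ 2)

/-- The upper `p`-quantile `z_p` of the standard normal distribution, for `0 < p < 1`. -/
def normalUpperQuantile (p : ℝ) : ℝ :=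
  sInf {t : ℝ | 1 - p ≤ cdf (gaussianReal 0 1) t}

/-! ## The conditions -/

/-- Ordinary smoothness of order `β`, upper bound:
`‖(φ̃^l(f_U))⁻¹‖_op ≤ c₁ l^β` for all `l ≥ 1`. -/
def OrdinarySmoothUpper {d : ℕ} (B : HarmonicFamily d) (fU : Rot d → ℝ) (β : ℝ) : Prop :=
  ∃ c₁ > 0, ∀ l : ℕ, 1 ≤ l → opNorm (rotFourier B fU l)⁻¹ ≤ c₁ * (l : ℝ) ^ β

/-- `T_n ≍ n^p`. -/
def PowerOrder (T : ℕ → ℝ) (p : ℝ) : Prop :=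
  ∃ c > 0, ∃ C > 0, ∀ n : ℕ, 1 ≤ n → c * (n : ℝ) ^ p ≤ T n ∧ T n ≤ C * (n : ℝ) ^ p

/-- For each `x`, `E[(Re K_{T_n}(x, Z))²] ≳ T_n^{2β+q}`, where `Z` has law `ρ`. -/
def SecondMomentLower {d : ℕ} (B : HarmonicFamily d) (fU : Rot d → ℝ) (ρ : Measure (Sph d))
    (T : ℕ → ℝ) (β q : ℝ) : Prop :=
  ∀ x : Sph d, ∃ c > 0, ∀ n : ℕ, 1 ≤ n →
    c * T n ^ (2 * β + q) ≤ ∫ z, (deconvKernel B fU (T n) x z).re ^ 2 ∂ρ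

end SphereDeconv

end

open SphereDeconv

/-! At a fixed `x` the estimator is the empirical mean of `g n = Re K_{T_n}(x, ·)` over an i.i.d.
sample, so the theorem is a self-normalised central limit theorem for a triangular array, plus a
bias estimate. Write `v n` for the second moment of `g n`, and `T` for `T_n`.

Mean. A rotation acts on the conjugated harmonics of degree `l` through the matrix `rotCoeff`. By
independence the Fourier coefficients of the law of `UX` are therefore `rotFourier` applied to those
of `fX`. The inverse matrix in the kernel undoes this, and the mean of the kernel is the partial sum
of the Fourier-Laplace series of `fX` (`integral_deconvKernel`).

Bias. Green's formula makes harmonics of degree `l` eigenfunctions of the Laplace-Beltrami operator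
with eigenvalue `-l(l+d-1)`, of modulus at least `l²`. Hence `T^{2k}` times the truncation error is
at most a tail of the absolutely convergent series of `Δ^k fX`, and the bias is `o(T^{-2k})`. That
the series sums to `fX` uses `d < 4k`: Bessel's inequality for `Δ^k fX` and the addition theorem
give uniform convergence, and completeness of the harmonics identifies the sum. Since `√n ≲
T^{2k+β+d/2}` and `√(v n) ≳ T^{β+d/2}`, the normalised bias vanishes (`tendsto_bias_div`).

Fluctuation. The addition theorem and ordinary smoothness bound the kernel by a multiple of `1 +
T^{β+d}`, while `v n ≳ T^{2β+d}`. So sup² / (n `v n`) is of order at most `T^d / n`, which tends to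
zero. This one ratio gives both the Lindeberg condition, used through characteristic functions in
`tendstoInDistribution_row_sum`, and the convergence of the empirical variance divided by `v n` to
one, by Chebyshev. Means stay bounded while `v n` diverges, so second moment and variance are
interchangeable. Slutsky's lemma concludes (`tendstoInDistribution_selfNormalised`), and coverage
follows because the normal law has no atoms. -/

noncomputable section

namespace SphereDeconv

/-! ### Central limit theorem and weak law for triangular arrays of bounded variables -/

section Probability

variable {S Ω : Type*} [MeasurableSpace S] [MeasurableSpace Ω]

lemma integrable_of_measurable_of_abs_le {ρ : Measure S} [IsFiniteMeasure ρ] {h : S → ℝ}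
    (hm : Measurable h) {M : ℝ} (hM : ∀ z, |h z| ≤ M) : Integrable h ρ :=
  Integrable.of_bound hm.aestronglyMeasurable M (ae_of_all _ hM)

/-- Second order expansion of the characteristic function of a bounded centred variable. -/
lemma norm_charFun_sub_le {ρ : Measure S} [IsProbabilityMeasure ρ] {h : S → ℝ}
    (hm : Measurable h) {M : ℝ} (hM : ∀ z, |h z| ≤ M) (h0 : ∫ z, h z ∂ρ = 0) {t : ℝ}
    (ht : |t| * M ≤ 1) :
    ‖charFun (ρ.map h) t - (1 - ((t ^ 2 / 2 * ∫ z, h z ^ 2 ∂ρ : ℝ) : ℂ))‖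
      ≤ |t| ^ 3 * M * ∫ z, h z ^ 2 ∂ρ := by
  have hi1 : Integrable h ρ := integrable_of_measurable_of_abs_le hm hM
  have hi2 : Integrable (fun z => h z ^ 2) ρ := by
    refine integrable_of_measurable_of_abs_le (hm.pow_const 2) (M := M ^ 2) fun z => ?_
    rw [abs_pow]
    exact pow_le_pow_left₀ (abs_nonneg _) (hM z) 2
  have hie : Integrable (fun z => Complex.exp (t * h z * Complex.I)) ρ := by
    refine Integrable.of_bound (by fun_prop) 1 (ae_of_all _ fun z => ?_)
    rw [← Complex.ofReal_mul, Complex.norm_exp_ofReal_mul_I]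
  have hp1 : Integrable (fun z => (t * h z * Complex.I : ℂ)) ρ := by
    simpa using (hi1.ofReal (𝕜 := ℂ)).const_mul (t : ℂ) |>.mul_const Complex.I
  have hp2 : Integrable (fun z => ((t ^ 2 / 2 * h z ^ 2 : ℝ) : ℂ)) ρ :=
    (hi2.const_mul (t ^ 2 / 2)).ofReal
  have hp3 : Integrable (fun z => (1 + t * h z * Complex.I : ℂ)) ρ := (integrable_const _).add hp1
  have hp4 : Integrable (fun z => (1 + t * h z * Complex.I : ℂ) - ((t ^ 2 / 2 * h z ^ 2 : ℝ) : ℂ))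
      ρ := hp3.sub hp2
  have hcf : charFun (ρ.map h) t = ∫ z, Complex.exp (t * h z * Complex.I) ∂ρ := by
    rw [charFun_apply_real, integral_map hm.aemeasurable (by fun_prop)]
  have hpoly : (1 - ((t ^ 2 / 2 * ∫ z, h z ^ 2 ∂ρ : ℝ) : ℂ))
      = ∫ z, (1 + (t * h z * Complex.I : ℂ) - ((t ^ 2 / 2 * h z ^ 2 : ℝ) : ℂ)) ∂ρ := by
    rw [integral_sub hp3 hp2, integral_add (integrable_const _) hp1,
      integral_complex_ofReal, integral_const_mul, integral_mul_const, integral_const_mul,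
      integral_complex_ofReal, h0]
    simp
  rw [hcf, hpoly, ← integral_sub hie hp4,
    ← integral_const_mul]
  refine norm_integral_le_of_norm_le (hi2.const_mul _) (ae_of_all _ fun z => ?_)
  have hn : ‖(t * h z * Complex.I : ℂ)‖ = |t| * |h z| := by simp
  have hle : ‖(t * h z * Complex.I : ℂ)‖ ≤ 1 := by
    rw [hn]
    exact (mul_le_mul_of_nonneg_left (hM z) (abs_nonneg t)).trans ht
  have hb := Complex.exp_bound hle (n := 3) (by norm_num)
  have hs : ∑ m ∈ Finset.range 3, (t * h z * Complex.I : ℂ) ^ m / (m.factorial : ℂ)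
      = 1 + (t * h z * Complex.I : ℂ) - ((t ^ 2 / 2 * h z ^ 2 : ℝ) : ℂ) := by
    simp only [Finset.sum_range_succ, Finset.sum_range_zero, Nat.factorial, mul_pow,
      Complex.I_sq]
    push_cast
    ring
  rw [hs, hn] at hb
  refine hb.trans ?_
  -- One of the three factors `|h|` is traded for the bound `M`, so that the error is expressed
  -- through the second moment alone.
  have h3 : |h z| ^ 3 ≤ M * h z ^ 2 := by
    rw [pow_succ', ← sq_abs (h z)]
    exact mul_le_mul_of_nonneg_right (hM z) (by positivity)
  -- The remainder constant of the exponential series is 4/18, rounded up to 1.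
  calc (|t| * |h z|) ^ 3 * (((3 : ℕ).succ : ℝ) * (((3 : ℕ).factorial : ℝ) * (3 : ℕ))⁻¹)
      ≤ (|t| * |h z|) ^ 3 * 1 := by
        refine mul_le_mul_of_nonneg_left ?_ (by positivity)
        norm_num [Nat.factorial]
    _ = |t| ^ 3 * |h z| ^ 3 := by ring
    _ ≤ |t| ^ 3 * (M * h z ^ 2) := mul_le_mul_of_nonneg_left h3 (by positivity)
    _ = _ := by ring

/-- A central limit theorem for row-wise i.i.d. triangular arrays of bounded variables. -/
theorem tendstoInDistribution_row_sum {P : Measure Ω} [IsProbabilityMeasure P]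
    {ρ : Measure S} [IsProbabilityMeasure ρ] {Z : ℕ → Ω → S} (hZ : ∀ i, Measurable (Z i))
    (hind : iIndepFun Z P) (hlaw : ∀ i, P.map (Z i) = ρ)
    {h : ℕ → S → ℝ} (hm : ∀ n, Measurable (h n)) {δ : ℕ → ℝ}
    (hδ : Tendsto δ atTop (𝓝 0)) (hb : ∀ᶠ n in atTop, ∀ z, |h n z| ≤ δ n * √(n : ℝ))
    (h0 : ∀ᶠ n in atTop, ∫ z, h n z ∂ρ = 0)
    (h2 : Tendsto (fun n => ∫ z, h n z ^ 2 ∂ρ) atTop (𝓝 1)) :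
    TendstoInDistribution (fun (n : ℕ) ω => (√(n : ℝ))⁻¹ * ∑ i ∈ Finset.range n, h n (Z i ω))
      atTop id (fun _ => P) (gaussianReal 0 1) where
  forall_aemeasurable n := by
    refine Measurable.aemeasurable ?_
    exact (Finset.measurable_sum _ fun i _ => (hm n).comp (hZ i)).const_mul _
  tendsto := by
    refine ProbabilityMeasure.tendsto_iff_tendsto_charFun.2 fun t => ?_
    simp only [ProbabilityMeasure.coe_mk, Measure.map_id, charFun_gaussianReal]
    have hcf : ∀ n : ℕ, charFun (P.map fun ω => (√(n : ℝ))⁻¹ * ∑ i ∈ Finset.range n, h n (Z i ω)) t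
        = charFun (ρ.map (h n)) ((√(n : ℝ))⁻¹ * t) ^ n := by
      intro n
      have hi : iIndepFun (fun i ω => h n (Z i ω)) P := hind.comp (fun _ => h n) fun _ => hm n
      have hmi : ∀ i, AEMeasurable (fun ω => h n (Z i ω)) P := fun i =>
        ((hm n).comp (hZ i)).aemeasurable
      rw [charFun_map_mul_comp (f := fun ω => ∑ i ∈ Finset.range n, h n (Z i ω))
          (Measurable.aemeasurable (Finset.measurable_sum _ fun i _ => (hm n).comp (hZ i))),
        (hi.restrict _).charFun_map_fun_finsetSum_eq_prod
          (fun i _ => hmi i)]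
      have : ∀ i, P.map (fun ω => h n (Z i ω)) = ρ.map (h n) := fun i => by
        rw [← hlaw i, Measure.map_map (hm n) (hZ i)]
        rfl
      simp [this]
    simp only [hcf]
    -- The characteristic function of the row sum is an `n`-th power, so the limit `(1 + w_n / n)^n
    -- → exp w` reduces everything to `w_n = n (φ_n - 1)`.
    have hlim : Tendsto (fun n : ℕ => (n : ℂ) * (charFun (ρ.map (h n)) ((√(n : ℝ))⁻¹ * t) - 1))
        atTop (𝓝 (-t ^ 2 / 2)) := by
      have hA : Tendsto (fun n : ℕ => ((-(t ^ 2 / 2 * ∫ z, h n z ^ 2 ∂ρ) : ℝ) : ℂ)) atTop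
          (𝓝 (-t ^ 2 / 2)) := by
        have := ((h2.const_mul (t ^ 2 / 2)).neg)
        have := (Complex.continuous_ofReal.tendsto _).comp this
        convert! this using 2
        push_cast
        ring
      have hB : Tendsto (fun n : ℕ => |t| ^ 3 * δ n * ∫ z, h n z ^ 2 ∂ρ) atTop (𝓝 0) := by
        simpa using (hδ.const_mul (|t| ^ 3)).mul h2
      have hC : ∀ᶠ n in atTop, |t| * δ n ≤ 1 := by
        have : Tendsto (fun n => |t| * δ n) atTop (𝓝 0) := by simpa using hδ.const_mul |t|
        exact this.eventually_le_const one_pos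
      -- At the argument `t / √n`, with bound `δ n * √n`, the cubic error times `n` is exactly `|t|³
      -- δ n` times the second moment.
      have hD : Tendsto (fun n : ℕ => (n : ℂ) * (charFun (ρ.map (h n)) ((√(n : ℝ))⁻¹ * t) - 1)
          - ((-(t ^ 2 / 2 * ∫ z, h n z ^ 2 ∂ρ) : ℝ) : ℂ)) atTop (𝓝 0) := by
        refine squeeze_zero_norm' ?_ hB
        filter_upwards [hb, h0, hC, eventually_gt_atTop 0] with n hbn h0n hCn hn
        have hn' : (0 : ℝ) < n := by exact_mod_cast hn
        have hs : 0 < √(n : ℝ) := Real.sqrt_pos.2 hn'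
        have habs : |(√(n : ℝ))⁻¹ * t| = (√(n : ℝ))⁻¹ * |t| := by
          rw [abs_mul, abs_of_pos (inv_pos.2 hs)]
        have hss : √(n : ℝ) ^ 2 = n := Real.sq_sqrt hn'.le
        have := norm_charFun_sub_le (hm n) hbn h0n (t := (√(n : ℝ))⁻¹ * t) (by
          rw [habs]
          calc (√(n : ℝ))⁻¹ * |t| * (δ n * √(n : ℝ)) = |t| * δ n := by field_simp
            _ ≤ 1 := hCn)
        have heq : (n : ℂ) * (charFun (ρ.map (h n)) ((√(n : ℝ))⁻¹ * t) - 1)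
            - ((-(t ^ 2 / 2 * ∫ z, h n z ^ 2 ∂ρ) : ℝ) : ℂ)
            = ((n : ℝ) : ℂ) * (charFun (ρ.map (h n)) ((√(n : ℝ))⁻¹ * t)
              - (1 - ((((√(n : ℝ))⁻¹ * t) ^ 2 / 2 * ∫ z, h n z ^ 2 ∂ρ : ℝ) : ℂ))) := by
          have h1 : ((√(n : ℝ))⁻¹ * t) ^ 2 = t ^ 2 / n := by
            rw [mul_pow, inv_pow, hss]
            ring
          rw [h1]
          have hnc : ((n : ℝ) : ℂ) ≠ 0 := by exact_mod_cast hn'.ne'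
          push_cast at hnc ⊢
          field_simp
          ring
        rw [heq, norm_mul, Complex.norm_real, Real.norm_of_nonneg hn'.le]
        calc (n : ℝ) * _ ≤ n * _ := mul_le_mul_of_nonneg_left this hn'.le
          _ = |t| ^ 3 * δ n * ∫ z, h n z ^ 2 ∂ρ := by
            rw [habs]
            have : (n : ℝ) = √(n : ℝ) ^ 2 := hss.symm
            rw [this, Real.sqrt_sq hs.le]
            field_simp
      simpa using hD.add hA
    have := Complex.tendsto_one_add_pow_exp_of_tendsto hlim
    convert! this using 2
    · ring
    · congr 1
      push_cast
      ring

/-- Continuity at the limit point alone suffices, which admits functions such as `r ↦ (√r)⁻¹` near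
`r = 1`. -/
lemma TendstoInMeasure.comp_continuousAt_const {P : Measure Ω} {R : ℕ → Ω → ℝ} {c : ℝ}
    (hR : TendstoInMeasure P R atTop fun _ => c) (φ : ℝ → ℝ) (hφ : ContinuousAt φ c) {c' : ℝ}
    (hc' : φ c = c') : TendstoInMeasure P (fun n ω => φ (R n ω)) atTop fun _ => c' := by
  subst hc'
  rw [tendstoInMeasure_iff_dist] at hR ⊢
  intro ε hε
  obtain ⟨δ, hδ, h⟩ := Metric.continuousAt_iff.1 hφ ε hε
  refine tendsto_of_tendsto_of_tendsto_of_le_of_le tendsto_const_nhds (hR δ hδ)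
    (fun _ => zero_le) fun n => measure_mono fun ω hω => ?_
  by_contra hc
  simp only [Set.mem_ofPred_eq, not_le] at hω hc
  exact absurd (h hc) (not_lt.2 hω)

/-- Chebyshev: a sequence whose means converge and whose variances vanish converges in
probability. -/
lemma tendstoInMeasure_of_variance {P : Measure Ω} [IsProbabilityMeasure P] {Y : ℕ → Ω → ℝ}
    (hY : ∀ n, MemLp (Y n) 2 P) {c : ℝ} (hmean : Tendsto (fun n => P[Y n]) atTop (𝓝 c))
    (hvar : Tendsto (fun n => Var[Y n; P]) atTop (𝓝 0)) :
    TendstoInMeasure P Y atTop fun _ => c := by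
  rw [tendstoInMeasure_iff_dist]
  intro ε hε
  -- Half of `ε` absorbs the error of the mean; the other half goes to Chebyshev's inequality.
  have h1 : ∀ᶠ n in atTop, dist (P[Y n]) c < ε / 2 :=
    (Metric.tendsto_nhds.1 hmean) (ε / 2) (by positivity)
  have h2 : Tendsto (fun n => ENNReal.ofReal (Var[Y n; P] / (ε / 2) ^ 2)) atTop (𝓝 0) := by
    have := (ENNReal.continuous_ofReal.tendsto _).comp (hvar.div_const ((ε / 2) ^ 2))
    simpa [Function.comp_def] using this
  refine tendsto_of_tendsto_of_tendsto_of_le_of_le' tendsto_const_nhds h2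
    (Eventually.of_forall fun _ => zero_le) ?_
  filter_upwards [h1] with n hn
  refine le_trans (measure_mono fun ω hω => ?_)
    (meas_ge_le_variance_div_sq (hY n) (c := ε / 2) (by positivity))
  simp only [Set.mem_ofPred_eq] at hω ⊢
  have := dist_triangle (Y n ω) (P[Y n]) c
  rw [Real.dist_eq (Y n ω) (P[Y n])] at this
  linarith

/-- The input for Chebyshev. Variances of independent copies add up, and each is bounded by the raw
second moment, the quantity that is controlled for the kernels. -/
lemma variance_mean_le {P : Measure Ω} [IsProbabilityMeasure P]
    {ρ : Measure S} [IsProbabilityMeasure ρ] {Z : ℕ → Ω → S} (hZ : ∀ i, Measurable (Z i))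
    (hind : iIndepFun Z P) (hlaw : ∀ i, P.map (Z i) = ρ)
    {h : S → ℝ} (hm : Measurable h) {M : ℝ} (hM : ∀ z, |h z| ≤ M) {n : ℕ} (hn : 0 < n) :
    P[fun ω => (n : ℝ)⁻¹ * ∑ i ∈ Finset.range n, h (Z i ω)] = ∫ z, h z ∂ρ ∧
    MemLp (fun ω => (n : ℝ)⁻¹ * ∑ i ∈ Finset.range n, h (Z i ω)) 2 P ∧
    Var[fun ω => (n : ℝ)⁻¹ * ∑ i ∈ Finset.range n, h (Z i ω); P]
      ≤ (n : ℝ)⁻¹ * ∫ z, h z ^ 2 ∂ρ := by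
  have hn' : (n : ℝ) ≠ 0 := by exact_mod_cast hn.ne'
  have hmi : ∀ i, Measurable fun ω => h (Z i ω) := fun i => hm.comp (hZ i)
  have hL : ∀ i, MemLp (fun ω => h (Z i ω)) 2 P := fun i =>
    MemLp.of_bound (hmi i).aestronglyMeasurable M (ae_of_all _ fun ω => hM _)
  have hint : ∀ i, ∫ ω, h (Z i ω) ∂P = ∫ z, h z ∂ρ := fun i => by
    rw [← hlaw i, integral_map (hZ i).aemeasurable hm.aestronglyMeasurable]
  have hint2 : ∀ i, ∫ ω, h (Z i ω) ^ 2 ∂P = ∫ z, h z ^ 2 ∂ρ := fun i => by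
    rw [← hlaw i, integral_map (hZ i).aemeasurable (hm.pow_const 2).aestronglyMeasurable]
  have hi : iIndepFun (fun i ω => h (Z i ω)) P := hind.comp (fun _ => h) fun _ => hm
  refine ⟨?_, ?_, ?_⟩
  · rw [integral_const_mul, integral_finsetSum _ fun i _ => (hL i).integrable (by norm_num)]
    simp only [hint, Finset.sum_const, Finset.card_range, nsmul_eq_mul]
    field_simp
  · exact (memLp_finsetSum _ fun i _ => hL i).const_mul _
  · rw [variance_const_mul]
    have hs : Var[fun ω => ∑ i ∈ Finset.range n, h (Z i ω); P]
        = ∑ i ∈ Finset.range n, Var[fun ω => h (Z i ω); P] := by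
      have := IndepFun.variance_sum (μ := P) (X := fun i ω => h (Z i ω)) (s := Finset.range n)
        (fun i _ => hL i) (fun i _ j _ hij => hi.indepFun hij)
      rw [← this]
      congr 1
      ext ω
      simp
    rw [hs]
    have hv : ∀ i ∈ Finset.range n, Var[fun ω => h (Z i ω); P] ≤ ∫ z, h z ^ 2 ∂ρ := fun i _ => by
      rw [← hint2 i]
      exact variance_le_expectation_sq (hmi i).aestronglyMeasurable
    calc ((n : ℝ)⁻¹) ^ 2 * _ ≤ ((n : ℝ)⁻¹) ^ 2 * ∑ i ∈ Finset.range n, ∫ z, h z ^ 2 ∂ρ :=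
          mul_le_mul_of_nonneg_left (Finset.sum_le_sum hv) (by positivity)
      _ = _ := by
        simp only [Finset.sum_const, Finset.card_range, nsmul_eq_mul]
        field_simp

end Probability

/-! ### Studentised means of kernels with diverging second moments -/

section Probability

variable {S Ω : Type*} [MeasurableSpace S] [MeasurableSpace Ω]

/-- The empirical mean `n⁻¹ ∑_{i<n} h (z i)`. -/
def empMean (h : S → ℝ) (n : ℕ) (z : ℕ → S) : ℝ :=
  (n : ℝ)⁻¹ * ∑ i ∈ Finset.range n, h (z i)

/-- The empirical standard deviation. -/
def empSd (h : S → ℝ) (n : ℕ) (z : ℕ → S) : ℝ :=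
  √(empMean (fun s => h s ^ 2) n z - empMean h n z ^ 2)

lemma measurable_empMean {h : S → ℝ} (hm : Measurable h) (n : ℕ) {Z : ℕ → Ω → S}
    (hZ : ∀ i, Measurable (Z i)) : Measurable fun ω => empMean h n (fun i => Z i ω) :=
  (Finset.measurable_sum _ fun i _ => hm.comp (hZ i)).const_mul _

lemma measurable_empSd {h : S → ℝ} (hm : Measurable h) (n : ℕ) {Z : ℕ → Ω → S}
    (hZ : ∀ i, Measurable (Z i)) : Measurable fun ω => empSd h n (fun i => Z i ω) :=
  ((measurable_empMean (hm.pow_const 2) n hZ).sub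
    ((measurable_empMean hm n hZ).pow_const 2)).sqrt

/-- The ratio of the empirical variance to the second moment tends to one in probability, for
kernels with diverging second moments `v n` and bounded means. -/
lemma tendstoInMeasure_empVar_div {P : Measure Ω} [IsProbabilityMeasure P]
    {ρ : Measure S} [IsProbabilityMeasure ρ] {Z : ℕ → Ω → S} (hZ : ∀ i, Measurable (Z i))
    (hind : iIndepFun Z P) (hlaw : ∀ i, P.map (Z i) = ρ)
    {g : ℕ → S → ℝ} (hg : ∀ n, Measurable (g n)) {M : ℕ → ℝ} (hM : ∀ n z, |g n z| ≤ M n)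
    {v : ℕ → ℝ} (hvdef : ∀ n, ∫ z, g n z ^ 2 ∂ρ = v n) (hv : Tendsto v atTop atTop)
    {m₀ : ℝ} (hm₀ : ∀ᶠ n in atTop, |∫ z, g n z ∂ρ| ≤ m₀)
    (hMv : Tendsto (fun n : ℕ => M n ^ 2 / (n * v n)) atTop (𝓝 0)) :
    TendstoInMeasure P (fun n ω => (empMean (fun s => g n s ^ 2) n (fun i => Z i ω)
      - empMean (g n) n (fun i => Z i ω) ^ 2) / v n) atTop fun _ => 1 := by
  have hvpos : ∀ᶠ n in atTop, 0 < v n := hv.eventually_gt_atTop 0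
  have hn0 : ∀ᶠ n : ℕ in atTop, 0 < n := eventually_gt_atTop 0
  have hinv : Tendsto (fun n : ℕ => (n : ℝ)⁻¹) atTop (𝓝 0) := tendsto_inv_atTop_nhds_zero_nat
  have hinvv : Tendsto (fun n : ℕ => (v n)⁻¹) atTop (𝓝 0) := tendsto_inv_atTop_zero.comp hv
  have hM0 : ∀ n, 0 ≤ M n := fun n => by
    obtain ⟨z⟩ : Nonempty S := by
      by_contra hne
      rw [not_nonempty_iff] at hne
      have := measure_univ (μ := ρ)
      rw [Set.univ_eq_empty_iff.2 hne, measure_empty] at this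
      exact zero_ne_one this
    exact (abs_nonneg _).trans (hM n z)
  have hM2 : ∀ n z, |g n z ^ 2| ≤ M n ^ 2 := fun n z => by
    rw [abs_pow]
    exact pow_le_pow_left₀ (abs_nonneg _) (hM n z) 2
  -- the empirical second moment
  have hA : TendstoInMeasure P (fun n ω => empMean (fun s => g n s ^ 2) n (fun i => Z i ω) / v n)
      atTop fun _ => 1 := by
    have key : ∀ n, 0 < n → _ := fun n hn =>
      variance_mean_le hZ hind hlaw ((hg n).pow_const 2) (hM2 n) hn
    have hdiv : ∀ n, (fun ω => empMean (fun s => g n s ^ 2) n (fun i => Z i ω) / v n)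
        = fun ω => (v n)⁻¹ * ((n : ℝ)⁻¹ * ∑ i ∈ Finset.range n, g n (Z i ω) ^ 2) := fun n => by
      ext ω
      rw [div_eq_inv_mul]
      rfl
    refine tendstoInMeasure_of_variance (fun n => ?_) ?_ ?_
    · rw [hdiv]
      rcases Nat.eq_zero_or_pos n with rfl | hn
      · simp
      · exact (key n hn).2.1.const_mul _
    · refine tendsto_const_nhds.congr' ?_
      filter_upwards [hvpos, hn0] with n hvn hn
      rw [hdiv, integral_const_mul, (key n hn).1, hvdef]
      exact (inv_mul_cancel₀ hvn.ne').symm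
    · refine squeeze_zero' (Eventually.of_forall fun n => variance_nonneg _ _) ?_ hMv
      filter_upwards [hvpos, hn0] with n hvn hn
      rw [hdiv, variance_const_mul]
      -- The fourth moment is at most sup² times the second moment; after division by `v n ^ 2` the
      -- variance is at most `M n ^ 2 / (n * v n)`.
      have h4 : ∫ z, (g n z ^ 2) ^ 2 ∂ρ ≤ M n ^ 2 * v n := by
        rw [← hvdef, ← integral_const_mul]
        refine integral_mono_of_nonneg (ae_of_all _ fun z => by positivity) ?_
          (ae_of_all _ fun z => ?_)
        · exact (integrable_of_measurable_of_abs_le ((hg n).pow_const 2) (hM2 n)).const_mul _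
        · have := le_of_abs_le (hM2 n z)
          simp only
          rw [sq (g n z ^ 2)]
          exact mul_le_mul_of_nonneg_right this (sq_nonneg _)
      have hn' : (0 : ℝ) < n := by exact_mod_cast hn
      calc (v n)⁻¹ ^ 2 * _ ≤ (v n)⁻¹ ^ 2 * ((n : ℝ)⁻¹ * (M n ^ 2 * v n)) := by
            refine mul_le_mul_of_nonneg_left ((key n hn).2.2.trans ?_) (by positivity)
            exact mul_le_mul_of_nonneg_left h4 (by positivity)
        _ = M n ^ 2 / (n * v n) := by field_simp
  -- the empirical mean
  have hB : TendstoInMeasure P (fun n ω => empMean (g n) n (fun i => Z i ω) * (√(v n))⁻¹)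
      atTop fun _ => 0 := by
    have key : ∀ n, 0 < n → _ := fun n hn => variance_mean_le hZ hind hlaw (hg n) (hM n) hn
    have hdiv : ∀ n, (fun ω => empMean (g n) n (fun i => Z i ω) * (√(v n))⁻¹)
        = fun ω => (√(v n))⁻¹ * ((n : ℝ)⁻¹ * ∑ i ∈ Finset.range n, g n (Z i ω)) := fun n => by
      ext ω
      rw [mul_comm]
      rfl
    refine tendstoInMeasure_of_variance (fun n => ?_) ?_ ?_
    · rw [hdiv]
      rcases Nat.eq_zero_or_pos n with rfl | hn
      · simp
      · exact (key n hn).2.1.const_mul _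
    -- Bounded means divided by a diverging scale: centring is negligible in the empirical variance.
    · have hs : Tendsto (fun n => (√(v n))⁻¹ * m₀) atTop (𝓝 0) := by
        simpa using (tendsto_inv_atTop_zero.comp (Real.tendsto_sqrt_atTop.comp hv)).mul_const m₀
      refine squeeze_zero_norm' ?_ hs
      filter_upwards [hvpos, hn0, hm₀] with n hvn hn hm
      rw [hdiv, integral_const_mul, (key n hn).1, norm_mul, Real.norm_eq_abs, Real.norm_eq_abs,
        abs_of_nonneg (inv_nonneg.2 (Real.sqrt_nonneg _))]
      exact mul_le_mul_of_nonneg_left hm (inv_nonneg.2 (Real.sqrt_nonneg _))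
    · refine squeeze_zero' (Eventually.of_forall fun n => variance_nonneg _ _) ?_ hinv
      filter_upwards [hvpos, hn0] with n hvn hn
      have hk := (key n hn).2.2
      rw [hvdef] at hk
      rw [hdiv, variance_const_mul, inv_pow, Real.sq_sqrt hvn.le]
      calc (v n)⁻¹ * _ ≤ (v n)⁻¹ * ((n : ℝ)⁻¹ * v n) :=
            mul_le_mul_of_nonneg_left hk (inv_nonneg.2 hvn.le)
        _ = (n : ℝ)⁻¹ := by field_simp
  have hB2 : TendstoInMeasure P (fun n ω => (empMean (g n) n (fun i => Z i ω) * (√(v n))⁻¹) ^ 2)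
      atTop fun _ => 0 :=
    TendstoInMeasure.comp_continuousAt_const hB (fun r => r ^ 2) (by fun_prop) (by simp)
  have hsub : TendstoInMeasure P (fun n ω =>
      empMean (fun s => g n s ^ 2) n (fun i => Z i ω) / v n
        - (empMean (g n) n (fun i => Z i ω) * (√(v n))⁻¹) ^ 2) atTop fun _ => 1 := by
    rw [tendstoInMeasure_iff_dist] at hA hB2 ⊢
    intro ε hε
    have h1 := hA (ε / 2) (by positivity)
    have h2 := hB2 (ε / 2) (by positivity)
    have h12 := h1.add h2
    rw [add_zero] at h12
    refine tendsto_of_tendsto_of_tendsto_of_le_of_le tendsto_const_nhds h12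
      (fun _ => zero_le) fun n => (measure_mono fun ω hω => ?_).trans (measure_union_le _ _)
    simp only [Set.mem_union, Set.mem_ofPred_eq, Real.dist_eq] at hω ⊢
    by_contra hc
    push Not at hc
    have := abs_sub (empMean (fun s => g n s ^ 2) n (fun i => Z i ω) / v n - 1)
      ((empMean (g n) n (fun i => Z i ω) * (√(v n))⁻¹) ^ 2 - 0)
    have e : empMean (fun s => g n s ^ 2) n (fun i => Z i ω) / v n - 1
      - ((empMean (g n) n (fun i => Z i ω) * (√(v n))⁻¹) ^ 2 - 0)
      = empMean (fun s => g n s ^ 2) n (fun i => Z i ω) / v n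
        - (empMean (g n) n (fun i => Z i ω) * (√(v n))⁻¹) ^ 2 - 1 := by ring
    rw [e] at this
    linarith
  refine hsub.congr' ?_ (ae_eq_refl _)
  filter_upwards [hvpos] with n hvn
  refine ae_of_all _ fun ω => ?_
  simp only
  rw [mul_pow, inv_pow, Real.sq_sqrt hvn.le, sub_div, ← div_eq_mul_inv]

/-- Asymptotic normality of self-normalised means of bounded kernels. -/
theorem tendstoInDistribution_selfNormalised {P : Measure Ω} [IsProbabilityMeasure P]
    {ρ : Measure S} [IsProbabilityMeasure ρ] {Z : ℕ → Ω → S} (hZ : ∀ i, Measurable (Z i))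
    (hind : iIndepFun Z P) (hlaw : ∀ i, P.map (Z i) = ρ)
    {g : ℕ → S → ℝ} (hg : ∀ n, Measurable (g n)) {M : ℕ → ℝ} (hM : ∀ n z, |g n z| ≤ M n)
    {v : ℕ → ℝ} (hvdef : ∀ n, ∫ z, g n z ^ 2 ∂ρ = v n) (hv : Tendsto v atTop atTop)
    {m : ℕ → ℝ} (hmdef : ∀ n, ∫ z, g n z ∂ρ = m n)
    {m₀ : ℝ} (hm₀ : ∀ᶠ n in atTop, |m n| ≤ m₀)
    (hMv : Tendsto (fun n : ℕ => M n ^ 2 / (n * v n)) atTop (𝓝 0))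
    {b : ℝ} (hb : Tendsto (fun n : ℕ => √(n : ℝ) * (m n - b) / √(v n))
      atTop (𝓝 0)) :
    TendstoInDistribution (fun (n : ℕ) ω => √(n : ℝ) * (empMean (g n) n (fun i => Z i ω) - b)
      / empSd (g n) n (fun i => Z i ω)) atTop id (fun _ => P) (gaussianReal 0 1) ∧
    Tendsto (fun n => P {ω | empSd (g n) n (fun i => Z i ω) = 0}) atTop (𝓝 0) := by
  have hR := tendstoInMeasure_empVar_div hZ hind hlaw hg hM hvdef hv (m₀ := m₀) (by simpa only [hmdef] using hm₀) hMv
  have hvpos : ∀ᶠ n in atTop, 0 < v n := hv.eventually_gt_atTop 0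
  have hn0 : ∀ᶠ n : ℕ in atTop, 0 < n := eventually_gt_atTop 0
  have hsinv : Tendsto (fun n => (√(v n))⁻¹) atTop (𝓝 0) :=
    tendsto_inv_atTop_zero.comp (Real.tendsto_sqrt_atTop.comp hv)
  have hint : ∀ n, Integrable (g n) ρ := fun n => integrable_of_measurable_of_abs_le (hg n) (hM n)
  have hint2 : ∀ n, Integrable (fun z => g n z ^ 2) ρ := fun n =>
    integrable_of_measurable_of_abs_le ((hg n).pow_const 2) (M := M n ^ 2) fun z => by
      rw [abs_pow]
      exact pow_le_pow_left₀ (abs_nonneg _) (hM n z) 2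
  -- the central limit theorem for the centred kernels
  set h : ℕ → S → ℝ := fun n z => (g n z - m n) * (√(v n))⁻¹ with hhdef
  have hW : TendstoInDistribution
      (fun (n : ℕ) ω => (√(n : ℝ))⁻¹ * ∑ i ∈ Finset.range n, h n (Z i ω))
      atTop id (fun _ => P) (gaussianReal 0 1) := by
    refine tendstoInDistribution_row_sum hZ hind hlaw (h := h)
      -- Chosen so that `δ n * √n = (M n + m₀) / √(v n)`, which bounds the centred and scaled
      -- kernel.
      (δ := fun n => √(M n ^ 2 / (n * v n)) + m₀ * (√(n : ℝ))⁻¹ * (√(v n))⁻¹)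
      (fun n => ((hg n).sub_const _).mul_const _) ?_ ?_ ?_ ?_
    · have h1 : Tendsto (fun n : ℕ => √(M n ^ 2 / (n * v n))) atTop (𝓝 0) := by
        simpa [Function.comp_def] using (Real.continuous_sqrt.tendsto 0).comp hMv
      have h2 : Tendsto (fun n : ℕ => (√(n : ℝ))⁻¹) atTop (𝓝 0) :=
        tendsto_inv_atTop_zero.comp (Real.tendsto_sqrt_atTop.comp tendsto_natCast_atTop_atTop)
      simpa using h1.add ((h2.const_mul m₀).mul hsinv)
    · filter_upwards [hvpos, hn0, hm₀] with n hvn hn hmn z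
      have hn' : (0 : ℝ) < n := by exact_mod_cast hn
      have hs := Real.sqrt_pos.2 hn'
      have hsv := Real.sqrt_pos.2 hvn
      have hM0 : 0 ≤ M n := (abs_nonneg _).trans (hM n z)
      rw [hhdef]
      simp only
      rw [abs_mul, abs_of_pos (inv_pos.2 hsv), Real.sqrt_div (sq_nonneg _), Real.sqrt_sq hM0,
        Real.sqrt_mul hn'.le]
      have e : (M n / (√(n : ℝ) * √(v n)) + m₀ * (√(n : ℝ))⁻¹ * (√(v n))⁻¹) * √(n : ℝ)
          = (M n + m₀) * (√(v n))⁻¹ := by field_simp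
      rw [e]
      refine mul_le_mul_of_nonneg_right ?_ (inv_pos.2 hsv).le
      exact (abs_sub _ _).trans (add_le_add (hM n z) hmn)
    · refine Eventually.of_forall fun n => ?_
      rw [hhdef]
      simp only
      rw [integral_mul_const, integral_sub (hint n) (integrable_const _)]
      simp [hmdef]
    -- Scaling by the second moment instead of the variance leaves a defect `m² / v`, which vanishes
    -- in the limit.
    · have e : ∀ᶠ n in atTop, ∫ z, h n z ^ 2 ∂ρ = 1 - m n ^ 2 * (v n)⁻¹ := by
        filter_upwards [hvpos] with n hvn
        have : ∀ z, h n z ^ 2 = (v n)⁻¹ * (g n z ^ 2 - 2 * m n * g n z + m n ^ 2) := fun z => by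
          rw [hhdef]
          simp only
          rw [mul_pow, inv_pow, Real.sq_sqrt hvn.le]
          ring
        simp only [this]
        have i1 : Integrable (fun z => 2 * m n * g n z) ρ := (hint n).const_mul _
        have i2 : Integrable (fun z => g n z ^ 2 - 2 * m n * g n z) ρ := (hint2 n).sub i1
        rw [integral_const_mul, integral_add i2 (integrable_const _), integral_sub (hint2 n) i1,
          integral_const_mul]
        simp only [integral_const, probReal_univ, smul_eq_mul, one_mul]
        rw [hvdef, hmdef]
        field_simp
        ring
      refine Tendsto.congr' (EventuallyEq.symm e) ?_
      have : Tendsto (fun n => m n ^ 2 * (v n)⁻¹) atTop (𝓝 0) := by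
        have hb : Tendsto (fun n => m₀ ^ 2 * (v n)⁻¹) atTop (𝓝 0) := by
          simpa using (tendsto_inv_atTop_zero.comp hv).const_mul (m₀ ^ 2)
        refine squeeze_zero' ?_ ?_ hb
        · filter_upwards [hvpos] with n hvn
          positivity
        · filter_upwards [hvpos, hm₀] with n hvn hmn
          refine mul_le_mul_of_nonneg_right ?_ (inv_pos.2 hvn).le
          rw [← sq_abs]
          exact pow_le_pow_left₀ (abs_nonneg _) hmn 2
      simpa using this.const_sub 1
  -- Slutsky
  set R : ℕ → Ω → ℝ := fun n ω => (empMean (fun s => g n s ^ 2) n (fun i => Z i ω)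
      - empMean (g n) n (fun i => Z i ω) ^ 2) / v n with hRdef
  have hRm : ∀ n, Measurable (R n) := fun n =>
    ((measurable_empMean ((hg n).pow_const 2) n hZ).sub
      ((measurable_empMean (hg n) n hZ).pow_const 2)).div_const _
  have hY : TendstoInMeasure P (fun n ω => (√(R n ω))⁻¹) atTop fun _ => (1 : ℝ) := by
    have hc : ContinuousAt (fun r : ℝ => (√r)⁻¹) 1 :=
      Real.continuous_sqrt.continuousAt.inv₀ (by simp)
    exact TendstoInMeasure.comp_continuousAt_const hR _ hc (by simp)
  have hbias : TendstoInMeasure P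
      (fun (n : ℕ) (_ : Ω) => √(n : ℝ) * (m n - b) / √(v n)) atTop fun _ => (0 : ℝ) :=
    tendstoInMeasure_of_tendsto_ae (fun n => aestronglyMeasurable_const) (ae_of_all _ fun _ => hb)
  -- The studentised statistic is (centred sum + normalised bias) times `(√R)⁻¹`; the last two
  -- converge in probability to 0 and 1.
  have hsum := hW.add_of_tendstoInMeasure_const hbias (fun n => aemeasurable_const)
  have hprod := hsum.continuous_comp_prodMk_of_tendstoInMeasure_const
    (g := fun p : ℝ × ℝ => p.1 * p.2) (by fun_prop) hY
    (fun n => (hRm n).sqrt.inv.aemeasurable)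
  have hmeas : ∀ n : ℕ, Measurable fun ω => √(n : ℝ) * (empMean (g n) n (fun i => Z i ω) - b)
      / empSd (g n) n (fun i => Z i ω) := fun n =>
    (((measurable_empMean (hg n) n hZ).sub_const b).const_mul _).div
      (measurable_empSd (hg n) n hZ)
  refine ⟨⟨fun n => (hmeas n).aemeasurable, aemeasurable_id, ?_⟩, ?_⟩
  · have hlim := hprod.congr (T := id) (fun _ => ae_eq_refl _) (ae_of_all _ fun _ => by simp)
    refine hlim.tendsto.congr' ?_
    filter_upwards [hvpos, hn0] with n hvn hn
    have hn' : (0 : ℝ) < n := by exact_mod_cast hn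
    have hs := Real.sqrt_pos.2 hn'
    have hsv := Real.sqrt_pos.2 hvn
    congr 2
    ext ω
    simp only [Pi.add_apply]
    -- This holds also where the empirical deviation is zero: both sides are then 0 by the
    -- convention for division.
    have hsR : (√(R n ω))⁻¹ = √(v n) * (empSd (g n) n (fun i => Z i ω))⁻¹ := by
      rw [hRdef]
      simp only
      rw [Real.sqrt_div' _ hvn.le, inv_div, div_eq_mul_inv]
      rfl
    have hsumh : ∑ i ∈ Finset.range n, h n (Z i ω)
        = n * (empMean (g n) n (fun i => Z i ω) - m n) * (√(v n))⁻¹ := by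
      rw [hhdef]
      simp only
      rw [← Finset.sum_mul, Finset.sum_sub_distrib, empMean]
      simp only [Finset.sum_const, Finset.card_range, nsmul_eq_mul]
      field_simp
    rw [hsR, hsumh]
    have hnn : (n : ℝ) = √(n : ℝ) * √(n : ℝ) := (Real.mul_self_sqrt hn'.le).symm
    rw [div_eq_mul_inv _ (empSd (g n) n fun i => Z i ω), ← mul_assoc]
    congr 1
    rw [add_mul, div_mul_cancel₀ _ hsv.ne']
    calc _ = (√(n : ℝ))⁻¹ * (n * (empMean (g n) n (fun i => Z i ω) - m n))
            * ((√(v n))⁻¹ * √(v n)) + √(n : ℝ) * (m n - b) := by ring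
      _ = (√(n : ℝ))⁻¹ * (√(n : ℝ) * √(n : ℝ) * (empMean (g n) n (fun i => Z i ω) - m n))
            * 1 + √(n : ℝ) * (m n - b) := by rw [← hnn, inv_mul_cancel₀ hsv.ne']
      _ = _ := by
        field_simp
        ring
  · rw [tendstoInMeasure_iff_dist] at hR
    -- A vanishing deviation forces `R ≤ 0`, hence distance at least 1 from the limit 1 of `R`.
    refine tendsto_of_tendsto_of_tendsto_of_le_of_le' tendsto_const_nhds (hR 1 one_pos)
      (Eventually.of_forall fun _ => zero_le) ?_
    filter_upwards [hvpos] with n hvn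
    refine measure_mono fun ω hω => ?_
    simp only [Set.mem_ofPred_eq, Real.dist_eq] at hω ⊢
    rw [empSd, Real.sqrt_eq_zero'] at hω
    have : R n ω ≤ 0 := div_nonpos_of_nonpos_of_nonneg hω hvn.le
    change 1 ≤ |R n ω - 1|
    rw [abs_of_nonpos (by linarith)]
    linarith

end Probability

/-! ### Normal quantiles and asymptotic coverage -/

section Probability

variable {Ω : Type*} [MeasurableSpace Ω]

instance instNullSingletonClassGaussianStd : NullSingletonClass (gaussianReal 0 1) :=
  nullSingletonClass_gaussianReal one_ne_zero

/-- To the left of the infimum the distribution function is below `1 - p`, and the absence of atoms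
makes its left limit equal to its value. The other inequality is right continuity. -/
lemma cdf_normalUpperQuantile {p : ℝ} (hp0 : 0 < p) (hp1 : p < 1) :
    cdf (gaussianReal 0 1) (normalUpperQuantile p) = 1 - p := by
  set Φ := cdf (gaussianReal 0 1) with hΦ
  set A : Set ℝ := {t : ℝ | 1 - p ≤ Φ t} with hA
  have hne : A.Nonempty := by
    have := (tendsto_cdf_atTop (gaussianReal 0 1)).eventually_const_le (show 1 - p < 1 by linarith)
    obtain ⟨t, ht⟩ := this.exists
    exact ⟨t, ht⟩
  have hbdd : BddBelow A := by
    have := (tendsto_cdf_atBot (gaussianReal 0 1)).eventually_lt_const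
      (show 0 < 1 - p by linarith)
    obtain ⟨t, ht⟩ := this.exists
    refine ⟨t, fun s hs => ?_⟩
    by_contra hc
    exact absurd ((monotone_cdf _ (not_le.1 hc).le).trans_lt ht) (not_lt.2 hs)
  have hz : normalUpperQuantile p = sInf A := rfl
  set z := normalUpperQuantile p
  apply le_antisymm
  · have h1 := (Φ).measure_singleton z
    rw [hΦ, measure_cdf, measure_singleton, ← hΦ] at h1
    have h2 : Φ z ≤ Function.leftLim Φ z := by
      have := ENNReal.ofReal_eq_zero.1 h1.symm
      linarith
    refine h2.trans (le_of_tendsto ((monotone_cdf (gaussianReal 0 1)).tendsto_leftLim z) ?_)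
    filter_upwards [self_mem_nhdsWithin] with t ht
    by_contra hc
    exact absurd (csInf_le hbdd (show t ∈ A from (not_le.1 hc).le)) (by rw [← hz]; exact not_le.2 ht)
  · have h1 : Tendsto Φ (𝓝[>] z) (𝓝 (Φ z)) :=
      ((Φ).right_continuous z).tendsto.mono_left (nhdsWithin_mono _ Set.Ioi_subset_Ici_self)
    refine ge_of_tendsto h1 ?_
    filter_upwards [self_mem_nhdsWithin] with t ht
    obtain ⟨s, hs, hst⟩ := exists_lt_of_csInf_lt hne (show sInf A < t by rw [← hz]; exact ht)
    exact (show 1 - p ≤ Φ s from hs).trans (monotone_cdf _ hst.le)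

lemma cdf_gaussianReal_neg (z : ℝ) :
    cdf (gaussianReal 0 1) (-z) = 1 - cdf (gaussianReal 0 1) z := by
  have hneg : (gaussianReal 0 1).map (fun x => -x) = gaussianReal 0 1 := by
    simp [gaussianReal_map_neg]
  rw [cdf_eq_real, cdf_eq_real]
  have h1 : (gaussianReal 0 1).real (Set.Iic (-z)) = (gaussianReal 0 1).real (Set.Ici z) := by
    conv_lhs => rw [← hneg]
    rw [map_measureReal_apply measurable_neg measurableSet_Iic]
    congr 1
    ext x
    simp
  have h2 : (gaussianReal 0 1).real (Set.Ici z) = (gaussianReal 0 1).real (Set.Ioi z) := by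
    simp only [Measure.real, measure_congr Ioi_ae_eq_Ici]
  rw [h1, h2, ← Set.compl_Iic, probReal_compl_eq_one_sub measurableSet_Iic]

lemma gaussianReal_Ioo_quantile {α : ℝ} (h0 : 0 < α) (h1 : α < 1) :
    0 < normalUpperQuantile (α / 2) ∧
    (gaussianReal 0 1).real (Set.Ioo (-normalUpperQuantile (α / 2)) (normalUpperQuantile (α / 2)))
      = 1 - α := by
  have hz := cdf_normalUpperQuantile (p := α / 2) (by linarith) (by linarith)
  set z := normalUpperQuantile (α / 2)
  have hneg := cdf_gaussianReal_neg z
  -- If `z ≤ 0`, monotonicity would give `1 - α/2 ≤ α/2`, against `α < 1`.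
  have hpos : 0 < z := by
    by_contra hc
    have := monotone_cdf (gaussianReal 0 1) (show z ≤ -z by linarith)
    linarith
  refine ⟨hpos, ?_⟩
  have e : (gaussianReal 0 1).real (Set.Ioo (-z) z) = (gaussianReal 0 1).real (Set.Ioc (-z) z) := by
    simp only [Measure.real, measure_congr Ioo_ae_eq_Ioc]
  rw [e, ← Set.Iic_sdiff_Iic, measureReal_sdiff (Set.Iic_subset_Iic.2 (by linarith))
    measurableSet_Iic, ← cdf_eq_real, ← cdf_eq_real, hneg, hz]
  ring

/-- Asymptotic coverage of the confidence interval attached to a studentised statistic. -/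
theorem tendsto_coverage {P : Measure Ω} [IsProbabilityMeasure P] {e s : ℕ → Ω → ℝ} {b : ℝ}
    (hs : ∀ n ω, 0 ≤ s n ω)
    (hd : TendstoInDistribution (fun (n : ℕ) ω => √(n : ℝ) * (e n ω - b) / s n ω)
      atTop id (fun _ => P) (gaussianReal 0 1))
    (h0 : Tendsto (fun n => P {ω | s n ω = 0}) atTop (𝓝 0))
    {α : ℝ} (hα0 : 0 < α) (hα1 : α < 1) :
    Tendsto (fun n : ℕ => P.real {ω | b ∈ Set.Ioo
      (e n ω - normalUpperQuantile (α / 2) * (s n ω / √(n : ℝ)))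
      (e n ω + normalUpperQuantile (α / 2) * (s n ω / √(n : ℝ)))}) atTop (𝓝 (1 - α)) := by
  obtain ⟨hz, hI⟩ := gaussianReal_Ioo_quantile hα0 hα1
  set z := normalUpperQuantile (α / 2)
  have hfr : (gaussianReal 0 1) (frontier (Set.Ioo (-z) z)) = 0 := by
    rw [frontier_Ioo (by linarith)]
    exact (Set.toFinite _).measure_zero _
  have hlim := ProbabilityMeasure.tendsto_measure_of_null_frontier_of_tendsto' hd.tendsto
    (E := Set.Ioo (-z) z) (by simpa using hfr)
  simp only [ProbabilityMeasure.coe_mk, Measure.map_id] at hlim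
  have hlim' : Tendsto (fun n : ℕ => P.real
      {ω | √(n : ℝ) * (e n ω - b) / s n ω ∈ Set.Ioo (-z) z}) atTop (𝓝 (1 - α)) := by
    rw [← hI]
    have := (ENNReal.tendsto_toReal (measure_ne_top (gaussianReal 0 1) _)).comp hlim
    refine this.congr fun n => ?_
    simp only [Function.comp, Measure.real]
    rw [Measure.map_apply_of_aemeasurable (hd.forall_aemeasurable n) measurableSet_Ioo]
    rfl
  have h0' : Tendsto (fun n => P.real {ω | s n ω = 0}) atTop (𝓝 0) := by
    simpa [Function.comp_def, Measure.real] using (ENNReal.tendsto_toReal ENNReal.zero_ne_top).comp h0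
  -- The coverage event and the event for the quotient agree where `s ≠ 0`. Where `s = 0` the
  -- interval is empty while the quotient is 0, so coverage is squeezed between the quotient's
  -- probability and that probability minus `P (s = 0)`.
  have hlow : Tendsto (fun n : ℕ => P.real
      {ω | √(n : ℝ) * (e n ω - b) / s n ω ∈ Set.Ioo (-z) z} - P.real {ω | s n ω = 0}) atTop
      (𝓝 (1 - α)) := by simpa using hlim'.sub h0'
  have key : ∀ (n : ℕ) ω, 0 < n → s n ω ≠ 0 →
      (√(n : ℝ) * (e n ω - b) / s n ω ∈ Set.Ioo (-z) z ↔
        b ∈ Set.Ioo (e n ω - z * (s n ω / √(n : ℝ))) (e n ω + z * (s n ω / √(n : ℝ)))) := by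
    intro n ω hn hsn
    have hn' : 0 < √(n : ℝ) := Real.sqrt_pos.2 (by exact_mod_cast hn)
    have hsp : 0 < s n ω := lt_of_le_of_ne (hs n ω) (Ne.symm hsn)
    have e1 : z * (s n ω / √(n : ℝ)) = z * s n ω / √(n : ℝ) := by ring
    rw [Set.mem_Ioo, Set.mem_Ioo, lt_div_iff₀ hsp, div_lt_iff₀ hsp, e1, sub_lt_comm,
      ← sub_lt_iff_lt_add', lt_div_iff₀ hn', lt_div_iff₀ hn']
    constructor
    · rintro ⟨h1, h2⟩
      constructor <;> linarith
    · rintro ⟨h1, h2⟩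
      constructor <;> linarith
  refine tendsto_of_tendsto_of_tendsto_of_le_of_le' hlow hlim' ?_ ?_
  · filter_upwards [eventually_gt_atTop 0] with n hn
    rw [sub_le_iff_le_add]
    refine (measureReal_mono fun ω hω => ?_).trans (measureReal_union_le _ _)
    by_cases hsn : s n ω = 0
    · exact Or.inr hsn
    · exact Or.inl ((key n ω hn hsn).1 hω)
  · filter_upwards [eventually_gt_atTop 0] with n hn
    refine measureReal_mono fun ω hω => ?_
    by_cases hsn : s n ω = 0
    · simp only [Set.mem_ofPred_eq, hsn] at hω ⊢
      simp at hω
    · exact (key n ω hn hsn).2 hω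

end Probability

/-! ### Harmonic decomposition of polynomials, and symmetries of harmonic spaces -/

section Polynomials

open MvPolynomial

variable {d : ℕ}

lemma polyLaplacian_apply (p : MvPolynomial (Fin (d + 1)) ℂ) :
    polyLaplacian d p = ∑ i, pderiv i (pderiv i p) := by
  simp [polyLaplacian, LinearMap.sum_apply]

lemma restrictToSphere_apply (p : MvPolynomial (Fin (d + 1)) ℂ) (x : Sph d) :
    restrictToSphere d p x = aeval (fun i => ((x.1 i : ℝ) : ℂ)) p := rfl

/-- The polynomial `∑ᵢ Xᵢ²`. -/
def radiusSq (d : ℕ) : MvPolynomial (Fin (d + 1)) ℂ := ∑ i, X i ^ 2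

lemma radiusSq_isHomogeneous : (radiusSq d).IsHomogeneous 2 :=
  IsHomogeneous.sum _ _ _ fun i _ => by simpa using (isHomogeneous_X ℂ i).pow 2

lemma radiusSq_ne_zero : radiusSq d ≠ 0 := by
  intro h
  have := congrArg (aeval fun i : Fin (d + 1) => (1 : ℂ)) h
  simp only [radiusSq, map_sum, map_pow, aeval_X, one_pow, map_zero, Finset.sum_const,
    Finset.card_univ, Fintype.card_fin, nsmul_eq_mul, mul_one] at this
  exact Nat.cast_ne_zero.2 (Nat.succ_ne_zero d) this

lemma restrictToSphere_radiusSq_mul (q : MvPolynomial (Fin (d + 1)) ℂ) :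
    restrictToSphere d (radiusSq d * q) = restrictToSphere d q := by
  ext x
  have hx : ∑ i, (x.1 i) ^ 2 = 1 := by
    have h1 : ‖x.1‖ = 1 := by simp
    rw [← EuclideanSpace.real_norm_sq_eq, h1, one_pow]
  have hx' : ∑ i, ((x.1 i : ℝ) : ℂ) ^ 2 = 1 := by exact_mod_cast congrArg (Complex.ofReal) hx
  rw [restrictToSphere_apply, restrictToSphere_apply, map_mul, radiusSq]
  simp [hx']

/-- Leibniz's rule produces the cross term `4 ∑ X_i ∂_i q`, which Euler's identity evaluates as `4 m
q`. -/
lemma polyLaplacian_radiusSq_mul {q : MvPolynomial (Fin (d + 1)) ℂ} {m : ℕ}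
    (hq : q.IsHomogeneous m) :
    polyLaplacian d (radiusSq d * q)
      = radiusSq d * polyLaplacian d q + C ((2 * (d + 1) + 4 * m : ℕ) : ℂ) * q := by
  have h1 : ∀ i : Fin (d + 1), pderiv i (radiusSq d) = 2 * X i := fun i => by
    simp only [radiusSq, map_sum, pderiv_pow]
    rw [Finset.sum_eq_single i]
    · simp
    · intro j _ hj
      simp [pderiv_X_of_ne hj]
    · simp
  have h2 : ∀ i : Fin (d + 1), pderiv i (pderiv i (radiusSq d * q))
      = radiusSq d * pderiv i (pderiv i q) + 4 * (X i * pderiv i q) + 2 * q := fun i => by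
    have h3 : pderiv i (2 : MvPolynomial (Fin (d + 1)) ℂ) = 0 := by
      rw [show (2 : MvPolynomial (Fin (d + 1)) ℂ) = C 2 from (map_ofNat C 2).symm, pderiv_C]
    simp only [pderiv_mul, h1, map_add, pderiv_X_self, h3]
    ring
  rw [polyLaplacian_apply, polyLaplacian_apply]
  simp only [h2, Finset.sum_add_distrib, ← Finset.mul_sum, hq.sum_X_mul_pderiv]
  simp only [Finset.sum_const, Finset.card_univ, Fintype.card_fin, nsmul_eq_mul]
  push_cast
  simp only [map_add, map_mul, map_natCast, map_one, map_ofNat]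
  ring

lemma isHomogeneous_polyLaplacian {q : MvPolynomial (Fin (d + 1)) ℂ} {m : ℕ}
    (hq : q.IsHomogeneous m) : (polyLaplacian d q).IsHomogeneous (m - 1 - 1) := by
  rw [polyLaplacian_apply]
  exact IsHomogeneous.sum _ _ _ fun i _ => hq.pderiv.pderiv

/-- Induction on the degree. The equation exhibits `q` as `|x|² q₁`; inserting this and cancelling
`|x|²` gives an equation of the same shape for `q₁` with a larger constant. Allowing an arbitrary
positive `c` is what lets the induction close. -/
lemma eq_zero_of_radiusSq_mul_polyLaplacian (m : ℕ) : ∀ {q : MvPolynomial (Fin (d + 1)) ℂ},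
    q.IsHomogeneous m → ∀ c : ℕ, 0 < c →
    radiusSq d * polyLaplacian d q + C (c : ℂ) * q = 0 → q = 0 := by
  induction m using Nat.strong_induction_on with
  | _ m ih =>
    intro q hq c hc h
    by_contra hne
    have hc' : (c : ℂ) ≠ 0 := Nat.cast_ne_zero.2 hc.ne'
    set q₁ : MvPolynomial (Fin (d + 1)) ℂ := C (-(c : ℂ)⁻¹) * polyLaplacian d q with hq₁
    have hqq : q = radiusSq d * q₁ := by
      have hcc : C (-(c : ℂ)⁻¹) * C (c : ℂ) = (-1 : MvPolynomial (Fin (d + 1)) ℂ) := by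
        rw [← C_mul, neg_mul, inv_mul_cancel₀ hc']
        simp
      calc q = -(-1) * q := by ring
        _ = radiusSq d * q₁ - C (-(c : ℂ)⁻¹) *
            (radiusSq d * polyLaplacian d q + C (c : ℂ) * q) := by
          rw [← hcc, hq₁]
          ring
        _ = radiusSq d * q₁ := by rw [h, mul_zero, sub_zero]
    have hh₁ : q₁.IsHomogeneous (m - 1 - 1) := by
      simpa using (isHomogeneous_C _ _).mul (isHomogeneous_polyLaplacian hq)
    -- A nonzero polynomial has only one degree of homogeneity; hence `m ≥ 2` and the truncated
    -- subtraction is genuine.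
    have hm : m = 2 + (m - 1 - 1) := by
      refine hq.inj_right ?_ hne
      rw [hqq]
      exact radiusSq_isHomogeneous.mul hh₁
    have h0 : radiusSq d * (radiusSq d * polyLaplacian d q₁
        + C ((2 * (d + 1) + 4 * (m - 1 - 1) + c : ℕ) : ℂ) * q₁) = 0 := by
      have := h
      rw [hqq, polyLaplacian_radiusSq_mul hh₁] at this
      rw [← this]
      push_cast
      simp only [map_add, map_mul, map_natCast, map_one, map_ofNat]
      ring
    have h1 := (mul_eq_zero.1 h0).resolve_left radiusSq_ne_zero
    have h2 := ih (m - 1 - 1) (by omega) hh₁ _ (by omega) h1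
    exact hne (by rw [hqq, h2, mul_zero])

/-- `q ↦ Δ(|x|² q)` is onto on homogeneous polynomials of a given degree. -/
lemma exists_polyLaplacian_radiusSq_mul_eq {p : MvPolynomial (Fin (d + 1)) ℂ} {m : ℕ}
    (hp : p.IsHomogeneous m) :
    ∃ q : MvPolynomial (Fin (d + 1)) ℂ, q.IsHomogeneous m ∧
      polyLaplacian d (radiusSq d * q) = p := by
  have : Module.Finite ℂ (homogeneousSubmodule (Fin (d + 1)) ℂ m) :=
    Module.Finite.iff_fg.2 (homogeneousSubmodule_fg _ _ m)
  let L : homogeneousSubmodule (Fin (d + 1)) ℂ m →ₗ[ℂ] homogeneousSubmodule (Fin (d + 1)) ℂ m :=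
    ((polyLaplacian d ∘ₗ LinearMap.mulLeft ℂ (radiusSq d)).restrict (by
      intro q hq
      have := isHomogeneous_polyLaplacian (radiusSq_isHomogeneous.mul hq)
      have e : 2 + m - 1 - 1 = m := by omega
      rw [e] at this
      exact this))
  have hL : Function.Injective L := by
    rw [injective_iff_map_eq_zero]
    rintro ⟨q, hq⟩ h
    have h' : polyLaplacian d (radiusSq d * q) = 0 := congrArg Subtype.val h
    rw [polyLaplacian_radiusSq_mul hq] at h'
    exact Subtype.ext (eq_zero_of_radiusSq_mul_polyLaplacian m hq _ (by omega) h')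
  -- An injective endomorphism of a finite-dimensional space is onto.
  obtain ⟨q, hq⟩ := LinearMap.surjective_of_injective hL ⟨p, hp⟩
  exact ⟨q.1, q.2, congrArg Subtype.val hq⟩

lemma polyLaplacian_eq_zero_of_isHomogeneous {p : MvPolynomial (Fin (d + 1)) ℂ} {m : ℕ}
    (hp : p.IsHomogeneous m) (hm : m < 2) : polyLaplacian d p = 0 := by
  rw [polyLaplacian_apply]
  refine Finset.sum_eq_zero fun i _ => ?_
  have h1 : (pderiv i p).IsHomogeneous 0 := by
    have := hp.pderiv (i := i)
    rwa [show m - 1 = 0 by omega] at this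
  rw [(totalDegree_eq_zero_iff_eq_C).1 ((totalDegree_zero_iff_isHomogeneous _).2 h1), pderiv_C]

/-- Choose `q` of degree `m - 2` with `Δ(|x|² q) = Δp`. Then `p - |x|² q` is harmonic, and on the
sphere `|x|² q` coincides with `q`, to which induction applies. -/
lemma restrictToSphere_mem_iSup_of_isHomogeneous (m : ℕ) :
    ∀ {p : MvPolynomial (Fin (d + 1)) ℂ}, p.IsHomogeneous m →
      restrictToSphere d p ∈ ⨆ l, harmonicSpace d l := by
  induction m using Nat.strong_induction_on with
  | _ m ih =>
    intro p hp
    rcases lt_or_ge m 2 with hm | hm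
    · refine Submodule.mem_iSup_of_mem m ?_
      exact Submodule.mem_map_of_mem ⟨hp, polyLaplacian_eq_zero_of_isHomogeneous hp hm⟩
    · have hΔ := isHomogeneous_polyLaplacian hp
      obtain ⟨q, hq, hqe⟩ := exists_polyLaplacian_radiusSq_mul_eq hΔ
      have hpq : (p - radiusSq d * q).IsHomogeneous m := by
        have h := radiusSq_isHomogeneous.mul hq
        rw [show 2 + (m - 1 - 1) = m by omega] at h
        exact hp.sub h
      have e : restrictToSphere d p
          = restrictToSphere d (p - radiusSq d * q) + restrictToSphere d q := by
        rw [map_sub, restrictToSphere_radiusSq_mul, sub_add_cancel]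
      rw [e]
      refine Submodule.add_mem _ (Submodule.mem_iSup_of_mem m ?_) (ih _ (by omega) hq)
      refine Submodule.mem_map_of_mem ⟨hpq, ?_⟩
      rw [SetLike.mem_coe, LinearMap.mem_ker, map_sub, hqe, sub_self]

/-- Every polynomial function on the sphere is a sum of spherical harmonics. -/
theorem restrictToSphere_mem_iSup (p : MvPolynomial (Fin (d + 1)) ℂ) :
    restrictToSphere d p ∈ ⨆ l, harmonicSpace d l := by
  rw [← sum_homogeneousComponent p, map_sum]
  exact Submodule.sum_mem _ fun i _ =>
    restrictToSphere_mem_iSup_of_isHomogeneous i (homogeneousComponent_isHomogeneous i p)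

/-- Substitution of the linear forms given by the rows of a matrix. -/
def linSubst (A : Matrix (Fin (d + 1)) (Fin (d + 1)) ℝ) :
    MvPolynomial (Fin (d + 1)) ℂ →ₐ[ℂ] MvPolynomial (Fin (d + 1)) ℂ :=
  aeval fun k => ∑ j, C ((A k j : ℝ) : ℂ) * X j

lemma pderiv_linSubst (A : Matrix (Fin (d + 1)) (Fin (d + 1)) ℝ) (i : Fin (d + 1))
    (p : MvPolynomial (Fin (d + 1)) ℂ) :
    pderiv i (linSubst A p) = ∑ k, C ((A k i : ℝ) : ℂ) * linSubst A (pderiv k p) := by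
  induction p using MvPolynomial.induction_on with
  | C a =>
    have : linSubst A (C a) = C a := aeval_C _ _
    simp [this]
  | add p q hp hq => simp only [map_add, hp, hq, mul_add, Finset.sum_add_distrib]
  | mul_X p n hp =>
    have hX : linSubst A (X n) = ∑ j, C ((A n j : ℝ) : ℂ) * X j := aeval_X _ _
    have h1 : pderiv i (linSubst A (X n)) = C ((A n i : ℝ) : ℂ) := by
      rw [hX, map_sum, Finset.sum_eq_single i]
      · simp
      · intro j _ hj
        rw [pderiv_C_mul, pderiv_X_of_ne hj, mul_zero]
      · simp
    have h2 : ∀ k, linSubst A (pderiv k (X n : MvPolynomial (Fin (d + 1)) ℂ))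
        = if k = n then 1 else 0 := fun k => by
      split_ifs with h
      · rw [h, pderiv_X_self, map_one]
      · rw [pderiv_X_of_ne (Ne.symm h), map_zero]
    simp only [map_mul, pderiv_mul, h1, hp, map_add, h2, mul_add, Finset.sum_add_distrib]
    rw [Finset.sum_mul]
    congr 1
    · exact Finset.sum_congr rfl fun k _ => by ring
    · rw [Finset.sum_eq_single n]
      · simp only [if_true]
        ring
      · intro k _ hk
        simp [hk]
      · simp

/-- The chain rule used twice gives a double sum over second derivatives, and orthonormality of the
rows of `A` leaves only its diagonal. -/
lemma polyLaplacian_linSubst {A : Matrix (Fin (d + 1)) (Fin (d + 1)) ℝ}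
    (hA : A * A.transpose = 1) (p : MvPolynomial (Fin (d + 1)) ℂ) :
    polyLaplacian d (linSubst A p) = linSubst A (polyLaplacian d p) := by
  rw [polyLaplacian_apply, polyLaplacian_apply, map_sum]
  have h : ∀ i, pderiv i (pderiv i (linSubst A p))
      = ∑ k, ∑ j, C ((A k i : ℝ) : ℂ) * C ((A j i : ℝ) : ℂ) * linSubst A (pderiv j (pderiv k p)) :=
    fun i => by
      rw [pderiv_linSubst, map_sum]
      refine Finset.sum_congr rfl fun k _ => ?_
      rw [pderiv_C_mul, pderiv_linSubst, Finset.mul_sum]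
      exact Finset.sum_congr rfl fun j _ => by ring
  simp only [h]
  rw [Finset.sum_comm]
  refine Finset.sum_congr rfl fun k _ => ?_
  rw [Finset.sum_comm]
  simp only [← Finset.sum_mul, ← C_mul, ← map_sum]
  have hkj : ∀ j, ∑ i, ((A k i : ℝ) : ℂ) * ((A j i : ℝ) : ℂ) = if k = j then 1 else 0 := fun j => by
    have := congrFun (congrFun hA k) j
    rw [Matrix.mul_apply, Matrix.one_apply] at this
    simp only [Matrix.transpose_apply] at this
    rw [← Complex.ofReal_one, ← Complex.ofReal_zero, ← apply_ite Complex.ofReal, ← this]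
    push_cast
    rfl
  simp only [hkj]
  rw [Finset.sum_eq_single k]
  · simp
  · intro j _ hj
    simp [Ne.symm hj]
  · simp

lemma isHomogeneous_linSubst (A : Matrix (Fin (d + 1)) (Fin (d + 1)) ℝ)
    {p : MvPolynomial (Fin (d + 1)) ℂ} {m : ℕ} (hp : p.IsHomogeneous m) :
    (linSubst A p).IsHomogeneous m := by
  have := hp.aeval (S := ℂ) (n := 1) (fun k => ∑ j, C ((A k j : ℝ) : ℂ) * X j) fun k =>
    IsHomogeneous.sum _ _ _ fun j _ => by
      simpa using (isHomogeneous_C _ _).mul (isHomogeneous_X ℂ j)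
  rwa [one_mul] at this

/-- Spherical harmonics composed with an orthogonal map are spherical harmonics. -/
lemma comp_mem_harmonicSpace {A : Matrix (Fin (d + 1)) (Fin (d + 1)) ℝ}
    (hA : A * A.transpose = 1) {ψ : Sph d → Sph d} (hψ : ∀ x, (ψ x).1.ofLp = A.mulVec x.1.ofLp)
    {l : ℕ} {f : Sph d → ℂ} (hf : f ∈ harmonicSpace d l) :
    (fun x => f (ψ x)) ∈ harmonicSpace d l := by
  obtain ⟨p, ⟨hp, hΔ⟩, rfl⟩ := hf
  rw [SetLike.mem_coe, LinearMap.mem_ker] at hΔ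
  refine ⟨linSubst A p, ⟨isHomogeneous_linSubst A hp, ?_⟩, ?_⟩
  · rw [SetLike.mem_coe, LinearMap.mem_ker, polyLaplacian_linSubst hA, hΔ, map_zero]
  · ext x
    rw [restrictToSphere_apply, restrictToSphere_apply, linSubst, ← AlgHom.comp_apply, comp_aeval]
    congr 2
    ext k
    have : (ψ x).1 k = ∑ j, A k j * x.1 j := congrFun (hψ x) k
    rw [this]
    simp

lemma restrictToSphere_map_star (p : MvPolynomial (Fin (d + 1)) ℂ) (x : Sph d) :
    restrictToSphere d (MvPolynomial.map (starRingEnd ℂ) p) x = star (restrictToSphere d p x) := by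
  rw [restrictToSphere_apply, restrictToSphere_apply, ← starRingEnd_apply, aeval_def, aeval_def,
    eval₂_map, eval₂_comp_left]
  congr 1
  ext i
  simp

/-- The complex conjugate of a spherical harmonic is a spherical harmonic. -/
lemma star_mem_harmonicSpace {l : ℕ} {f : Sph d → ℂ} (hf : f ∈ harmonicSpace d l) :
    (fun x => star (f x)) ∈ harmonicSpace d l := by
  obtain ⟨p, ⟨hp, hΔ⟩, rfl⟩ := hf
  rw [SetLike.mem_coe, LinearMap.mem_ker] at hΔ
  refine ⟨MvPolynomial.map (starRingEnd ℂ) p, ⟨hp.map _, ?_⟩, ?_⟩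
  · rw [SetLike.mem_coe, LinearMap.mem_ker]
    have := congrArg (MvPolynomial.map (starRingEnd ℂ)) hΔ
    rw [polyLaplacian_apply] at this ⊢
    simpa [pderiv_map] using this
  · exact funext (restrictToSphere_map_star p)

lemma continuous_restrictToSphere (p : MvPolynomial (Fin (d + 1)) ℂ) :
    Continuous (restrictToSphere d p) := by
  have h : Continuous fun x : Sph d => fun i => ((x.1 i : ℝ) : ℂ) := by fun_prop
  exact (MvPolynomial.continuous_eval p).comp h |>.congr fun x => by
    simp [restrictToSphere_apply, aeval_eq_eval]

lemma continuous_of_mem_harmonicSpace {l : ℕ} {f : Sph d → ℂ} (hf : f ∈ harmonicSpace d l) :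
    Continuous f := by
  obtain ⟨p, -, rfl⟩ := hf
  exact continuous_restrictToSphere p

end Polynomials

/-! ### Green's formula on the sphere for homogeneous functions -/

section Green

open Laplacian

variable {d : ℕ}

/-- Integration in polar coordinates of a product of a radial and an angular function. -/
lemma integral_radial_mul_angular (w : ℝ → ℂ) (h : Amb d → ℂ) :
    ∫ x : Amb d, w ‖x‖ * h (‖x‖⁻¹ • x)
      = (∫ s, h s.1 ∂(surfaceMeasure d)) * ∫ r in Set.Ioi (0 : ℝ), ((r ^ d : ℝ) : ℂ) * w r := by
  have hdim : Module.finrank ℝ (Amb d) - 1 = d := by simp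
  calc ∫ x : Amb d, w ‖x‖ * h (‖x‖⁻¹ • x)
      = ∫ x : ({(0 : Amb d)}ᶜ : Set (Amb d)), w ‖x.1‖ * h (‖x.1‖⁻¹ • x.1)
          ∂(volume.comap (Subtype.val)) := by
        rw [integral_subtype_comap (measurableSet_singleton _).compl
          (fun x : Amb d => w ‖x‖ * h (‖x‖⁻¹ • x)), restrict_compl_singleton]
    _ = ∫ x, h x.1.1 * w x.2
          ∂(volume : Measure (Amb d)).toSphere.prod (Measure.volumeIoiPow d) := by
        have := (volume : Measure (Amb d)).measurePreserving_homeomorphUnitSphereProd.integral_comp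
          (Homeomorph.measurableEmbedding _)
          (fun x : Metric.sphere (0 : Amb d) 1 × Set.Ioi (0 : ℝ) => h x.1.1 * w x.2)
        rw [hdim] at this
        rw [← this]
        refine integral_congr_ae (ae_of_all _ fun x => ?_)
        simp [mul_comm]
    _ = (∫ s, h s.1 ∂(surfaceMeasure d))
          * ∫ r : Set.Ioi (0 : ℝ), w r ∂(Measure.volumeIoiPow d) := by
        exact integral_prod_mul (fun s : Metric.sphere (0 : Amb d) 1 => h s.1)
          (fun r : Set.Ioi (0 : ℝ) => w r)
    _ = _ := by
        congr 1
        simp only [Measure.volumeIoiPow, ENNReal.ofReal]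
        rw [integral_withDensity_eq_integral_smul,
          integral_subtype_comap measurableSet_Ioi fun a ↦ Real.toNNReal (a ^ d) • w a]
        · refine setIntegral_congr_fun measurableSet_Ioi fun x hx => ?_
          rw [NNReal.smul_def, Real.coe_toNNReal _ (pow_nonneg (le_of_lt hx) _), Complex.real_smul]
        · exact (measurable_subtype_coe.pow_const _).real_toNNReal

/-- The factor `c` and the target space are left free so that the lemma can be applied to a function
and then again to its derivative. -/
lemma fderiv_smul_of_homogeneous {V : Type*} [NormedAddCommGroup V] [NormedSpace ℝ V]
    {H : Amb d → V} {t c : ℝ} (ht : 0 < t) (hH : ∀ x, x ≠ 0 → H (t • x) = c • H x)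
    (hd : ∀ x, x ≠ 0 → DifferentiableAt ℝ H x) {x : Amb d} (hx : x ≠ 0) :
    fderiv ℝ H (t • x) = (c / t) • fderiv ℝ H x := by
  have h1 : HasFDerivAt (fun y => H (t • y)) ((fderiv ℝ H (t • x)).comp
      (t • ContinuousLinearMap.id ℝ (Amb d))) x :=
    (hd _ (smul_ne_zero ht.ne' hx)).hasFDerivAt.comp x ((hasFDerivAt_id x).const_smul t)
  have h2 : HasFDerivAt (fun y => H (t • y)) (c • fderiv ℝ H x) x := by
    refine ((hd x hx).hasFDerivAt.const_smul c).congr_of_eventuallyEq ?_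
    filter_upwards [isOpen_compl_singleton.mem_nhds hx] with y hy using hH y hy
  have h3 := h1.unique h2
  ext v
  have := DFunLike.congr_fun h3 v
  simp only [ContinuousLinearMap.comp_apply, smul_apply,
    ContinuousLinearMap.id_apply, map_smul] at this ⊢
  rw [div_eq_inv_mul, mul_smul, ← this, smul_smul, inv_mul_cancel₀ ht.ne', one_smul]

lemma laplacian_eq_sum_fderiv {V : Type*} [NormedAddCommGroup V] [NormedSpace ℝ V]
    (F : Amb d → V) (x : Amb d) :
    Δ F x = ∑ i, fderiv ℝ (fderiv ℝ F) x (EuclideanSpace.basisFun (Fin (d + 1)) ℝ i)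
      (EuclideanSpace.basisFun (Fin (d + 1)) ℝ i) := by
  rw [InnerProductSpace.laplacian_eq_iteratedFDeriv_orthonormalBasis F
    (EuclideanSpace.basisFun (Fin (d + 1)) ℝ)]
  simp [iteratedFDeriv_two_apply]

lemma contDiffAt_laplacian {V : Type*} [NormedAddCommGroup V] [NormedSpace ℝ V]
    {F : Amb d → V} {x : Amb d} {n : ℕ} (hF : ContDiffAt ℝ ((n + 2 : ℕ) : WithTop ℕ∞) F x) :
    ContDiffAt ℝ (n : WithTop ℕ∞) (Δ F) x := by
  have h1 : ContDiffAt ℝ ((n + 1 : ℕ) : WithTop ℕ∞) (fderiv ℝ F) x :=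
    hF.fderiv_right (by exact_mod_cast le_rfl)
  have h2 : ContDiffAt ℝ (n : WithTop ℕ∞) (fderiv ℝ (fderiv ℝ F)) x :=
    h1.fderiv_right (by exact_mod_cast le_rfl)
  rw [show Δ F = _ from funext (laplacian_eq_sum_fderiv F)]
  exact ContDiffAt.sum fun i _ => (h2.clm_apply contDiffAt_const).clm_apply contDiffAt_const

/-- Smoothness of order two off the origin together with homogeneity of degree `a`. -/
structure HomogeneousC2 (F : Amb d → ℂ) (a : ℕ) : Prop where
  contDiffAt : ∀ x, x ≠ 0 → ContDiffAt ℝ 2 F x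
  homogeneous : ∀ t : ℝ, 0 < t → ∀ x, x ≠ 0 → F (t • x) = t ^ a • F x

namespace HomogeneousC2

variable {F G : Amb d → ℂ} {a b : ℕ}

lemma differentiableAt (hF : HomogeneousC2 F a) {x : Amb d} (hx : x ≠ 0) :
    DifferentiableAt ℝ F x := (hF.contDiffAt x hx).differentiableAt (by norm_num)

lemma contDiffAt_fderiv (hF : HomogeneousC2 F a) {x : Amb d} (hx : x ≠ 0) :
    ContDiffAt ℝ 1 (fderiv ℝ F) x := (hF.contDiffAt x hx).fderiv_right (by norm_num)

lemma differentiableAt_fderiv (hF : HomogeneousC2 F a) {x : Amb d} (hx : x ≠ 0) :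
    DifferentiableAt ℝ (fderiv ℝ F) x := (hF.contDiffAt_fderiv hx).differentiableAt (by norm_num)

lemma fderiv_self (hF : HomogeneousC2 F a) {x : Amb d} (hx : x ≠ 0) :
    fderiv ℝ F x x = a • F x := by
  have h1 : HasDerivAt (fun t : ℝ => F (t • x)) (fderiv ℝ F x x) 1 := by
    have h := (hasDerivAt_id (1 : ℝ)).smul_const x
    rw [one_smul] at h
    have hF' : HasFDerivAt F (fderiv ℝ F x) ((id (1 : ℝ)) • x) := by
      rw [id, one_smul]
      exact (hF.differentiableAt hx).hasFDerivAt
    exact hF'.comp_hasDerivAt (1 : ℝ) h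
  have h2 : HasDerivAt (fun t : ℝ => F (t • x)) ((a * (1 : ℝ) ^ (a - 1)) • F x) 1 := by
    refine ((hasDerivAt_pow a (1 : ℝ)).smul_const (F x)).congr_of_eventuallyEq ?_
    filter_upwards [lt_mem_nhds one_pos] with t ht using hF.homogeneous t ht x hx
  rw [h1.unique h2, one_pow, mul_one, Nat.cast_smul_eq_nsmul]

lemma laplacian_smul_arg (hF : HomogeneousC2 F a) {t : ℝ} (ht : 0 < t) {x : Amb d} (hx : x ≠ 0) :
    Δ F (t • x) = (t ^ a / t ^ 2) • Δ F x := by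
  have h1 : ∀ y, y ≠ 0 → fderiv ℝ F (t • y) = (t ^ a / t) • fderiv ℝ F y := fun y hy =>
    fderiv_smul_of_homogeneous ht (hF.homogeneous t ht) (fun _ => hF.differentiableAt) hy
  have h2 := fderiv_smul_of_homogeneous ht h1 (fun _ => hF.differentiableAt_fderiv) hx
  rw [laplacian_eq_sum_fderiv, laplacian_eq_sum_fderiv, h2, Finset.smul_sum]
  refine Finset.sum_congr rfl fun i _ => ?_
  rw [smul_apply, smul_apply, div_div, ← sq]

lemma eq_norm_smul (hF : HomogeneousC2 F a) {x : Amb d} (hx : x ≠ 0) :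
    F x = ‖x‖ ^ a • F (‖x‖⁻¹ • x) := by
  have hn : 0 < ‖x‖ := norm_pos_iff.2 hx
  rw [← hF.homogeneous ‖x‖ hn _ (smul_ne_zero (inv_pos.2 hn).ne' hx), smul_smul,
    mul_inv_cancel₀ hn.ne', one_smul]

lemma laplacian_eq_norm_smul (hF : HomogeneousC2 F a) {x : Amb d} (hx : x ≠ 0) :
    Δ F x = (‖x‖ ^ a / ‖x‖ ^ 2) • Δ F (‖x‖⁻¹ • x) := by
  have hn : 0 < ‖x‖ := norm_pos_iff.2 hx
  rw [← hF.laplacian_smul_arg hn (smul_ne_zero (inv_pos.2 hn).ne' hx), smul_smul,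
    mul_inv_cancel₀ hn.ne', one_smul]

end HomogeneousC2

/-- A smooth bump function on the line supported in `(1, 3)`. -/
def lineBump : ContDiffBump (2 : ℝ) := ⟨1 / 2, 1, by norm_num, by norm_num⟩

lemma lineBump_eq_zero {r : ℝ} (hr : r ≤ 1 ∨ 3 ≤ r) : lineBump r = 0 := by
  refine lineBump.zero_of_le_dist ?_
  change (1 : ℝ) ≤ dist r 2
  rw [Real.dist_eq]
  rcases hr with h | h
  · rw [abs_of_nonpos (by linarith)]
    linarith
  · rw [abs_of_nonneg (by linarith)]
    linarith

lemma deriv_lineBump_eq_zero {r : ℝ} (hr : r < 1 ∨ 3 < r) : deriv lineBump r = 0 := by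
  have : (lineBump : ℝ → ℝ) =ᶠ[𝓝 r] fun _ => 0 := by
    rcases hr with h | h
    · filter_upwards [gt_mem_nhds h] with s hs using lineBump_eq_zero (Or.inl hs.le)
    · filter_upwards [lt_mem_nhds h] with s hs using lineBump_eq_zero (Or.inr hs.le)
  rw [this.deriv_eq, deriv_const]

lemma contDiff_lineBump {n : ℕ∞} : ContDiff ℝ n lineBump := lineBump.contDiff

lemma hasDerivAt_lineBump (r : ℝ) : HasDerivAt lineBump (deriv lineBump r) r :=
  ((contDiff_lineBump (n := 1)).differentiable (by norm_num) r).hasDerivAt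

lemma continuous_deriv_lineBump : Continuous (deriv lineBump) :=
  (contDiff_lineBump (n := 1)).continuous_deriv (by norm_num)

/-- The radial integrals of Green's formula. -/
lemma integral_lineBump (m : ℕ) :
    0 < ∫ r in Set.Ioi (0 : ℝ), r ^ (m + 1) / r ^ 2 * lineBump (r ^ 2) ∧
    2 * ∫ r in Set.Ioi (0 : ℝ), r ^ (m + 1) * deriv lineBump (r ^ 2)
      = -(m * ∫ r in Set.Ioi (0 : ℝ), r ^ (m + 1) / r ^ 2 * lineBump (r ^ 2)) := by
  have hsq : Continuous fun r : ℝ => r ^ 2 := continuous_pow 2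
  have hη : Continuous fun r : ℝ => lineBump (r ^ 2) := lineBump.continuous.comp hsq
  have hη' : Continuous fun r : ℝ => deriv lineBump (r ^ 2) := continuous_deriv_lineBump.comp hsq
  have hout : ∀ r : ℝ, r ∉ Set.Icc (-2 : ℝ) 2 → 3 < r ^ 2 := fun r hr => by
    by_contra hc
    exact hr ⟨by nlinarith, by nlinarith⟩
  have hc1 : Continuous fun r : ℝ => r ^ (m + 1) / r ^ 2 * lineBump (r ^ 2) := by
    rw [continuous_iff_continuousAt]
    intro r
    rcases eq_or_ne r 0 with rfl | hr
    · refine ContinuousAt.congr (f := fun _ => (0 : ℝ)) continuousAt_const ?_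
      have : ∀ᶠ s : ℝ in 𝓝 0, s ^ 2 < 1 := hsq.continuousAt.eventually_lt_const (by norm_num)
      filter_upwards [this] with s hs
      rw [lineBump_eq_zero (Or.inl hs.le), mul_zero]
    · exact ((continuousAt_id.pow _).div (continuousAt_id.pow _) (pow_ne_zero _ hr)).mul
        hη.continuousAt
  have hi1 : Integrable fun r : ℝ => r ^ (m + 1) / r ^ 2 * lineBump (r ^ 2) :=
    hc1.integrable_of_hasCompactSupport (HasCompactSupport.intro isCompact_Icc fun r hr => by
      rw [lineBump_eq_zero (Or.inr (hout r hr).le), mul_zero])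
  have hi2 : Integrable fun r : ℝ => r ^ (m + 1) * deriv lineBump (r ^ 2) :=
    ((continuous_pow (m + 1)).mul hη').integrable_of_hasCompactSupport
      (HasCompactSupport.intro isCompact_Icc fun r (hr : r ∉ Set.Icc (-2 : ℝ) 2) => by
      simp [deriv_lineBump_eq_zero (Or.inr (hout r hr))])
  constructor
  · rw [setIntegral_pos_iff_support_of_nonneg_ae _ hi1.integrableOn]
    -- For `r` in this interval `r²` lies in `[3/2, 5/2]`, where the bump equals 1.
    · refine lt_of_lt_of_le (b := volume (Set.Ioo (1.3 : ℝ) 1.5)) (by simp; norm_num)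
        (measure_mono fun r hr => ⟨?_, ?_⟩)
      · have h0 : (0 : ℝ) < r := by linarith [hr.1]
        rw [Function.mem_support, lineBump.one_of_mem_closedBall, mul_one]
        · positivity
        · change dist (r ^ 2) 2 ≤ 1 / 2
          rw [Real.dist_eq, abs_le]
          constructor <;> nlinarith [hr.1, hr.2]
      · exact lt_trans (by norm_num) hr.1
    · filter_upwards [ae_restrict_mem measurableSet_Ioi] with r hr
      have h0 : (0 : ℝ) < r := hr
      exact mul_nonneg (by positivity) lineBump.nonneg
  -- The function `r^m η(r²)` vanishes at 0 and for large `r`, so its derivative has integral zero.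
  -- The power `r^{m-1}` is written `r^{m+1} / r²` to cover `m = 0`.
  · have hder : ∀ r ∈ Set.Ioi (0 : ℝ), HasDerivAt (fun r : ℝ => r ^ m * lineBump (r ^ 2))
        (m * (r ^ (m + 1) / r ^ 2 * lineBump (r ^ 2)) + 2 * (r ^ (m + 1) * deriv lineBump (r ^ 2)))
        r := by
      intro r hr
      have h0 : (0 : ℝ) < r := hr
      have h1 : HasDerivAt (fun r : ℝ => lineBump (r ^ 2)) (deriv lineBump (r ^ 2) * (2 * r)) r := by
        have := (hasDerivAt_lineBump (r ^ 2)).comp r (hasDerivAt_pow 2 r)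
        simpa [Function.comp_def] using this
      have h2 := (hasDerivAt_pow m r).mul h1
      convert! h2 using 1
      rcases Nat.eq_zero_or_pos m with rfl | hm
      · simp
        ring
      · obtain ⟨k, rfl⟩ : ∃ k, m = k + 1 := ⟨m - 1, by omega⟩
        rw [Nat.add_sub_cancel]
        field_simp
        ring
    have hlim : Tendsto (fun r : ℝ => r ^ m * lineBump (r ^ 2)) atTop (𝓝 0) := by
      refine tendsto_const_nhds.congr' ?_
      filter_upwards [eventually_gt_atTop 2] with r hr
      rw [lineBump_eq_zero (Or.inr (by nlinarith)), mul_zero]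
    have := integral_Ioi_of_hasDerivAt_of_tendsto
      (f := fun r : ℝ => r ^ m * lineBump (r ^ 2)) (a := 0)
      ((continuous_pow m).mul hη).continuousWithinAt hder
      ((hi1.const_mul _).add (hi2.const_mul _)).integrableOn hlim
    rw [integral_add (hi1.const_mul _).integrableOn (hi2.const_mul _).integrableOn,
      integral_const_mul, integral_const_mul] at this
    have h0 : lineBump ((0 : ℝ) ^ 2) = 0 := lineBump_eq_zero (by norm_num)
    rw [h0, mul_zero, sub_zero] at this
    linarith

/-- The cutoff vanishes near the origin and outside a ball, so a possible singularity of `f` at the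
origin and its growth at infinity play no role. -/
lemma integrable_mul_cutoff {f : Amb d → ℂ} (hf : ContinuousOn f {0}ᶜ) {w : ℝ → ℝ}
    (hw : Continuous w) (h0 : ∀ r, r < 1 ∨ 3 < r → w r = 0) :
    Integrable fun x : Amb d => f x * (w (‖x‖ ^ 2) : ℝ) := by
  have hsq : Continuous fun x : Amb d => ‖x‖ ^ 2 := by fun_prop
  have hc : Continuous fun x : Amb d => f x * (w (‖x‖ ^ 2) : ℝ) := by
    rw [continuous_iff_continuousAt]
    intro x
    rcases eq_or_ne x 0 with rfl | hx
    · refine ContinuousAt.congr (f := fun _ => (0 : ℂ)) continuousAt_const ?_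
      have : ∀ᶠ y : Amb d in 𝓝 0, ‖y‖ ^ 2 < 1 := hsq.continuousAt.eventually_lt_const (by simp)
      filter_upwards [this] with y hy
      rw [h0 _ (Or.inl hy)]
      simp
    · exact (hf.continuousAt (isOpen_compl_singleton.mem_nhds hx)).mul
        (Complex.continuous_ofReal.comp (hw.comp hsq)).continuousAt
  refine hc.integrable_of_hasCompactSupport
    (HasCompactSupport.intro (isCompact_closedBall (0 : Amb d) 2) fun x hx => ?_)
  rw [Metric.mem_closedBall, dist_zero_right, not_le] at hx
  rw [h0 _ (Or.inr (by nlinarith))]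
  simp

/-- Integration by parts of the field `G ∇F - F ∇G` against the cutoff `η(|x|²)`, so that no
boundary terms occur. The divergence is `G ΔF - F ΔG`; the gradient of the cutoff is `2 η' x`, and
its pairing with the field is computed by Euler's identity, which gives the factor `a - b`. -/
theorem integral_green_ambient {F G : Amb d → ℂ} {a b : ℕ} (hF : HomogeneousC2 F a)
    (hG : HomogeneousC2 G b) :
    ∫ x : Amb d, ((a : ℂ) - b) * (F x * G x) * (2 * deriv lineBump (‖x‖ ^ 2) : ℝ)
      = -∫ x : Amb d, (Δ F x * G x - F x * Δ G x) * (lineBump (‖x‖ ^ 2) : ℝ) := by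
  set e := EuclideanSpace.basisFun (Fin (d + 1)) ℝ with he
  set g : Amb d → ℂ := fun x => ((lineBump (‖x‖ ^ 2) : ℝ) : ℂ) with hg
  set f : Fin (d + 1) → Amb d → ℂ := fun i x => fderiv ℝ F x (e i) * G x - F x * fderiv ℝ G x (e i)
    with hf
  have hsupp : ∀ x ∈ tsupport g, x ≠ 0 := by
    intro x hx h0
    subst h0
    refine notMem_tsupport_iff_eventuallyEq.2 ?_ hx
    have hsq : Continuous fun x : Amb d => ‖x‖ ^ 2 := by fun_prop
    have : ∀ᶠ y : Amb d in 𝓝 0, ‖y‖ ^ 2 < 1 := hsq.continuousAt.eventually_lt_const (by simp)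
    filter_upwards [this] with y hy
    simp [hg, lineBump_eq_zero (Or.inl hy.le)]
  have hgd : ∀ x, HasFDerivAt g ((deriv lineBump (‖x‖ ^ 2) : ℝ) •
      (Complex.ofRealCLM ∘L ((2 : ℝ) • innerSL ℝ x))) x := by
    intro x
    have h1 := (hasStrictFDerivAt_norm_sq x).hasFDerivAt
    have h2 := (hasDerivAt_lineBump (‖x‖ ^ 2)).comp_hasFDerivAt x h1
    have h3 := Complex.ofRealCLM.hasFDerivAt.comp x h2
    refine h3.congr_fderiv ?_
    ext v
    simp
  have hgd' : ∀ x v, fderiv ℝ g x v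
      = ((2 * deriv lineBump (‖x‖ ^ 2) : ℝ) : ℂ) * ((inner ℝ x v : ℝ) : ℂ) := by
    intro x v
    rw [(hgd x).fderiv]
    simp
    ring
  have hcont : ∀ {H : Amb d → ℂ} {c : ℕ}, HomogeneousC2 H c → ContinuousOn H {0}ᶜ :=
    fun hH x hx => (hH.contDiffAt x hx).continuousAt.continuousWithinAt
  have hcont' : ∀ {H : Amb d → ℂ} {c : ℕ}, HomogeneousC2 H c → ∀ v,
      ContinuousOn (fun x => fderiv ℝ H x v) {0}ᶜ :=
    fun hH v x hx => ((hH.contDiffAt_fderiv hx).continuousAt.clm_apply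
      continuousAt_const).continuousWithinAt
  have hcont'' : ∀ {H : Amb d → ℂ} {c : ℕ}, HomogeneousC2 H c → ∀ v,
      ContinuousOn (fun x => fderiv ℝ (fderiv ℝ H) x v v) {0}ᶜ :=
    fun hH v x hx => ((((hH.contDiffAt_fderiv hx).fderiv_right (m := 0)
      (by norm_num)).continuousAt.clm_apply continuousAt_const).clm_apply
      continuousAt_const).continuousWithinAt
  have hfd : ∀ i x, x ≠ 0 → HasFDerivAt (f i) (fderiv ℝ (f i) x) x ∧
      fderiv ℝ (f i) x (e i) = fderiv ℝ (fderiv ℝ F) x (e i) (e i) * G x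
        - F x * fderiv ℝ (fderiv ℝ G) x (e i) (e i) := by
    intro i x hx
    have hF1 := (hF.differentiableAt hx).hasFDerivAt
    have hG1 := (hG.differentiableAt hx).hasFDerivAt
    have hF2 : HasFDerivAt (fun x => fderiv ℝ F x (e i))
        ((fderiv ℝ (fderiv ℝ F) x).flip (e i)) x := by
      simpa using (hF.differentiableAt_fderiv hx).hasFDerivAt.clm_apply (hasFDerivAt_const (e i) x)
    have hG2 : HasFDerivAt (fun x => fderiv ℝ G x (e i))
        ((fderiv ℝ (fderiv ℝ G) x).flip (e i)) x := by
      simpa using (hG.differentiableAt_fderiv hx).hasFDerivAt.clm_apply (hasFDerivAt_const (e i) x)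
    have h := (hF2.mul hG1).sub (hF1.mul hG2)
    have h' : fderiv ℝ (f i) x = _ := h.fderiv
    refine ⟨h'.symm ▸ h, ?_⟩
    rw [h']
    simp
    ring
  have hfc : ∀ i, ContinuousOn (f i) {0}ᶜ := fun i =>
    ((hcont' hF _).mul (hcont hG)).sub ((hcont hF).mul (hcont' hG _))
  have hI1 : ∀ i, Integrable fun x => f i x * fderiv ℝ g x (e i) := by
    intro i
    have hc : ContinuousOn (fun x => f i x * ((inner ℝ x (e i) : ℝ) : ℂ)) {0}ᶜ := by
      refine (hfc i).mul (Continuous.continuousOn ?_)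
      fun_prop
    refine (integrable_mul_cutoff hc (w := fun r => 2 * deriv lineBump r)
      (continuous_const.mul continuous_deriv_lineBump) fun r hr => by
        rw [deriv_lineBump_eq_zero hr, mul_zero]).congr (ae_of_all _ fun x => ?_)
    simp only
    rw [hgd']
    ring
  have hI2 : ∀ i, Integrable fun x => fderiv ℝ (f i) x (e i) * g x := by
    intro i
    refine (integrable_mul_cutoff (((hcont'' hF (e i)).mul (hcont hG)).sub
      ((hcont hF).mul (hcont'' hG (e i)))) lineBump.continuous fun r hr =>
        lineBump_eq_zero (hr.imp le_of_lt le_of_lt)).congr (ae_of_all _ fun x => ?_)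
    rcases eq_or_ne x 0 with rfl | hx
    · simp [hg, lineBump_eq_zero]
    · simp only [Pi.sub_apply, Pi.mul_apply]
      rw [(hfd i x hx).2]
  have hI3 : ∀ i, Integrable fun x => f i x * g x := fun i =>
    integrable_mul_cutoff (hfc i) lineBump.continuous fun r hr =>
        lineBump_eq_zero (hr.imp le_of_lt le_of_lt)
  have key : ∀ i, ∫ x, f i x * fderiv ℝ g x (e i) = -∫ x, fderiv ℝ (f i) x (e i) * g x := fun i =>
    integral_mul_fderiv_eq_neg_fderiv_mul_of_integrable (hI2 i) (hI1 i) (hI3 i)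
      (fun x hx => (hfd i x (hsupp x hx)).1.differentiableAt)
      (fun x _ => (hgd x).differentiableAt)
  have hsum := Finset.sum_congr (rfl : (Finset.univ : Finset (Fin (d + 1))) = _)
    (fun i _ => key i)
  rw [Finset.sum_neg_distrib, ← integral_finsetSum _ fun i _ => hI1 i,
    ← integral_finsetSum _ fun i _ => hI2 i] at hsum
  convert! hsum using 2
  · ext x
    rcases eq_or_ne x 0 with rfl | hx
    · simp [hgd', deriv_lineBump_eq_zero]
    · have hx' : ∑ i, (inner ℝ x (e i)) • e i = x := by
        have := e.sum_repr' x
        simpa only [real_inner_comm] using this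
      have hdir : ∀ {H : Amb d → ℂ} {c : ℕ}, HomogeneousC2 H c →
          ∑ i, fderiv ℝ H x (e i) * ((inner ℝ x (e i) : ℝ) : ℂ) = c * H x := by
        intro H c hH
        have := hH.fderiv_self hx
        rw [nsmul_eq_mul] at this
        rw [← this]
        conv_rhs => rw [show fderiv ℝ H x x = fderiv ℝ H x (∑ i, (inner ℝ x (e i)) • e i) by rw [hx']]
        simp only [map_sum, map_smul, Complex.real_smul]
        exact Finset.sum_congr rfl fun i _ => mul_comm _ _
      simp only [hgd']
      have e1 : ∀ i, f i x * (((2 * deriv lineBump (‖x‖ ^ 2) : ℝ) : ℂ) * ((inner ℝ x (e i) : ℝ) : ℂ))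
          = ((2 * deriv lineBump (‖x‖ ^ 2) : ℝ) : ℂ) *
            (fderiv ℝ F x (e i) * ((inner ℝ x (e i) : ℝ) : ℂ) * G x
              - fderiv ℝ G x (e i) * ((inner ℝ x (e i) : ℝ) : ℂ) * F x) := fun i => by
        rw [hf]
        ring
      simp only [e1]
      rw [← Finset.mul_sum, Finset.sum_sub_distrib, ← Finset.sum_mul, ← Finset.sum_mul,
        hdir hF, hdir hG]
      ring
  · congr 1
    ext x
    rcases eq_or_ne x 0 with rfl | hx
    · simp [hg, lineBump_eq_zero]
    · rw [← Finset.sum_mul]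
      simp only [fun i => (hfd i x hx).2]
      rw [Finset.sum_sub_distrib, ← Finset.sum_mul, ← Finset.mul_sum,
        laplacian_eq_sum_fderiv, laplacian_eq_sum_fderiv]

/-- Green's formula on the sphere for the Laplacians of homogeneous functions. -/
theorem integral_sphere_green (hd : 1 ≤ d) {F G : Amb d → ℂ} {a b : ℕ} (hF : HomogeneousC2 F a)
    (hG : HomogeneousC2 G b) :
    ∫ s, (Δ F s.1 * G s.1 - F s.1 * Δ G s.1) ∂(surfaceMeasure d)
      = ((a : ℂ) - b) * ((a + b + d : ℂ) - 1) * ∫ s, F s.1 * G s.1 ∂(surfaceMeasure d) := by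
  obtain ⟨m, hm⟩ : ∃ m : ℕ, a + b + d = m + 1 := ⟨a + b + d - 1, by omega⟩
  have hg := integral_green_ambient hF hG
  obtain ⟨hpos, hrad⟩ := integral_lineBump m
  set I := ∫ r in Set.Ioi (0 : ℝ), r ^ (m + 1) / r ^ 2 * lineBump (r ^ 2)
  set J := ∫ r in Set.Ioi (0 : ℝ), r ^ (m + 1) * deriv lineBump (r ^ 2)
  -- By homogeneity both sides of the ambient identity factor in polar coordinates. The radial
  -- factors satisfy `2 J = -m I` with `I > 0` and `m = a + b + d - 1`, so `I` cancels.
  have h1 : ∫ x : Amb d, ((a : ℂ) - b) * (F x * G x) * (2 * deriv lineBump (‖x‖ ^ 2) : ℝ)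
      = ((a : ℂ) - b) * (2 * J : ℝ) * ∫ s, F s.1 * G s.1 ∂(surfaceMeasure d) := by
    have e : ∀ x : Amb d, ((a : ℂ) - b) * (F x * G x) * (2 * deriv lineBump (‖x‖ ^ 2) : ℝ)
        = ((fun r : ℝ => ((a : ℂ) - b) * ((2 * (r ^ (a + b) * deriv lineBump (r ^ 2)) : ℝ) : ℂ)) ‖x‖)
          * (fun y => F y * G y) (‖x‖⁻¹ • x) := by
      intro x
      rcases eq_or_ne x 0 with rfl | hx
      · simp [deriv_lineBump_eq_zero]
      · simp only
        rw [hF.eq_norm_smul hx, hG.eq_norm_smul hx]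
        simp only [Complex.real_smul]
        push_cast
        ring
    rw [integral_congr_ae (ae_of_all _ e), integral_radial_mul_angular
      (fun r : ℝ => ((a : ℂ) - b) * ((2 * (r ^ (a + b) * deriv lineBump (r ^ 2)) : ℝ) : ℂ))
      (fun y => F y * G y)]
    have e2 : ∀ r : ℝ, ((r ^ d : ℝ) : ℂ)
        * (((a : ℂ) - b) * ((2 * (r ^ (a + b) * deriv lineBump (r ^ 2)) : ℝ) : ℂ))
        = (((a : ℂ) - b) * 2) * ((r ^ (m + 1) * deriv lineBump (r ^ 2) : ℝ) : ℂ) := fun r => by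
      rw [← hm, pow_add r (a + b) d]
      push_cast
      ring
    simp only [e2]
    rw [integral_const_mul, integral_complex_ofReal]
    push_cast
    ring
  have h2 : ∫ x : Amb d, (Δ F x * G x - F x * Δ G x) * (lineBump (‖x‖ ^ 2) : ℝ)
      = I * ∫ s, (Δ F s.1 * G s.1 - F s.1 * Δ G s.1) ∂(surfaceMeasure d) := by
    have e : ∀ x : Amb d, (Δ F x * G x - F x * Δ G x) * (lineBump (‖x‖ ^ 2) : ℝ)
        = ((fun r : ℝ => ((r ^ (a + b) / r ^ 2 * lineBump (r ^ 2) : ℝ) : ℂ)) ‖x‖)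
          * (fun y => Δ F y * G y - F y * Δ G y) (‖x‖⁻¹ • x) := by
      intro x
      rcases eq_or_ne x 0 with rfl | hx
      · simp [lineBump_eq_zero]
      · simp only
        rw [hF.laplacian_eq_norm_smul hx, hG.laplacian_eq_norm_smul hx,
          hF.eq_norm_smul hx, hG.eq_norm_smul hx]
        simp only [Complex.real_smul]
        push_cast
        ring
    rw [integral_congr_ae (ae_of_all _ e), integral_radial_mul_angular
      (fun r : ℝ => ((r ^ (a + b) / r ^ 2 * lineBump (r ^ 2) : ℝ) : ℂ))
      (fun y => Δ F y * G y - F y * Δ G y)]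
    have e2 : ∀ r : ℝ, ((r ^ d : ℝ) : ℂ) * ((r ^ (a + b) / r ^ 2 * lineBump (r ^ 2) : ℝ) : ℂ)
        = ((r ^ (m + 1) / r ^ 2 * lineBump (r ^ 2) : ℝ) : ℂ) := fun r => by
      rw [← hm, pow_add r (a + b) d]
      push_cast
      ring
    simp only [e2]
    rw [integral_complex_ofReal, mul_comm]
  rw [h1, h2, hrad] at hg
  have hI : (I : ℂ) ≠ 0 := by exact_mod_cast hpos.ne'
  have hm' : ((a + b + d : ℂ) - 1) = m := by
    have : ((a + b + d : ℕ) : ℂ) = ((m + 1 : ℕ) : ℂ) := by rw [hm]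
    push_cast at this
    rw [this]
    ring
  rw [hm']
  apply mul_left_cancel₀ hI
  have := congrArg Neg.neg hg
  rw [neg_neg] at this
  rw [← this]
  push_cast
  ring

end Green

/-! ### Orthogonality of harmonics and eigenvalues of the Laplace-Beltrami operator -/

section LaplaceBeltrami

open Laplacian

variable {d : ℕ}

/-- A complex polynomial as a function on the ambient real space. -/
def polyFun (p : MvPolynomial (Fin (d + 1)) ℂ) (x : Amb d) : ℂ :=
  MvPolynomial.aeval (fun i => ((x i : ℝ) : ℂ)) p

lemma restrictToSphere_eq_polyFun (p : MvPolynomial (Fin (d + 1)) ℂ) (x : Sph d) :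
    restrictToSphere d p x = polyFun p x.1 := rfl

/-- The `i`-th coordinate as a complex valued linear form. -/
def coordC (i : Fin (d + 1)) : Amb d →L[ℝ] ℂ := Complex.ofRealCLM ∘L EuclideanSpace.proj i

lemma coordC_apply (i : Fin (d + 1)) (x : Amb d) : coordC i x = ((x i : ℝ) : ℂ) := rfl

lemma hasFDerivAt_polyFun (p : MvPolynomial (Fin (d + 1)) ℂ) (x : Amb d) :
    HasFDerivAt (polyFun p) (∑ i, polyFun (MvPolynomial.pderiv i p) x • coordC i) x := by
  induction p using MvPolynomial.induction_on with
  | C a =>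
    have : polyFun (d := d) (MvPolynomial.C a) = fun _ => a := by
      ext y
      simp [polyFun]
    rw [this]
    refine (hasFDerivAt_const a x).congr_fderiv ?_
    ext v
    simp [polyFun]
  | add p q hp hq =>
    have : polyFun (p + q) = fun y => polyFun p y + polyFun q y := by
      ext y
      simp [polyFun]
    rw [this]
    refine (hp.add hq).congr_fderiv ?_
    rw [← Finset.sum_add_distrib]
    refine Finset.sum_congr rfl fun i _ => ?_
    rw [← add_smul]
    simp [polyFun]
  | mul_X p n hp =>
    have : polyFun (p * MvPolynomial.X n) = fun y => polyFun p y * coordC n y := by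
      ext y
      simp [polyFun, coordC_apply]
    rw [this]
    refine (hp.mul (coordC n).hasFDerivAt).congr_fderiv ?_
    have h : ∀ i, polyFun (MvPolynomial.pderiv i (p * MvPolynomial.X n)) x
        = polyFun (MvPolynomial.pderiv i p) x * coordC n x + if i = n then polyFun p x else 0 := by
      intro i
      rw [MvPolynomial.pderiv_mul]
      split_ifs with hi
      · subst hi
        simp [polyFun, coordC_apply]
      · rw [MvPolynomial.pderiv_X_of_ne (Ne.symm hi)]
        simp [polyFun, coordC_apply]
    ext v
    simp only [h, add_apply, smul_apply, sum_apply, smul_eq_mul, add_mul, ite_mul, zero_mul,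
      Finset.sum_add_distrib, Finset.sum_ite_eq', Finset.mem_univ, if_true, Finset.mul_sum]
    rw [add_comm]
    congr 1
    exact Finset.sum_congr rfl fun i _ => by ring

lemma fderiv_polyFun_basis (p : MvPolynomial (Fin (d + 1)) ℂ) (x : Amb d) (i : Fin (d + 1)) :
    fderiv ℝ (polyFun p) x (EuclideanSpace.basisFun (Fin (d + 1)) ℝ i)
      = polyFun (MvPolynomial.pderiv i p) x := by
  rw [(hasFDerivAt_polyFun p x).fderiv]
  simp only [sum_apply, smul_apply, coordC_apply,
    EuclideanSpace.basisFun_apply, smul_eq_mul]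
  rw [Finset.sum_eq_single i]
  · simp
  · intro j _ hj
    simp [hj]
  · simp

lemma contDiff_polyFun (p : MvPolynomial (Fin (d + 1)) ℂ) (n : ℕ) :
    ContDiff ℝ (n : WithTop ℕ∞) (polyFun p) := by
  induction p using MvPolynomial.induction_on with
  | C a =>
    have : polyFun (d := d) (MvPolynomial.C a) = fun _ => a := by
      ext y
      simp [polyFun]
    rw [this]
    exact contDiff_const
  | add p q hp hq =>
    have : polyFun (p + q) = fun y => polyFun p y + polyFun q y := by
      ext y
      simp [polyFun]
    rw [this]
    exact hp.add hq
  | mul_X p m hp =>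
    have : polyFun (p * MvPolynomial.X m) = fun y => polyFun p y * coordC m y := by
      ext y
      simp [polyFun, coordC_apply]
    rw [this]
    exact hp.mul (coordC m).contDiff

lemma laplacian_polyFun (p : MvPolynomial (Fin (d + 1)) ℂ) (x : Amb d) :
    Δ (polyFun p) x = polyFun (polyLaplacian d p) x := by
  rw [laplacian_eq_sum_fderiv, polyLaplacian_apply]
  have h : ∀ i, fderiv ℝ (fderiv ℝ (polyFun p)) x (EuclideanSpace.basisFun (Fin (d + 1)) ℝ i)
      (EuclideanSpace.basisFun (Fin (d + 1)) ℝ i)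
      = polyFun (MvPolynomial.pderiv i (MvPolynomial.pderiv i p)) x := by
    intro i
    rw [← fderiv_polyFun_basis (MvPolynomial.pderiv i p)]
    have hd : DifferentiableAt ℝ (fderiv ℝ (polyFun p)) x :=
      (((contDiff_polyFun p 2).fderiv_right (m := 1) (by norm_num)).differentiable
        (by norm_num)) x
    have h1 : HasFDerivAt (fun y => fderiv ℝ (polyFun p) y (EuclideanSpace.basisFun (Fin (d + 1)) ℝ i))
        ((fderiv ℝ (fderiv ℝ (polyFun p)) x).flip (EuclideanSpace.basisFun (Fin (d + 1)) ℝ i)) x := by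
      simpa using hd.hasFDerivAt.clm_apply
        (hasFDerivAt_const (EuclideanSpace.basisFun (Fin (d + 1)) ℝ i) x)
    have h2 : (fun y => fderiv ℝ (polyFun p) y (EuclideanSpace.basisFun (Fin (d + 1)) ℝ i))
        = polyFun (MvPolynomial.pderiv i p) := funext fun y => fderiv_polyFun_basis p y i
    rw [h2] at h1
    rw [h1.fderiv]
    rfl
  simp only [h]
  simp [polyFun]

lemma homogeneousC2_polyFun {p : MvPolynomial (Fin (d + 1)) ℂ} {l : ℕ} (hp : p.IsHomogeneous l) :
    HomogeneousC2 (polyFun p) l where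
  contDiffAt x _ := (contDiff_polyFun p 2).contDiffAt
  homogeneous t _ x _ := by
    rw [polyFun, polyFun, MvPolynomial.aeval_def, MvPolynomial.aeval_def, MvPolynomial.eval₂_eq,
      MvPolynomial.eval₂_eq, Finset.smul_sum]
    refine Finset.sum_congr rfl fun m hm => ?_
    have hdeg : ∑ i ∈ m.support, m i = l := (hp.degree_eq_sum_deg_support hm).symm
    have hx : ∀ i, (((t • x) i : ℝ) : ℂ) = (t : ℂ) * ((x i : ℝ) : ℂ) := fun i => by simp
    simp only [hx, mul_pow, Finset.prod_mul_distrib, Finset.prod_pow_eq_pow_sum, hdeg,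
      Complex.real_smul]
    push_cast
    ring

/-- Spherical harmonics of different orders are orthogonal. -/
theorem integral_mul_harmonicSpace_eq_zero (hd : 1 ≤ d) {l m : ℕ} (hlm : l ≠ m) {f g : Sph d → ℂ}
    (hf : f ∈ harmonicSpace d l) (hg : g ∈ harmonicSpace d m) :
    ∫ x, f x * g x ∂(surfaceMeasure d) = 0 := by
  obtain ⟨p, ⟨hp, hpΔ⟩, rfl⟩ := hf
  obtain ⟨q, ⟨hq, hqΔ⟩, rfl⟩ := hg
  rw [SetLike.mem_coe, LinearMap.mem_ker] at hpΔ hqΔ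
  -- Both Laplacians vanish, leaving `(l - m)(l + m + d - 1) ∫ fg = 0`; neither factor is zero,
  -- since `l ≠ m` and `d ≥ 1`.
  have := integral_sphere_green hd (homogeneousC2_polyFun hp) (homogeneousC2_polyFun hq)
  simp only [laplacian_polyFun, hpΔ, hqΔ] at this
  have h0 : ∀ x, polyFun (0 : MvPolynomial (Fin (d + 1)) ℂ) x = 0 := fun x => by simp [polyFun]
  simp only [h0, zero_mul, mul_zero, sub_zero, integral_zero] at this
  have h1 : ((l : ℂ) - m) ≠ 0 := sub_ne_zero.2 (by exact_mod_cast hlm)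
  have h2 : ((l + m + d : ℂ) - 1) ≠ 0 := by
    rw [sub_ne_zero]
    have : l + m + d ≠ 1 := by omega
    exact_mod_cast this
  exact (mul_eq_zero.1 this.symm).resolve_left (mul_ne_zero h1 h2)

/-- `f` is `n` times continuously differentiable, in terms of its radial extension. -/
def SphereContDiff (n : ℕ) (f : Sph d → ℝ) : Prop :=
  ∀ x : Amb d, x ≠ 0 → ContDiffAt ℝ (n : WithTop ℕ∞) (radialExtension f) x

lemma radialExtension_coe (f : Sph d → ℝ) (x : Sph d) : radialExtension f x.1 = f x := by
  have hx : ‖x.1‖ = 1 := by simp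
  rw [radialExtension, hx, inv_one, one_smul, Subtype.val_injective.extend_apply]

lemma norm_inv_smul_mem_sphere {y : Amb d} (hy : y ≠ 0) :
    ‖y‖⁻¹ • y ∈ Metric.sphere (0 : Amb d) 1 := by
  rw [mem_sphere_zero_iff_norm, norm_smul, norm_inv, norm_norm,
    inv_mul_cancel₀ (norm_ne_zero_iff.2 hy)]

lemma radialExtension_of_ne (f : Sph d → ℝ) {y : Amb d} (hy : y ≠ 0) :
    radialExtension f y = f ⟨‖y‖⁻¹ • y, norm_inv_smul_mem_sphere hy⟩ :=
  Subtype.val_injective.extend_apply f 0 ⟨‖y‖⁻¹ • y, norm_inv_smul_mem_sphere hy⟩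

lemma radialExtension_smul (f : Sph d → ℝ) {t : ℝ} (ht : 0 < t) (y : Amb d) :
    radialExtension f (t • y) = radialExtension f y := by
  rw [radialExtension, radialExtension, norm_smul, Real.norm_of_nonneg ht.le, mul_inv, smul_smul,
    mul_right_comm, inv_mul_cancel₀ ht.ne', one_mul]

lemma contDiffAt_norm_inv_smul {n : ℕ} {y : Amb d} (hy : y ≠ 0) :
    ContDiffAt ℝ (n : WithTop ℕ∞) (fun y : Amb d => ‖y‖⁻¹ • y) y :=
  ((contDiffAt_norm ℝ hy).inv (norm_ne_zero_iff.2 hy)).smul contDiffAt_id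

/-- Off the origin the radial extension is `f` composed with the smooth map `y ↦ y / ‖y‖` into the
sphere. This carries regularity on the manifold over to calculus in the ambient space. -/
lemma SphereContDiff.of_contMDiff {n : ℕ} {f : Sph d → ℝ}
    (hf : ContMDiff (𝓡 d) 𝓘(ℝ, ℝ) (n : WithTop ℕ∞) f) : SphereContDiff n f := by
  intro x hx
  let V : TopologicalSpace.Opens (Amb d) := ⟨{0}ᶜ, isOpen_compl_singleton⟩
  have hφ : ContMDiff 𝓘(ℝ, Amb d) 𝓘(ℝ, Amb d) (n : WithTop ℕ∞)
      (fun y : V => ‖y.1‖⁻¹ • y.1) := fun y =>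
    (contMDiffAt_subtype_iff (f := fun y : Amb d => ‖y‖⁻¹ • y)).2
      (contDiffAt_norm_inv_smul y.2).contMDiffAt
  have hcr := hφ.codRestrict_sphere (n := d) (fun y => norm_inv_smul_mem_sphere y.2)
  have hcomp := hf.comp hcr
  have hr : ContMDiffAt 𝓘(ℝ, Amb d) 𝓘(ℝ, ℝ) (n : WithTop ℕ∞)
      (fun y : V => radialExtension f y.1) ⟨x, hx⟩ := by
    refine (hcomp ⟨x, hx⟩).congr_of_eventuallyEq (Eventually.of_forall fun y => ?_)
    exact radialExtension_of_ne f y.2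
  exact (contMDiffAt_subtype_iff.1 hr).contDiffAt

lemma SphereContDiff.continuous {n : ℕ} {f : Sph d → ℝ} (hf : SphereContDiff n f) :
    Continuous f := by
  rw [continuous_iff_continuousAt]
  intro x
  have hx : x.1 ≠ 0 := ne_zero_of_mem_unit_sphere x
  have := (hf x.1 hx).continuousAt.comp (f := (Subtype.val : Sph d → Amb d))
    continuous_subtype_val.continuousAt
  exact this.congr (Eventually.of_forall fun y => radialExtension_coe f y)

lemma SphereContDiff.laplaceBeltrami {n : ℕ} {f : Sph d → ℝ} (hf : SphereContDiff (n + 2) f) :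
    SphereContDiff n (laplaceBeltrami f) := by
  intro x hx
  have h1 : ContDiffAt ℝ (n : WithTop ℕ∞) (fun y => Δ (radialExtension f) (‖y‖⁻¹ • y)) x :=
    (contDiffAt_laplacian (hf _ (smul_ne_zero (inv_ne_zero (norm_ne_zero_iff.2 hx)) hx))).comp
      (f := fun y : Amb d => ‖y‖⁻¹ • y) x
      (contDiffAt_norm_inv_smul hx)
  refine h1.congr_of_eventuallyEq ?_
  filter_upwards [isOpen_compl_singleton.mem_nhds hx] with y hy
  exact radialExtension_of_ne _ hy

lemma SphereContDiff.iterate_laplaceBeltrami (k : ℕ) : ∀ {n : ℕ} {f : Sph d → ℝ},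
    SphereContDiff (n + 2 * k) f → SphereContDiff n (SphereDeconv.laplaceBeltrami^[k] f) := by
  induction k with
  | zero => exact fun hf => hf
  | succ k ih =>
    intro n f hf
    rw [Function.iterate_succ_apply]
    exact ih (SphereContDiff.laplaceBeltrami (by rwa [show n + 2 * (k + 1) = n + 2 * k + 2 by ring] at hf))

/-- The Laplace-Beltrami operator is symmetric against spherical harmonics, which are
eigenfunctions with eigenvalue `-l(l+d-1)`. -/
theorem integral_laplaceBeltrami_mul (hd : 1 ≤ d) {f : Sph d → ℝ} (hf : SphereContDiff 2 f)
    {l : ℕ} {g : Sph d → ℂ} (hg : g ∈ harmonicSpace d l) :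
    ∫ x, (laplaceBeltrami f x : ℂ) * g x ∂(surfaceMeasure d)
      = -((l * (l + d - 1) : ℝ) : ℂ) * ∫ x, (f x : ℂ) * g x ∂(surfaceMeasure d) := by
  obtain ⟨q, ⟨hq, hqΔ⟩, rfl⟩ := hg
  rw [SetLike.mem_coe, LinearMap.mem_ker] at hqΔ
  -- Green's formula with degrees `a = 0` and `b = l`: the factor `(a - b)(a + b + d - 1)` becomes
  -- `-l(l + d - 1)`.
  have hF : HomogeneousC2 (fun y : Amb d => ((radialExtension f y : ℝ) : ℂ)) 0 :=
    { contDiffAt := fun x hx => Complex.ofRealCLM.contDiff.contDiffAt.comp x (hf x hx)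
      homogeneous := fun t ht x _ => by
        rw [radialExtension_smul f ht, pow_zero, one_smul] }
  have hΔ : ∀ s : Sph d, Δ (fun y : Amb d => ((radialExtension f y : ℝ) : ℂ)) s.1
      = (laplaceBeltrami f s : ℂ) := fun s =>
    (hf s.1 (ne_zero_of_mem_unit_sphere s)).laplacian_CLM_comp_left (l := Complex.ofRealCLM)
  have := integral_sphere_green hd hF (homogeneousC2_polyFun hq)
  have h0 : ∀ x, polyFun (0 : MvPolynomial (Fin (d + 1)) ℂ) x = 0 := fun x => by simp [polyFun]
  simp only [laplacian_polyFun, hqΔ, h0, mul_zero, sub_zero, hΔ, radialExtension_coe] at this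
  rw [show ∫ x, (laplaceBeltrami f x : ℂ) * restrictToSphere d q x ∂(surfaceMeasure d) = _ from this]
  push_cast
  simp only [restrictToSphere_eq_polyFun]
  ring

lemma integral_iterate_laplaceBeltrami_mul (hd : 1 ≤ d) (k : ℕ) : ∀ {f : Sph d → ℝ},
    SphereContDiff (2 * k) f → ∀ {l : ℕ} {g : Sph d → ℂ}, g ∈ harmonicSpace d l →
    ∫ x, ((laplaceBeltrami^[k] f x : ℝ) : ℂ) * g x ∂(surfaceMeasure d)
      = (-((l * (l + d - 1) : ℝ) : ℂ)) ^ k * ∫ x, (f x : ℂ) * g x ∂(surfaceMeasure d) := by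
  induction k with
  | zero => intro f _ l g _; simp
  | succ k ih =>
    intro f hf l g hg
    rw [Function.iterate_succ_apply, ih (SphereContDiff.laplaceBeltrami hf) hg,
      integral_laplaceBeltrami_mul hd (fun x hx => (hf x hx).of_le ?_) hg]
    · ring
    · exact_mod_cast (by omega : 2 ≤ 2 * (k + 1))

end LaplaceBeltrami

/-! ### Invariance of the surface measure and of the harmonic spaces under isometries -/

section Invariance

open scoped Pointwise

variable {d : ℕ}

instance instIsFiniteMeasureSurface : IsFiniteMeasure (surfaceMeasure d) := by
  unfold surfaceMeasure
  infer_instance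

instance instIsOpenPosMeasureSurface : (surfaceMeasure d).IsOpenPosMeasure := by
  unfold surfaceMeasure
  infer_instance

lemma integrable_of_continuous {f : Sph d → ℂ} (hf : Continuous f) :
    Integrable f (surfaceMeasure d) :=
  hf.integrable_of_hasCompactSupport (HasCompactSupport.of_compactSpace f)

/-- The action of a linear isometry on the sphere. -/
def sphMap (R : Amb d ≃ₗᵢ[ℝ] Amb d) (x : Sph d) : Sph d :=
  ⟨R x.1, by simp⟩

lemma continuous_sphMap (R : Amb d ≃ₗᵢ[ℝ] Amb d) : Continuous (sphMap R) :=
  (R.continuous.comp continuous_subtype_val).subtype_mk _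

/-- The surface measure is invariant under linear isometries. -/
theorem measurePreserving_sphMap (R : Amb d ≃ₗᵢ[ℝ] Amb d) :
    MeasurePreserving (sphMap R) (surfaceMeasure d) (surfaceMeasure d) := by
  refine ⟨(continuous_sphMap R).measurable, ?_⟩
  ext s hs
  rw [Measure.map_apply (continuous_sphMap R).measurable hs, surfaceMeasure,
    Measure.toSphere_apply' _ ((continuous_sphMap R).measurable hs),
    Measure.toSphere_apply' _ hs]
  congr 1
  -- The cone over a preimage is the preimage of the cone, and `R` preserves Lebesgue measure.
  have hset : Set.Ioo (0 : ℝ) 1 • (Subtype.val '' (sphMap R ⁻¹' s))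
      = R ⁻¹' (Set.Ioo (0 : ℝ) 1 • (Subtype.val '' s)) := by
    ext y
    simp only [Set.mem_smul, Set.mem_image, Set.mem_preimage]
    constructor
    · rintro ⟨r, hr, _, ⟨x, hx, rfl⟩, rfl⟩
      exact ⟨r, hr, _, ⟨_, hx, rfl⟩, by rw [map_smul]; rfl⟩
    · rintro ⟨r, hr, _, ⟨x, hx, rfl⟩, h⟩
      refine ⟨r, hr, _, ⟨sphMap R.symm x, ?_, rfl⟩, ?_⟩
      · have : sphMap R (sphMap R.symm x) = x := Subtype.ext (R.apply_symm_apply x.1)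
        rwa [this]
      · apply R.injective
        rw [map_smul, ← h]
        congr 1
        exact R.apply_symm_apply x.1
  rw [hset]
  exact R.measurePreserving.measure_preimage_emb R.toHomeomorph.measurableEmbedding _

lemma integral_comp_sphMap (R : Amb d ≃ₗᵢ[ℝ] Amb d) {f : Sph d → ℂ} (hf : Continuous f) :
    ∫ x, f (sphMap R x) ∂(surfaceMeasure d) = ∫ x, f x ∂(surfaceMeasure d) := by
  conv_rhs => rw [← (measurePreserving_sphMap R).map_eq]
  exact (integral_map (continuous_sphMap R).measurable.aemeasurable
    hf.aestronglyMeasurable).symm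

/-- Any point of the sphere is moved to any other one by a linear isometry. -/
lemma exists_sphMap_eq (x y : Sph d) : ∃ R : Amb d ≃ₗᵢ[ℝ] Amb d, sphMap R x = y :=
  -- The reflection in the hyperplane orthogonal to `x - y` maps `x` to `y`, as they have equal
  -- norm. Admitting reflections is why general isometries are used here.
  ⟨(Submodule.span ℝ {x.1 - y.1})ᗮ.reflection,
    Subtype.ext (Submodule.reflection_sub (by simp))⟩

lemma comp_sphMap_mem_harmonicSpace (R : Amb d ≃ₗᵢ[ℝ] Amb d) {l : ℕ} {f : Sph d → ℂ}
    (hf : f ∈ harmonicSpace d l) : (fun x => f (sphMap R x)) ∈ harmonicSpace d l := by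
  set e := EuclideanSpace.basisFun (Fin (d + 1)) ℝ
  set A : Matrix (Fin (d + 1)) (Fin (d + 1)) ℝ :=
    R.toLinearEquiv.toLinearMap.toMatrix e.toBasis e.toBasis with hAdef
  have hA : A * A.transpose = 1 :=
    (Matrix.mem_orthogonalGroup_iff (Fin (d + 1)) ℝ).1 (R.toMatrix_mem_unitaryGroup e e)
  refine comp_mem_harmonicSpace hA (fun x => ?_) hf
  have := LinearMap.toMatrix_mulVec_repr e.toBasis e.toBasis R.toLinearEquiv.toLinearMap x.1
  exact this.symm

/-- The linear isometry given by a rotation matrix. -/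
def rotIsometry (u : Rot d) : Amb d ≃ₗᵢ[ℝ] Amb d :=
  LinearIsometry.toLinearIsometryEquiv
    { toLinearMap := Matrix.toEuclideanLin u.mat
      norm_map' := fun x => by
        have h1 : ∀ y : Amb d, ‖y‖ ^ 2 = dotProduct y.ofLp y.ofLp := fun y => by
          rw [EuclideanSpace.norm_sq_eq]
          simp [dotProduct, sq]
        have h2 : ‖Matrix.toEuclideanLin u.mat x‖ ^ 2 = ‖x‖ ^ 2 := by
          rw [h1, h1]
          change dotProduct (u.mat.mulVec x.ofLp) (u.mat.mulVec x.ofLp) = _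
          rw [Matrix.dotProduct_mulVec, ← Matrix.mulVec_transpose, Matrix.mulVec_mulVec,
            Rot.transpose_mul, Matrix.one_mulVec]
        exact (pow_left_inj₀ (norm_nonneg _) (norm_nonneg _) two_ne_zero).1 h2 } rfl

lemma sphMap_rotIsometry (u : Rot d) (x : Sph d) : sphMap (rotIsometry u) x = rotate u x := rfl

end Invariance

/-! ### The addition theorem on the diagonal -/

namespace IsHarmonicBasis

variable {d l : ℕ} {B : Fin (harmonicDim d l) → Sph d → ℂ}

lemma mem (h : IsHarmonicBasis d l B) (q : Fin (harmonicDim d l)) :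
    B q ∈ harmonicSpace d l := by
  rw [← h.span_eq]
  exact Submodule.subset_span ⟨q, rfl⟩

lemma continuous (h : IsHarmonicBasis d l B) (q : Fin (harmonicDim d l)) : Continuous (B q) :=
  continuous_of_mem_harmonicSpace (h.mem q)

/-- Expansion of a spherical harmonic in an orthonormal basis. -/
lemma eq_sum (h : IsHarmonicBasis d l B) {f : Sph d → ℂ} (hf : f ∈ harmonicSpace d l)
    (x : Sph d) : f x = ∑ r, (∫ y, f y * star (B r y) ∂(surfaceMeasure d)) * B r x := by
  rw [← h.span_eq, Submodule.mem_span_range_iff_exists_fun] at hf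
  obtain ⟨c, rfl⟩ := hf
  have hc : ∀ r, ∫ y, (∑ q, c q • B q) y * star (B r y) ∂(surfaceMeasure d) = c r := by
    intro r
    have e : ∀ y, (∑ q, c q • B q) y * star (B r y) = ∑ q, c q * (B q y * star (B r y)) := by
      intro y
      simp only [Finset.sum_apply, Pi.smul_apply, smul_eq_mul, Finset.sum_mul, mul_assoc]
    simp only [e]
    rw [integral_finsetSum]
    · simp only [integral_const_mul, h.orthonormal, mul_ite, mul_one, mul_zero,
        Finset.sum_ite_eq', Finset.mem_univ, if_true]
    · exact fun q _ => (integrable_of_continuous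
        ((h.continuous q).mul (h.continuous r).star)).const_mul _
  simp only [hc]
  simp

/-- The sum of the squared moduli of an orthonormal basis is invariant under isometries. -/
lemma sum_normSq_comp (h : IsHarmonicBasis d l B) (R : Amb d ≃ₗᵢ[ℝ] Amb d) (x : Sph d) :
    ∑ q, B q (sphMap R x) * star (B q (sphMap R x)) = ∑ q, B q x * star (B q x) := by
  set c : Matrix (Fin (harmonicDim d l)) (Fin (harmonicDim d l)) ℂ := Matrix.of fun q r =>
    ∫ y, B q (sphMap R y) * star (B r y) ∂(surfaceMeasure d) with hc
  have hexp : ∀ q y, B q (sphMap R y) = ∑ r, c q r * B r y := fun q y =>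
    h.eq_sum (comp_sphMap_mem_harmonicSpace R (h.mem q)) y
  have hcc : c * c.conjTranspose = 1 := by
    ext q q'
    have h1 := integral_comp_sphMap R ((h.continuous q).mul (h.continuous q').star)
    rw [Matrix.one_apply, ← h.orthonormal q q']
    refine Eq.trans ?_ h1
    have e : ∀ y, B q (sphMap R y) * star (B q' (sphMap R y))
        = ∑ r, ∑ r', c q r * star (c q' r') * (B r y * star (B r' y)) := by
      intro y
      rw [hexp q, hexp q', star_sum, Finset.sum_mul_sum]
      refine Finset.sum_congr rfl fun r _ => Finset.sum_congr rfl fun r' _ => ?_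
      rw [star_mul']
      ring
    simp only [Pi.mul_apply, e]
    have hi : ∀ r r', Integrable (fun y => c q r * star (c q' r') * (B r y * star (B r' y)))
        (surfaceMeasure d) := fun r r' =>
      (integrable_of_continuous ((h.continuous r).mul (h.continuous r').star)).const_mul _
    rw [integral_finsetSum _ fun r _ => integrable_finsetSum _ fun r' _ => hi r r',
      Matrix.mul_apply]
    refine Finset.sum_congr rfl fun r _ => ?_
    rw [integral_finsetSum _ fun r' _ => hi r r']
    simp only [integral_const_mul, h.orthonormal, mul_ite, mul_one, mul_zero, Finset.sum_ite_eq,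
      Finset.mem_univ, if_true, Matrix.conjTranspose_apply]
  -- Invariance of the measure gives orthonormal rows; the sum over `q` needs orthonormal columns,
  -- which follow because `c` is square.
  have hcc' : c.conjTranspose * c = 1 := mul_eq_one_comm.1 hcc
  have hent : ∀ r r', ∑ q, star (c q r') * c q r = if r' = r then 1 else 0 := fun r r' => by
    have := congrFun (congrFun hcc' r') r
    rwa [Matrix.mul_apply, Matrix.one_apply] at this
  calc ∑ q, B q (sphMap R x) * star (B q (sphMap R x))
      = ∑ q, ∑ r, ∑ r', (star (c q r') * c q r) * (B r x * star (B r' x)) := by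
        refine Finset.sum_congr rfl fun q _ => ?_
        rw [hexp q, star_sum, Finset.sum_mul_sum]
        refine Finset.sum_congr rfl fun r _ => Finset.sum_congr rfl fun r' _ => ?_
        rw [star_mul']
        ring
    _ = ∑ r, ∑ r', (∑ q, star (c q r') * c q r) * (B r x * star (B r' x)) := by
        rw [Finset.sum_comm]
        refine Finset.sum_congr rfl fun r _ => ?_
        rw [Finset.sum_comm]
        exact Finset.sum_congr rfl fun r' _ => (Finset.sum_mul _ _ _).symm
    _ = _ := by simp only [hent, ite_mul, one_mul, zero_mul, Finset.sum_ite_eq', Finset.mem_univ, if_true]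

/-- The addition theorem on the diagonal. -/
theorem sum_norm_sq (h : IsHarmonicBasis d l B) (x : Sph d) :
    (∑ q, ‖B q x‖ ^ 2) * (surfaceMeasure d).real Set.univ = harmonicDim d l := by
  -- Isometries act transitively, so the sum is constant; its integral counts the basis elements.
  have hconst : ∀ y, ∑ q, B q y * star (B q y) = ∑ q, B q x * star (B q x) := fun y => by
    obtain ⟨R, rfl⟩ := exists_sphMap_eq x y
    exact h.sum_normSq_comp R x
  have h1 : ∫ y, ∑ q, B q y * star (B q y) ∂(surfaceMeasure d) = harmonicDim d l := by
    have hi : ∀ q, Integrable (fun y => B q y * star (B q y)) (surfaceMeasure d) := fun q =>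
      integrable_of_continuous ((h.continuous q).mul (h.continuous q).star)
    rw [integral_finsetSum _ fun q _ => hi q]
    simp only [h.orthonormal, if_true]
    simp
  simp only [hconst, integral_const] at h1
  have h2 : ∑ q, B q x * star (B q x) = ((∑ q, ‖B q x‖ ^ 2 : ℝ) : ℂ) := by
    push_cast
    refine Finset.sum_congr rfl fun q _ => ?_
    exact Complex.mul_conj' _
  rw [h2, Complex.real_smul] at h1
  rw [mul_comm]
  exact_mod_cast h1

end IsHarmonicBasis

/-! ### Growth of the dimensions of the harmonic spaces -/

section Dimension

lemma surfaceMeasure_real_univ_pos (d : ℕ) : 0 < (surfaceMeasure d).real Set.univ := by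
  have hne : Nonempty (Sph d) :=
    ((NormedSpace.sphere_nonempty (x := (0 : Amb d)) (r := 1)).2 zero_le_one).to_subtype
  exact ENNReal.toReal_pos (isOpen_univ.measure_ne_zero _ Set.univ_nonempty) (measure_ne_top _ _)

lemma harmonicDim_le {d l : ℕ} (hd : 1 ≤ d) (hl : 1 ≤ l) :
    harmonicDim d l ≤ (d + 1) ^ d * l ^ (d - 1) := by
  rw [harmonicDim, if_neg (by omega)]
  refine Nat.div_le_of_le_mul ?_
  -- For `d = 1` the quotient is 2. For `d = e + 2` the ratio `(l+e)! / l!` is at most `(l+e)^e`.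
  rcases Nat.lt_or_ge d 2 with h | h
  · obtain rfl : d = 1 := by omega
    obtain ⟨m, rfl⟩ : ∃ m, l = m + 1 := ⟨l - 1, by omega⟩
    simp [Nat.factorial_succ]
    nlinarith
  · obtain ⟨e, rfl⟩ : ∃ e, d = e + 2 := ⟨d - 2, by omega⟩
    have h1 : (l + (e + 2) - 2).factorial ≤ l.factorial * (l + e) ^ e := by
      rw [show l + (e + 2) - 2 = l + e by omega, ← Nat.factorial_mul_ascFactorial]
      exact Nat.mul_le_mul_left _ (Nat.ascFactorial_le_pow_add l e)
    have h2 : 2 * l + (e + 2) - 1 ≤ (e + 3) * l := by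
      have : e + 1 ≤ (e + 1) * l := Nat.le_mul_of_pos_right _ hl
      have e1 : (e + 3) * l = 2 * l + (e + 1) * l := by ring
      omega
    have h3 : l + e ≤ (e + 3) * l := by
      have : e ≤ e * l := Nat.le_mul_of_pos_right _ hl
      nlinarith
    calc (2 * l + (e + 2) - 1) * (l + (e + 2) - 2).factorial
        ≤ ((e + 3) * l) * (l.factorial * ((e + 3) * l) ^ e) :=
          Nat.mul_le_mul h2 (h1.trans (Nat.mul_le_mul_left _ (Nat.pow_le_pow_left h3 e)))
      _ = l.factorial * 1 * ((e + 3) ^ (e + 1) * l ^ (e + 1)) := by rw [mul_pow]; ring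
      _ ≤ l.factorial * (e + 2 - 1).factorial * ((e + 2 + 1) ^ (e + 2) * l ^ (e + 2 - 1)) := by
          refine Nat.mul_le_mul (Nat.mul_le_mul_left _ (Nat.factorial_pos _)) ?_
          exact Nat.mul_le_mul (Nat.pow_le_pow_right (by omega) (by omega)) le_rfl

/-- The addition theorem makes the bound uniform in the point and in the basis. Degree 0 is excluded
because `l ^ (d - 1)` vanishes there when `d ≥ 2`. -/
lemma exists_sum_norm_sq_le {d : ℕ} (hd : 1 ≤ d) :
    ∃ C : ℝ, 0 < C ∧ ∀ (l : ℕ), 1 ≤ l → ∀ (B : Fin (harmonicDim d l) → Sph d → ℂ),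
      IsHarmonicBasis d l B → ∀ x, ∑ q, ‖B q x‖ ^ 2 ≤ C * (l : ℝ) ^ (d - 1) := by
  have hω := surfaceMeasure_real_univ_pos d
  refine ⟨((d + 1 : ℕ) : ℝ) ^ d / (surfaceMeasure d).real Set.univ, by positivity, ?_⟩
  intro l hl B hB x
  have h1 := hB.sum_norm_sq x
  have h2 : (harmonicDim d l : ℝ) ≤ ((d + 1 : ℕ) : ℝ) ^ d * (l : ℝ) ^ (d - 1) := by
    exact_mod_cast harmonicDim_le hd hl
  rw [div_mul_eq_mul_div, le_div_iff₀ hω, h1]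
  exact h2

end Dimension

/-! ### Completeness of the spherical harmonics -/

section Density

variable {d : ℕ}

/-- A continuous function orthogonal to all spherical harmonics vanishes. -/
theorem eq_zero_of_orthogonal_harmonicSpace {e : Sph d → ℂ} (he : Continuous e)
    (horth : ∀ l, ∀ g ∈ harmonicSpace d l, ∫ x, e x * g x ∂(surfaceMeasure d) = 0) : e = 0 := by
  have hpoly : ∀ p, ∫ x, e x * restrictToSphere d p x ∂(surfaceMeasure d) = 0 := by
    intro p
    have : restrictToSphere d p ∈ ⨆ l, harmonicSpace d l := restrictToSphere_mem_iSup p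
    suffices h : ∀ g ∈ ⨆ l, harmonicSpace d l,
        -- Continuity is carried through the induction because splitting the integral of a sum needs
        -- integrability.
        Continuous g ∧ ∫ x, e x * g x ∂(surfaceMeasure d) = 0 from (h _ this).2
    intro g hg
    refine Submodule.iSup_induction (harmonicSpace d)
      (motive := fun g => Continuous g ∧ ∫ x, e x * g x ∂(surfaceMeasure d) = 0) hg ?_ ?_ ?_
    · exact fun l g hg => ⟨continuous_of_mem_harmonicSpace hg, horth l g hg⟩
    · exact ⟨continuous_const, by simp⟩
    · rintro g₁ g₂ ⟨h₁, h₁'⟩ ⟨h₂, h₂'⟩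
      refine ⟨h₁.add h₂, ?_⟩
      simp only [Pi.add_apply, mul_add]
      have i₁ : Integrable (fun x => e x * g₁ x) (surfaceMeasure d) :=
        integrable_of_continuous (he.mul h₁)
      have i₂ : Integrable (fun x => e x * g₂ x) (surfaceMeasure d) :=
        integrable_of_continuous (he.mul h₂)
      rw [integral_add i₁ i₂, h₁', h₂', add_zero]
  let coord : Fin (d + 1) → C(Sph d, ℂ) := fun i => ⟨fun x => ((x.1 i : ℝ) : ℂ), by fun_prop⟩
  -- Stone-Weierstrass: the coordinates separate points, and every element of the algebra they
  -- generate is the restriction of a polynomial.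
  set A := StarAlgebra.adjoin ℂ (Set.range coord)
  have hAp : ∀ a ∈ A, ∃ p, ∀ x, a x = restrictToSphere d p x := by
    intro a ha
    refine StarAlgebra.adjoin_induction
      (p := fun a _ => ∃ p, ∀ x, a x = restrictToSphere d p x) ?_ ?_ ?_ ?_ ?_ ha
    · rintro _ ⟨i, rfl⟩
      exact ⟨MvPolynomial.X i, fun x => by simp [restrictToSphere_apply, coord]⟩
    · exact fun r => ⟨MvPolynomial.C r, fun x => by simp [restrictToSphere_apply]⟩
    · rintro a b _ _ ⟨p, hp⟩ ⟨q, hq⟩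
      exact ⟨p + q, fun x => by simp [hp, hq]⟩
    · rintro a b _ _ ⟨p, hp⟩ ⟨q, hq⟩
      exact ⟨p * q, fun x => by simp [restrictToSphere_apply, hp, hq]⟩
    · rintro a _ ⟨p, hp⟩
      refine ⟨MvPolynomial.map (starRingEnd ℂ) p, fun x => ?_⟩
      rw [ContinuousMap.star_apply, hp, ← restrictToSphere_map_star]
  have hsep : A.SeparatesPoints := by
    intro x y hxy
    obtain ⟨i, hi⟩ : ∃ i, x.1 i ≠ y.1 i := by
      by_contra! h
      exact hxy (Subtype.ext (PiLp.ext h))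
    refine ⟨coord i, ⟨coord i, StarAlgebra.subset_adjoin ℂ _ ⟨i, rfl⟩, rfl⟩, ?_⟩
    simpa [coord] using hi
  have htop := ContinuousMap.starSubalgebra_topologicalClosure_eq_top_of_separatesPoints A hsep
  have hint : ∀ a : C(Sph d, ℂ), Integrable (fun x => e x * a x) (surfaceMeasure d) := fun a =>
    integrable_of_continuous (he.mul a.continuous)
  have hcont : Continuous fun a : C(Sph d, ℂ) => ∫ x, e x * a x ∂(surfaceMeasure d) := by
    refine LipschitzWith.continuous (K := (∫ x, ‖e x‖ ∂(surfaceMeasure d)).toNNReal)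
      (LipschitzWith.of_dist_le_mul fun a b => ?_)
    rw [Real.coe_toNNReal _ (integral_nonneg fun x => norm_nonneg _), dist_eq_norm,
      ← integral_sub (hint a) (hint b), ← integral_mul_const]
    refine norm_integral_le_of_norm_le
      ((integrable_of_continuous he).norm.mul_const _) (ae_of_all _ fun x => ?_)
    rw [← mul_sub, norm_mul, ← dist_eq_norm]
    exact mul_le_mul_of_nonneg_left (ContinuousMap.dist_apply_le_dist x) (norm_nonneg _)
  have hzero : ∀ a : C(Sph d, ℂ), ∫ x, e x * a x ∂(surfaceMeasure d) = 0 := by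
    intro a
    have ha : a ∈ closure (A : Set C(Sph d, ℂ)) := by
      rw [← StarSubalgebra.topologicalClosure_coe, htop]
      trivial
    have hcl : IsClosed {a : C(Sph d, ℂ) | ∫ x, e x * a x ∂(surfaceMeasure d) = 0} :=
      isClosed_eq hcont continuous_const
    refine closure_minimal (fun b hb => ?_) hcl ha
    obtain ⟨p, hp⟩ := hAp b hb
    change ∫ x, e x * b x ∂(surfaceMeasure d) = 0
    simp only [hp, hpoly]
  -- Testing against the conjugate of `e` gives `∫ |e|² = 0`; open sets have positive measure, so
  -- the continuous `e` vanishes everywhere.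
  have h2 := hzero ⟨fun x => star (e x), he.star⟩
  have h3 : ∀ x, e x * star (e x) = ((‖e x‖ ^ 2 : ℝ) : ℂ) := fun x => by
    push_cast
    exact Complex.mul_conj' _
  simp only [ContinuousMap.coe_mk, h3] at h2
  have hn : Continuous fun x => ‖e x‖ ^ 2 := he.norm.pow 2
  rw [integral_complex_ofReal, Complex.ofReal_eq_zero,
    integral_eq_zero_iff_of_nonneg (fun x => by positivity)
      (hn.integrable_of_hasCompactSupport (HasCompactSupport.of_compactSpace _)),
    Continuous.ae_eq_iff_eq _ hn continuous_zero] at h2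
  funext x
  simpa using congrFun h2 x

end Density

/-! ### Bessel's inequality -/

section Bessel

variable {d : ℕ} {B : HarmonicFamily d}

lemma integral_mul_star_harmonicBasis (hd : 1 ≤ d) (hB : ∀ l, IsHarmonicBasis d l (B l))
    (i j : Σ l, Fin (harmonicDim d l)) :
    ∫ x, B i.1 i.2 x * star (B j.1 j.2 x) ∂(surfaceMeasure d) = if i = j then 1 else 0 := by
  obtain ⟨l, q⟩ := i
  obtain ⟨m, r⟩ := j
  by_cases h : l = m
  · subst h
    simp only [(hB l).orthonormal, Sigma.mk.injEq, heq_eq_eq, true_and]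
  · rw [if_neg (by simp [h])]
    exact integral_mul_harmonicSpace_eq_zero hd h ((hB l).mem q)
      (star_mem_harmonicSpace ((hB m).mem r))

/-- Bessel's inequality for the hyperspherical Fourier transform. -/
theorem summable_sum_norm_sphFourier_sq (hd : 1 ≤ d) (hB : ∀ l, IsHarmonicBasis d l (B l))
    {g : Sph d → ℂ} (hg : Continuous g) : Summable fun l => ∑ q, ‖sphFourier B g l q‖ ^ 2 := by
  have hL : ∀ {f : Sph d → ℂ}, Continuous f → MemLp f 2 (surfaceMeasure d) := fun hf =>
    hf.memLp_of_hasCompactSupport (HasCompactSupport.of_compactSpace _)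
  let e : (Σ l, Fin (harmonicDim d l)) → Lp ℂ 2 (surfaceMeasure d) := fun i =>
    (hL ((hB i.1).continuous i.2)).toLp
  have hin : ∀ {f h : Sph d → ℂ} (hf : Continuous f) (hh : Continuous h),
      inner ℂ ((hL hf).toLp f) ((hL hh).toLp h) = ∫ x, h x * star (f x) ∂(surfaceMeasure d) := by
    intro f h hf hh
    rw [L2.inner_def]
    refine integral_congr_ae ?_
    filter_upwards [(hL hf).coeFn_toLp, (hL hh).coeFn_toLp] with x h1 h2
    rw [h1, h2]
    rfl
  have hon : Orthonormal ℂ e := by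
    rw [orthonormal_iff_ite]
    intro i j
    rw [hin ((hB i.1).continuous i.2) ((hB j.1).continuous j.2),
      integral_mul_star_harmonicBasis hd hB]
    simp only [eq_comm]
  have hs := hon.inner_products_summable (x := (hL hg).toLp)
  -- Bessel's inequality for the whole orthonormal family over all degrees, regrouped by degree.
  have h2 := hs.sigma
  refine h2.congr fun l => ?_
  rw [tsum_fintype]
  refine Finset.sum_congr rfl fun q _ => ?_
  rw [hin ((hB l).continuous q) hg]
  rfl

end Bessel

/-! ### Convergence and truncation error of Fourier-Laplace series -/

section FourierLaplace

variable {d : ℕ} {B : HarmonicFamily d}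

lemma sphFourier_iterate_laplaceBeltrami (hd : 1 ≤ d) (hB : ∀ l, IsHarmonicBasis d l (B l))
    {k : ℕ} {f : Sph d → ℝ} (hf : SphereContDiff (2 * k) f) (l : ℕ) (q : Fin (harmonicDim d l)) :
    sphFourier B (fun y => ((laplaceBeltrami^[k] f y : ℝ) : ℂ)) l q
      = (-((l * (l + d - 1) : ℝ) : ℂ)) ^ k * sphFourier B (fun y => (f y : ℂ)) l q :=
  integral_iterate_laplaceBeltrami_mul hd k hf (star_mem_harmonicSpace ((hB l).mem q))

lemma fourierLaplaceTerm_iterate_laplaceBeltrami (hd : 1 ≤ d)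
    (hB : ∀ l, IsHarmonicBasis d l (B l)) {k : ℕ} {f : Sph d → ℝ}
    (hf : SphereContDiff (2 * k) f) (l : ℕ) (x : Sph d) :
    fourierLaplaceTerm B (laplaceBeltrami^[k] f) l x
      = (-((l * (l + d - 1) : ℝ) : ℂ)) ^ k * fourierLaplaceTerm B f l x := by
  simp only [fourierLaplaceTerm, sphFourier_iterate_laplaceBeltrami hd hB hf, Finset.mul_sum,
    mul_assoc]

/-- As `d ≥ 1`, the eigenvalue has modulus at least `l²`; each application of the operator thus
gains two powers of `l`. -/
lemma pow_le_norm_eigenvalue_pow (hd : 1 ≤ d) (l k : ℕ) :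
    (l : ℝ) ^ (2 * k) ≤ ‖(-((l * (l + d - 1) : ℝ) : ℂ)) ^ k‖ := by
  have hd' : (1 : ℝ) ≤ d := by exact_mod_cast hd
  have h0 : (0 : ℝ) ≤ l * (l + d - 1) := mul_nonneg (by positivity) (by linarith [l.cast_nonneg (α := ℝ)])
  rw [norm_pow, norm_neg, Complex.norm_real, Real.norm_of_nonneg h0, pow_mul]
  refine pow_le_pow_left₀ (by positivity) ?_ k
  nlinarith [l.cast_nonneg (α := ℝ)]

lemma continuous_fourierLaplaceTerm (hB : ∀ l, IsHarmonicBasis d l (B l)) (f : Sph d → ℝ)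
    (l : ℕ) : Continuous (fourierLaplaceTerm B f l) :=
  continuous_finsetSum _ fun q _ => continuous_const.mul ((hB l).continuous q)

lemma norm_sum_mul_le_sqrt {ι : Type*} [Fintype ι] (a b : ι → ℂ) :
    ‖∑ q, a q * b q‖ ≤ √(∑ q, ‖a q‖ ^ 2) * √(∑ q, ‖b q‖ ^ 2) := by
  refine (norm_sum_le _ _).trans ?_
  simp only [norm_mul]
  exact Real.sum_mul_le_sqrt_mul_sqrt _ _ _

/-- Uniform summability of the Fourier-Laplace series of a smooth function. -/
lemma exists_summable_bound_fourierLaplaceTerm (hd : 1 ≤ d) (hB : ∀ l, IsHarmonicBasis d l (B l))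
    {k : ℕ} (hk : d < 4 * k) {f : Sph d → ℝ} (hf : SphereContDiff (2 * k) f) :
    ∃ u : ℕ → ℝ, Summable u ∧ ∀ l x, ‖fourierLaplaceTerm B f l x‖ ≤ u l := by
  obtain ⟨C, hC, hCB⟩ := exists_sum_norm_sq_le hd
  set Φ : ℕ → ℝ := fun l => ∑ q, ‖sphFourier B (fun y => (f y : ℂ)) l q‖ ^ 2 with hΦ
  have hΦ0 : ∀ l, 0 ≤ Φ l := fun l => Finset.sum_nonneg fun q _ => by positivity
  have hcont : Continuous fun y => ((laplaceBeltrami^[k] f y : ℝ) : ℂ) :=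
    Complex.continuous_ofReal.comp
      (SphereContDiff.iterate_laplaceBeltrami k (n := 0) (by simpa using hf)).continuous
  have hA := summable_sum_norm_sphFourier_sq hd hB hcont
  have hΦA : ∀ l, Φ l * ((l : ℝ) ^ (2 * k)) ^ 2
      ≤ ∑ q, ‖sphFourier B (fun y => ((laplaceBeltrami^[k] f y : ℝ) : ℂ)) l q‖ ^ 2 := by
    intro l
    rw [hΦ, Finset.sum_mul]
    refine Finset.sum_le_sum fun q _ => ?_
    rw [sphFourier_iterate_laplaceBeltrami hd hB hf, norm_mul, mul_pow, mul_comm]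
    gcongr
    exact pow_le_norm_eigenvalue_pow hd l k
  have hω : 0 < (surfaceMeasure d).real Set.univ := surfaceMeasure_real_univ_pos d
  -- Bound for `∑ ‖B l q x‖²`, with degree 0 taken directly from the addition theorem.
  set D : ℕ → ℝ := fun l =>
    if l = 0 then (harmonicDim d 0 : ℝ) / (surfaceMeasure d).real Set.univ
      else C * (l : ℝ) ^ (d - 1) with hD
  have hBD : ∀ l x, ∑ q, ‖B l q x‖ ^ 2 ≤ D l := by
    intro l x
    by_cases h : l = 0
    · subst h
      simp only [hD, if_true]
      rw [le_div_iff₀ hω, (hB 0).sum_norm_sq x]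
    · simp only [hD, if_neg h]
      exact hCB l (by omega) _ (hB l) x
  refine ⟨fun l => √(Φ l) * √(D l), ?_, fun l x => ?_⟩
  · rw [← summable_nat_add_iff 1]
    have h1 : Summable fun l : ℕ =>
        (∑ q, ‖sphFourier B (fun y => ((laplaceBeltrami^[k] f y : ℝ) : ℂ)) (l + 1) q‖ ^ 2
          + C * (1 / ((l + 1 : ℕ) : ℝ) ^ 2)) :=
      ((summable_nat_add_iff 1).2 hA).add
        (((summable_nat_add_iff 1).2 (Real.summable_one_div_nat_pow.2 one_lt_two)).mul_left C)
    refine Summable.of_nonneg_of_le (fun l => by positivity) (fun l => ?_) h1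
    have hl : (1 : ℝ) ≤ ((l + 1 : ℕ) : ℝ) := by exact_mod_cast Nat.le_add_left 1 l
    set L : ℝ := ((l + 1 : ℕ) : ℝ)
    have hL0 : 0 < L := by linarith
    have hDl : D (l + 1) = C * L ^ (d - 1) := by simp [hD, L]
    have hy : D (l + 1) / (L ^ (2 * k)) ^ 2 ≤ C * (1 / L ^ 2) := by
      rw [hDl, mul_div_assoc]
      refine mul_le_mul_of_nonneg_left ?_ hC.le
      rw [div_le_div_iff₀ (by positivity) (by positivity), one_mul, ← pow_add, ← pow_mul]
      -- The exponents compare as `(d - 1) + 2 ≤ 4k`, which is `d < 4k` for integers.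
      exact pow_le_pow_right₀ hl (by omega)
    -- Moving the weight `L^{4k}` from one factor to the other and using `√a √b ≤ a + b` leaves a
    -- Bessel sum plus `C / L²`.
    have hxy : √(Φ (l + 1)) * √(D (l + 1))
        = √(Φ (l + 1) * (L ^ (2 * k)) ^ 2) * √(D (l + 1) / (L ^ (2 * k)) ^ 2) := by
      rw [← Real.sqrt_mul (hΦ0 _), ← Real.sqrt_mul (by have := hΦ0 (l + 1); positivity)]
      congr 1
      field_simp
    rw [hxy]
    have hx0 : 0 ≤ Φ (l + 1) * (L ^ (2 * k)) ^ 2 := by have := hΦ0 (l + 1); positivity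
    have hy0 : 0 ≤ D (l + 1) / (L ^ (2 * k)) ^ 2 := by rw [hDl]; positivity
    have := hΦA (l + 1)
    nlinarith [Real.sq_sqrt hx0, Real.sq_sqrt hy0,
      sq_nonneg (√(Φ (l + 1) * (L ^ (2 * k)) ^ 2) - √(D (l + 1) / (L ^ (2 * k)) ^ 2))]
  · refine (norm_sum_mul_le_sqrt _ _).trans ?_
    exact mul_le_mul_of_nonneg_left (Real.sqrt_le_sqrt (hBD l x)) (Real.sqrt_nonneg _)

/-- Pointwise convergence of the Fourier-Laplace series of a smooth function. -/
theorem hasSum_fourierLaplaceTerm (hd : 1 ≤ d) (hB : ∀ l, IsHarmonicBasis d l (B l))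
    {k : ℕ} (hk : d < 4 * k) {f : Sph d → ℝ} (hf : SphereContDiff (2 * k) f) (x : Sph d) :
    HasSum (fun l => fourierLaplaceTerm B f l x) (f x : ℂ) := by
  obtain ⟨u, hu, hb⟩ := exists_summable_bound_fourierLaplaceTerm hd hB hk hf
  have hs : ∀ x, Summable fun l => fourierLaplaceTerm B f l x := fun x =>
    Summable.of_norm_bounded hu fun l => hb l x
  set h : Sph d → ℂ := fun x => ∑' l, fourierLaplaceTerm B f l x with hh
  have hcont : Continuous h := continuous_tsum (continuous_fourierLaplaceTerm hB f) hu hb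
  have hfc : Continuous fun y => (f y : ℂ) := Complex.continuous_ofReal.comp hf.continuous
  -- Uniform convergence permits integration term by term, and orthonormality selects one
  -- coefficient: the sum `h` and `f` have the same Fourier coefficients.
  have hcoef : ∀ m r, ∫ y, h y * star (B m r y) ∂(surfaceMeasure d)
      = ∫ y, (f y : ℂ) * star (B m r y) ∂(surfaceMeasure d) := by
    intro m r
    obtain ⟨K, hK⟩ : ∃ K, ∀ y, ‖star (B m r y)‖ ≤ K := by
      obtain ⟨K, hK⟩ := (isCompact_range ((hB m).continuous r).star).isBounded.exists_norm_le
      exact ⟨K, fun y => hK _ ⟨y, rfl⟩⟩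
    have hi : ∀ l, Integrable (fun y => fourierLaplaceTerm B f l y * star (B m r y))
        (surfaceMeasure d) := fun l => integrable_of_continuous
      ((continuous_fourierLaplaceTerm hB f l).mul ((hB m).continuous r).star)
    have hsum := hasSum_integral_of_summable_integral_norm hi (by
      refine Summable.of_nonneg_of_le (fun l => integral_nonneg fun y => norm_nonneg _) (fun l => ?_)
        ((hu.mul_right K).mul_right ((surfaceMeasure d).real Set.univ))
      have : ∫ y, ‖fourierLaplaceTerm B f l y * star (B m r y)‖ ∂(surfaceMeasure d)
          ≤ ∫ _, u l * K ∂(surfaceMeasure d) := by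
        refine integral_mono (hi l).norm (integrable_const _) fun y => ?_
        simp only [norm_mul]
        exact mul_le_mul (hb l y) (hK y) (norm_nonneg _) ((norm_nonneg _).trans (hb l y))
      simpa [mul_comm] using this)
    have hval : ∀ l, ∫ y, fourierLaplaceTerm B f l y * star (B m r y) ∂(surfaceMeasure d)
        = if l = m then sphFourier B (fun y => (f y : ℂ)) m r else 0 := by
      intro l
      have e : ∀ y, fourierLaplaceTerm B f l y * star (B m r y) = ∑ q,
          sphFourier B (fun y => (f y : ℂ)) l q * (B l q y * star (B m r y)) := fun y => by
        simp only [fourierLaplaceTerm, Finset.sum_mul, mul_assoc]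
      simp only [e]
      rw [integral_finsetSum _ fun q _ => Integrable.const_mul (integrable_of_continuous
        (f := fun y => B l q y * star (B m r y))
        (((hB l).continuous q).mul ((hB m).continuous r).star)) _]
      have := fun q => integral_mul_star_harmonicBasis hd hB ⟨l, q⟩ ⟨m, r⟩
      simp only [integral_const_mul, this]
      by_cases hlm : l = m
      · subst hlm
        simp
      · simp [hlm]
    simp only [hval] at hsum
    have h1 := hsum.unique (hasSum_ite_eq m _)
    simp only [hh]
    rw [show (∫ y, (f y : ℂ) * star (B m r y) ∂(surfaceMeasure d))
      = sphFourier B (fun y => (f y : ℂ)) m r from rfl, ← h1]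
    simp only [tsum_mul_right]
  -- Completeness tests against an arbitrary harmonic `g`. Its conjugate is expanded in the basis,
  -- so that `g` becomes a combination of the conjugates against which the coefficients are taken.
  have hzero : (fun y => h y - (f y : ℂ)) = 0 := by
    refine eq_zero_of_orthogonal_harmonicSpace (hcont.sub hfc) fun l g hg => ?_
    have hg' := star_mem_harmonicSpace hg
    have e : ∀ y, g y = ∑ r, star (∫ z, star (g z) * star (B l r z) ∂(surfaceMeasure d))
        * star (B l r y) := by
      intro y
      have := congrArg star ((hB l).eq_sum hg' y)
      simpa only [star_star, star_sum, star_mul'] using this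
    have e2 : ∀ y, (h y - (f y : ℂ)) * g y
        = ∑ r, star (∫ z, star (g z) * star (B l r z) ∂(surfaceMeasure d))
          * (h y * star (B l r y) - (f y : ℂ) * star (B l r y)) := by
      intro y
      rw [e y, Finset.mul_sum]
      exact Finset.sum_congr rfl fun r _ => by ring
    have i1 : ∀ r, Integrable (fun y => h y * star (B l r y)) (surfaceMeasure d) := fun r =>
      integrable_of_continuous (hcont.mul ((hB l).continuous r).star)
    have i2 : ∀ r, Integrable (fun y => (f y : ℂ) * star (B l r y)) (surfaceMeasure d) := fun r =>
      integrable_of_continuous (hfc.mul ((hB l).continuous r).star)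
    have i3 : ∀ r, Integrable (fun y => star (∫ z, star (g z) * star (B l r z) ∂(surfaceMeasure d))
        * (h y * star (B l r y) - (f y : ℂ) * star (B l r y))) (surfaceMeasure d) := fun r =>
      ((i1 r).sub (i2 r)).const_mul _
    simp only [e2]
    rw [integral_finsetSum _ fun r _ => i3 r]
    refine Finset.sum_eq_zero fun r _ => ?_
    rw [integral_const_mul, integral_sub (i1 r) (i2 r), hcoef, sub_self, mul_zero]
  have := congrFun hzero x
  rw [← sub_eq_zero.1 this]
  exact (hs x).hasSum

/-- The truncation error of the Fourier-Laplace series of a smooth function. -/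
theorem norm_sub_sum_fourierLaplaceTerm_le (hd : 1 ≤ d) (hB : ∀ l, IsHarmonicBasis d l (B l))
    {k : ℕ} (hk : d < 4 * k) {f : Sph d → ℝ} (hf : SphereContDiff (2 * k) f) (x : Sph d)
    (hAbs : Summable fun l => ‖fourierLaplaceTerm B (laplaceBeltrami^[k] f) l x‖) (n : ℕ) :
    (n : ℝ) ^ (2 * k) * ‖∑ l ∈ Finset.range n, fourierLaplaceTerm B f l x - f x‖
      ≤ ∑' l, ‖fourierLaplaceTerm B (laplaceBeltrami^[k] f) (l + n) x‖ := by
  have hs := hasSum_fourierLaplaceTerm hd hB hk hf x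
  have h1 := hs.summable.sum_add_tsum_nat_add n
  rw [hs.tsum_eq] at h1
  have h2 : ∑ l ∈ Finset.range n, fourierLaplaceTerm B f l x - f x
      = - ∑' l, fourierLaplaceTerm B f (l + n) x := by rw [← h1]; ring
  rw [h2, norm_neg]
  obtain ⟨u, hu, hb⟩ := exists_summable_bound_fourierLaplaceTerm hd hB hk hf
  have hsn : Summable fun l => ‖fourierLaplaceTerm B f (l + n) x‖ :=
    (summable_nat_add_iff (f := fun l => ‖fourierLaplaceTerm B f l x‖) n).2
      (Summable.of_nonneg_of_le (fun _ => norm_nonneg _) (fun l => hb l x) hu)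
  refine (mul_le_mul_of_nonneg_left (norm_tsum_le_tsum_norm hsn) (by positivity)).trans ?_
  rw [← tsum_mul_left]
  refine Summable.tsum_le_tsum (fun l => ?_) (hsn.mul_left _)
    ((summable_nat_add_iff
      (f := fun l => ‖fourierLaplaceTerm B (laplaceBeltrami^[k] f) l x‖) n).2 hAbs)
  -- In the tail every degree is at least `n`, so the eigenvalue factor dominates `n ^ (2 * k)`.
  rw [fourierLaplaceTerm_iterate_laplaceBeltrami hd hB hf, norm_mul]
  refine mul_le_mul_of_nonneg_right ?_ (norm_nonneg _)
  refine le_trans ?_ (pow_le_norm_eigenvalue_pow hd (l + n) k)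
  gcongr
  exact Nat.le_add_left n l

end FourierLaplace

/-! ### The mean of the deconvolution kernel -/

section Expectation

variable {d : ℕ} {B : HarmonicFamily d}

lemma integral_withDensity_ofReal_mul {α : Type*} [MeasurableSpace α] {μ : Measure α} {f : α → ℝ}
    (hf : AEMeasurable f μ) (h0 : ∀ x, 0 ≤ f x) (g : α → ℂ) :
    ∫ x, g x ∂(μ.withDensity fun x => ENNReal.ofReal (f x)) = ∫ x, (f x : ℂ) * g x ∂μ := by
  rw [integral_withDensity_eq_integral_toReal_smul₀ hf.ennreal_ofReal
    (ae_of_all _ fun x => ENNReal.ofReal_lt_top)]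
  simp only [ENNReal.toReal_ofReal (h0 _), Complex.real_smul]

lemma continuous_rotate : Continuous fun p : Rot d × Sph d => rotate p.1 p.2 := by
  refine Continuous.subtype_mk ((PiLp.continuous_toLp 2 _).comp ?_) _
  exact (continuous_subtype_val.comp continuous_fst).matrix_mulVec
    ((PiLp.continuous_ofLp 2 _).comp (continuous_subtype_val.comp continuous_snd))

lemma continuous_rotCoeff (hB : ∀ l, IsHarmonicBasis d l (B l)) (l : ℕ)
    (q r : Fin (harmonicDim d l)) : Continuous fun u => rotCoeff B l u q r := by
  have h : Continuous (Function.uncurry fun (u : Rot d) (x : Sph d) =>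
      star (B l q (rotate u x)) * B l r x) :=
    ((hB l).continuous q |>.comp continuous_rotate).star.mul
      (((hB l).continuous r).comp continuous_snd)
  have : FirstCountableTopology (Matrix (Fin (d + 1)) (Fin (d + 1)) ℝ) :=
    inferInstanceAs (FirstCountableTopology (Fin (d + 1) → Fin (d + 1) → ℝ))
  have : FirstCountableTopology (Rot d) :=
    Topology.IsInducing.subtypeVal.firstCountableTopology
  have h2 := continuous_parametric_integral_of_continuous (μ := surfaceMeasure d) h isCompact_univ
  simp only [Measure.restrict_univ] at h2
  exact h2

/-- The action of a rotation on the conjugated basis of spherical harmonics. -/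
lemma star_harmonicBasis_rotate (hB : ∀ l, IsHarmonicBasis d l (B l)) (l : ℕ)
    (q : Fin (harmonicDim d l)) (u : Rot d) (x : Sph d) :
    star (B l q (rotate u x)) = ∑ r, rotCoeff B l u q r * star (B l r x) := by
  have h1 := (hB l).eq_sum (comp_sphMap_mem_harmonicSpace (rotIsometry u) ((hB l).mem q)) x
  have h2 := congrArg star h1
  rw [sphMap_rotIsometry, star_sum] at h2
  rw [h2]
  refine Finset.sum_congr rfl fun r _ => ?_
  rw [star_mul']
  congr 1
  rw [← starRingEnd_apply, ← integral_conj]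
  simp only [starRingEnd_apply, star_mul', star_star, sphMap_rotIsometry]
  rfl

variable {Ω : Type*} [MeasurableSpace Ω] {P : Measure Ω} [IsProbabilityMeasure P]
  {X : Ω → Sph d} {fX : Sph d → ℝ} {U : Ω → Rot d} {fU : Rot d → ℝ}

/-- The Fourier transform of the law of `U X` is the product of the Fourier transforms. -/
lemma integral_star_harmonicBasis_map_rotate (hB : ∀ l, IsHarmonicBasis d l (B l))
    (hX : Measurable X) (hfX_nonneg : ∀ x, 0 ≤ fX x) (hfX_meas : AEMeasurable fX (surfaceMeasure d))
    (hfX : P.map X = (surfaceMeasure d).withDensity fun x => ENNReal.ofReal (fX x))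
    (hU : Measurable U) (hfU_nonneg : ∀ u, 0 ≤ fU u) (hfU_meas : AEMeasurable fU (haarRot d))
    (hfU : P.map U = (haarRot d).withDensity fun u => ENNReal.ofReal (fU u))
    (hUX : IndepFun U X P) (l : ℕ) (r : Fin (harmonicDim d l)) :
    ∫ z, star (B l r z) ∂(P.map fun ω => rotate (U ω) (X ω))
      = ∑ s, rotFourier B fU l r s * sphFourier B (fun y => (fX y : ℂ)) l s := by
  have : IsProbabilityMeasure (P.map U) := Measure.isProbabilityMeasure_map hU.aemeasurable
  have : IsProbabilityMeasure (P.map X) := Measure.isProbabilityMeasure_map hX.aemeasurable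
  -- By independence the law is the image of a product measure; after expanding in the matrix
  -- `rotCoeff` the double integral factors.
  have hmap : P.map (fun ω => rotate (U ω) (X ω))
      = ((P.map U).prod (P.map X)).map fun p => rotate p.1 p.2 := by
    rw [← (indepFun_iff_map_prod_eq_prod_map_map hU.aemeasurable hX.aemeasurable).1 hUX,
      Measure.map_map continuous_rotate.measurable (hU.prodMk hX)]
    rfl
  rw [hmap, integral_map continuous_rotate.measurable.aemeasurable
    ((hB l).continuous r).star.aestronglyMeasurable]
  simp only [star_harmonicBasis_rotate hB]
  have hc : ∀ s, Continuous fun p : Rot d × Sph d => rotCoeff B l p.1 r s * star (B l s p.2) :=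
    fun s => ((continuous_rotCoeff hB l r s).comp continuous_fst).mul
      (((hB l).continuous s).comp continuous_snd).star
  rw [integral_finsetSum _ fun s _ =>
    (hc s).integrable_of_hasCompactSupport (HasCompactSupport.of_compactSpace _)]
  refine Finset.sum_congr rfl fun s _ => ?_
  rw [integral_prod_mul (fun u => rotCoeff B l u r s) (fun x => star (B l s x)), hfU, hfX,
    integral_withDensity_ofReal_mul hfU_meas hfU_nonneg,
    integral_withDensity_ofReal_mul hfX_meas hfX_nonneg]
  rfl

lemma continuous_deconvKernel (hB : ∀ l, IsHarmonicBasis d l (B l)) (fU : Rot d → ℝ) (t : ℝ)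
    (x : Sph d) : Continuous (deconvKernel B fU t x) := by
  refine continuous_finsetSum _ fun l _ => continuous_finsetSum _ fun q _ =>
    Continuous.mul (continuous_finsetSum _ fun r _ => ?_) continuous_const
  exact continuous_const.mul ((hB l).continuous r).star

/-- The mean of the deconvolution kernel is the truncated Fourier-Laplace series. -/
theorem integral_deconvKernel (hB : ∀ l, IsHarmonicBasis d l (B l))
    (hX : Measurable X) (hfX_nonneg : ∀ x, 0 ≤ fX x) (hfX_meas : AEMeasurable fX (surfaceMeasure d))
    (hfX : P.map X = (surfaceMeasure d).withDensity fun x => ENNReal.ofReal (fX x))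
    (hU : Measurable U) (hfU_nonneg : ∀ u, 0 ≤ fU u) (hfU_meas : AEMeasurable fU (haarRot d))
    (hfU : P.map U = (haarRot d).withDensity fun u => ENNReal.ofReal (fU u))
    (hUX : IndepFun U X P) (hinv : ∀ l, IsUnit (rotFourier B fU l)) (t : ℝ) (x : Sph d) :
    ∫ z, deconvKernel B fU t x z ∂(P.map fun ω => rotate (U ω) (X ω))
      = ∑ l ∈ Finset.range (⌊t⌋₊ + 1), fourierLaplaceTerm B fX l x := by
  have : IsProbabilityMeasure (P.map fun ω => rotate (U ω) (X ω)) :=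
    Measure.isProbabilityMeasure_map
      (continuous_rotate.measurable.comp (hU.prodMk hX)).aemeasurable
  set ρ := P.map fun ω => rotate (U ω) (X ω)
  have hi : ∀ {f : Sph d → ℂ}, Continuous f → Integrable f ρ := fun hf =>
    hf.integrable_of_hasCompactSupport (HasCompactSupport.of_compactSpace _)
  have hc : ∀ l q r, Continuous fun z => (rotFourier B fU l)⁻¹ q r * star (B l r z) :=
    fun l q r => continuous_const.mul ((hB l).continuous r).star
  have hc' : ∀ l q, Continuous fun z =>
      (∑ r, (rotFourier B fU l)⁻¹ q r * star (B l r z)) * B l q x := fun l q =>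
    (continuous_finsetSum _ fun r _ => hc l q r).mul continuous_const
  simp only [deconvKernel]
  rw [integral_finsetSum _ fun l _ => hi (continuous_finsetSum _ fun q _ => hc' l q)]
  refine Finset.sum_congr rfl fun l _ => ?_
  rw [integral_finsetSum _ fun q _ => hi (hc' l q), fourierLaplaceTerm]
  refine Finset.sum_congr rfl fun q _ => ?_
  rw [integral_mul_const, integral_finsetSum _ fun r _ => hi (hc l q r)]
  simp only [integral_const_mul]
  congr 1
  have hE := integral_star_harmonicBasis_map_rotate hB hX hfX_nonneg hfX_meas hfX hU hfU_nonneg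
    hfU_meas hfU hUX l
  -- The coefficients of the law of `UX` are the matrix `rotFourier` applied to those of `fX`, and
  -- the inverse in the kernel cancels it.
  have hmv : (fun r => ∫ z, star (B l r z) ∂ρ)
      = (rotFourier B fU l).mulVec (sphFourier B (fun y => (fX y : ℂ)) l) := funext hE
  change ((rotFourier B fU l)⁻¹.mulVec fun r => ∫ z, star (B l r z) ∂ρ) q = _
  rw [hmv, Matrix.mulVec_mulVec,
    Matrix.nonsing_inv_mul _ ((Matrix.isUnit_iff_isUnit_det _).1 (hinv l)), Matrix.one_mulVec]

end Expectation

/-! ### Uniform bound for the kernel -/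

section Bound

variable {d : ℕ} {B : HarmonicFamily d}

lemma norm_sum_mulVec_mul_le {N : ℕ} (A : Matrix (Fin N) (Fin N) ℂ) (v w : Fin N → ℂ) :
    ‖∑ q, (∑ r, A q r * v r) * w q‖ ≤ opNorm A * (√(∑ r, ‖v r‖ ^ 2) * √(∑ q, ‖w q‖ ^ 2)) := by
  refine (norm_sum_mul_le_sqrt _ _).trans ?_
  rw [← mul_assoc]
  refine mul_le_mul_of_nonneg_right ?_ (Real.sqrt_nonneg _)
  have h := (Matrix.toEuclideanCLM (𝕜 := ℂ) A).le_opNorm (WithLp.toLp 2 v)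
  rw [EuclideanSpace.norm_eq, EuclideanSpace.norm_eq] at h
  exact h

/-- A uniform bound for the deconvolution kernel under ordinary smoothness. -/
theorem exists_norm_deconvKernel_le (hd : 1 ≤ d) (hB : ∀ l, IsHarmonicBasis d l (B l))
    {fU : Rot d → ℝ} {β : ℝ} (hβ : 0 ≤ β) (hS : OrdinarySmoothUpper B fU β) :
    ∃ M > 0, ∀ t x z, ‖deconvKernel B fU t x z‖
      ≤ M * (1 + (⌊t⌋₊ : ℝ) ^ β * (⌊t⌋₊ : ℝ) ^ d) := by
  obtain ⟨C, hC, hCB⟩ := exists_sum_norm_sq_le hd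
  obtain ⟨c₁, hc₁, hop⟩ := hS
  have hω : 0 < (surfaceMeasure d).real Set.univ := surfaceMeasure_real_univ_pos d
  -- Ordinary smoothness is silent at degree 0, so that term is bounded separately; it accounts for
  -- the `1 +` in the bound.
  set M₀ : ℝ := opNorm (rotFourier B fU 0)⁻¹
    * ((harmonicDim d 0 : ℝ) / (surfaceMeasure d).real Set.univ) with hM₀
  have hop0 : ∀ l, 0 ≤ opNorm (rotFourier B fU l)⁻¹ := fun l => norm_nonneg _
  have hM₀0 : 0 ≤ M₀ := mul_nonneg (hop0 0) (by positivity)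
  have hterm : ∀ l x z (D : ℝ), (∀ y, ∑ q, ‖B l q y‖ ^ 2 ≤ D) →
      ‖∑ q, (∑ r, (rotFourier B fU l)⁻¹ q r * star (B l r z)) * B l q x‖
        ≤ opNorm (rotFourier B fU l)⁻¹ * D := by
    intro l x z D hD
    refine (norm_sum_mulVec_mul_le _ _ _).trans (mul_le_mul_of_nonneg_left ?_ (hop0 l))
    simp only [norm_star]
    have hD0 : 0 ≤ D := (Finset.sum_nonneg fun q _ => by positivity).trans (hD x)
    calc √(∑ r, ‖B l r z‖ ^ 2) * √(∑ q, ‖B l q x‖ ^ 2) ≤ √D * √D :=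
          mul_le_mul (Real.sqrt_le_sqrt (hD z)) (Real.sqrt_le_sqrt (hD x)) (Real.sqrt_nonneg _)
            (Real.sqrt_nonneg _)
      _ = D := Real.mul_self_sqrt hD0
  refine ⟨M₀ + c₁ * C, by positivity, fun t x z => ?_⟩
  set N := ⌊t⌋₊
  have h0 : ‖∑ q, (∑ r, (rotFourier B fU 0)⁻¹ q r * star (B 0 r z)) * B 0 q x‖ ≤ M₀ :=
    hterm 0 x z _ fun y => by rw [le_div_iff₀ hω, (hB 0).sum_norm_sq y]
  -- Each of the `N` remaining terms has size at most `c₁ C N^{β+d-1}`, hence a total of order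
  -- `N^{β+d}`.
  have hl : ∀ l ∈ Finset.range N,
      ‖∑ q, (∑ r, (rotFourier B fU (l + 1))⁻¹ q r * star (B (l + 1) r z)) * B (l + 1) q x‖
        ≤ c₁ * C * ((N : ℝ) ^ β * (N : ℝ) ^ (d - 1)) := by
    intro l hl
    have hlN : ((l + 1 : ℕ) : ℝ) ≤ N := by exact_mod_cast Finset.mem_range.1 hl
    have hl1 : 1 ≤ l + 1 := by omega
    calc _ ≤ opNorm (rotFourier B fU (l + 1))⁻¹ * (C * ((l + 1 : ℕ) : ℝ) ^ (d - 1)) :=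
          hterm _ x z _ (hCB _ hl1 _ (hB _))
      _ ≤ (c₁ * ((l + 1 : ℕ) : ℝ) ^ β) * (C * ((l + 1 : ℕ) : ℝ) ^ (d - 1)) :=
          mul_le_mul_of_nonneg_right (hop _ hl1) (by positivity)
      _ ≤ (c₁ * (N : ℝ) ^ β) * (C * (N : ℝ) ^ (d - 1)) := by gcongr
      _ = _ := by ring
  have hsum := (norm_sum_le (Finset.range N) _).trans (Finset.sum_le_sum hl)
  rw [Finset.sum_const, Finset.card_range, nsmul_eq_mul] at hsum
  have hN : (N : ℝ) * (c₁ * C * ((N : ℝ) ^ β * (N : ℝ) ^ (d - 1)))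
      = c₁ * C * ((N : ℝ) ^ β * (N : ℝ) ^ d) := by
    obtain ⟨e, rfl⟩ : ∃ e, d = e + 1 := ⟨d - 1, by omega⟩
    rw [Nat.add_sub_cancel]
    ring
  rw [hN] at hsum
  have hpos : 0 ≤ (N : ℝ) ^ β * (N : ℝ) ^ d := by positivity
  rw [deconvKernel, Finset.sum_range_succ']
  refine (norm_add_le _ _).trans ((add_le_add hsum h0).trans ?_)
  nlinarith [mul_pos hc₁ hC, mul_nonneg hM₀0 hpos]

end Bound

/-! ### Power rates of the truncation level -/

section Rates

variable {T : ℕ → ℝ} {p : ℝ}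

lemma PowerOrder.tendsto_atTop (hT : PowerOrder T p) (hp : 0 < p) : Tendsto T atTop atTop := by
  obtain ⟨c, hc, C, -, h⟩ := hT
  refine tendsto_atTop_mono' _ ?_
    (((tendsto_rpow_atTop hp).comp tendsto_natCast_atTop_atTop).const_mul_atTop hc)
  filter_upwards [eventually_ge_atTop 1] with n hn using (h n hn).1

/-- `T_n^q = o(n)` when `T_n ≍ n^p` with `p q < 1`. -/
lemma PowerOrder.tendsto_rpow_div (hT : PowerOrder T p) {q : ℝ} (hq : 0 ≤ q) (hpq : p * q < 1) :
    Tendsto (fun n : ℕ => T n ^ q / n) atTop (𝓝 0) := by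
  obtain ⟨c, hc, C, hC, h⟩ := hT
  have hlim : Tendsto (fun n : ℕ => C ^ q * (n : ℝ) ^ (-(1 - p * q))) atTop (𝓝 0) := by
    have := ((tendsto_rpow_neg_atTop (by linarith : 0 < 1 - p * q)).comp
      tendsto_natCast_atTop_atTop).const_mul (C ^ q)
    simpa using this
  refine squeeze_zero' ?_ ?_ hlim
  · filter_upwards [eventually_ge_atTop 1] with n hn
    have : 0 ≤ T n := le_trans (by positivity) (h n hn).1
    positivity
  · filter_upwards [eventually_ge_atTop 1] with n hn
    have hn0 : (0 : ℝ) < n := by exact_mod_cast hn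
    have hT0 : 0 ≤ T n := le_trans (by positivity) (h n hn).1
    calc T n ^ q / n ≤ (C * (n : ℝ) ^ p) ^ q / n := by
          gcongr
          exact (h n hn).2
      _ = C ^ q * (n : ℝ) ^ (-(1 - p * q)) := by
          rw [Real.mul_rpow hC.le (by positivity), ← Real.rpow_mul hn0.le, neg_sub,
            Real.rpow_sub hn0, Real.rpow_one, mul_div_assoc]

/-- `√n = O(T_n^q)` when `T_n ≍ n^p` with `p q = 1/2`. -/
lemma PowerOrder.exists_sqrt_le (hT : PowerOrder T p) {q : ℝ} (hq : 0 ≤ q)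
    (hpq : p * q = 1 / 2) : ∃ a > 0, ∀ n : ℕ, 1 ≤ n → √(n : ℝ) ≤ a * T n ^ q := by
  obtain ⟨c, hc, C, hC, h⟩ := hT
  refine ⟨(c ^ q)⁻¹, by positivity, fun n hn => ?_⟩
  have h1 : (c * (n : ℝ) ^ p) ^ q ≤ T n ^ q :=
    Real.rpow_le_rpow (by positivity) (h n hn).1 hq
  rw [Real.mul_rpow hc.le (by positivity), ← Real.rpow_mul (by positivity), hpq,
    ← Real.sqrt_eq_rpow] at h1
  rwa [inv_mul_eq_div, le_div_iff₀ (by positivity), mul_comm]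

end Rates

/-! ### Lindeberg ratio and normalised bias -/

section Asymptotics

variable {T v : ℕ → ℝ} {p q c : ℝ}

lemma tendsto_atTop_of_rpow_le (hT : Tendsto T atTop atTop) (hq : 0 < q) (hc : 0 < c)
    (hv : ∀ n : ℕ, 1 ≤ n → c * T n ^ q ≤ v n) : Tendsto v atTop atTop := by
  refine tendsto_atTop_mono' _ ?_ (((tendsto_rpow_atTop hq).comp hT).const_mul_atTop hc)
  filter_upwards [eventually_ge_atTop 1] with n hn using hv n hn

/-- The Lindeberg ratio of the deconvolution kernel tends to zero. -/
lemma tendsto_bound_sq_div {d : ℕ} {β M : ℝ} (hβ : 0 ≤ β) (hM : 0 < M) (hp : 0 < p)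
    (hpd : p * d < 1) (hT : PowerOrder T p) (hc : 0 < c)
    (hv : ∀ n : ℕ, 1 ≤ n → c * T n ^ (2 * β + d) ≤ v n) :
    Tendsto (fun n : ℕ => (M * (1 + (⌊T n⌋₊ : ℝ) ^ β * (⌊T n⌋₊ : ℝ) ^ d)) ^ 2 / (n * v n))
      atTop (𝓝 0) := by
  have hlim := (hT.tendsto_rpow_div (q := d) (by positivity) hpd).const_mul (4 * M ^ 2 / c)
  rw [mul_zero] at hlim
  refine squeeze_zero' ?_ ?_ hlim
  · filter_upwards [eventually_ge_atTop 1, (hT.tendsto_atTop hp).eventually_ge_atTop 1]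
      with n hn hTn
    have : 0 ≤ v n := le_trans (by positivity) (hv n hn)
    positivity
  · filter_upwards [eventually_ge_atTop 1, (hT.tendsto_atTop hp).eventually_ge_atTop 1]
      with n hn hTn
    have hn0 : (0 : ℝ) < n := by exact_mod_cast hn
    have hT0 : 0 < T n := by linarith
    have hfl : (⌊T n⌋₊ : ℝ) ≤ T n := Nat.floor_le hT0.le
    have h1 : 1 + (⌊T n⌋₊ : ℝ) ^ β * (⌊T n⌋₊ : ℝ) ^ d ≤ 2 * T n ^ (β + d) := by
      have e1 : (⌊T n⌋₊ : ℝ) ^ β * (⌊T n⌋₊ : ℝ) ^ d ≤ T n ^ β * T n ^ d := by gcongr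
      rw [← Real.rpow_natCast (T n), ← Real.rpow_add hT0] at e1
      have e2 : 1 ≤ T n ^ (β + d) := Real.one_le_rpow hTn (by positivity)
      linarith
    -- The excess of `2(β + d)` over `2β + d` is `d`, so the ratio is bounded by a multiple of
    -- `T_n^d / n`.
    calc (M * (1 + (⌊T n⌋₊ : ℝ) ^ β * (⌊T n⌋₊ : ℝ) ^ d)) ^ 2 / (n * v n)
        ≤ (M * (2 * T n ^ (β + d))) ^ 2 / (n * (c * T n ^ (2 * β + d))) := by
          gcongr
          exact hv n hn
      _ = 4 * M ^ 2 / c * (T n ^ (d : ℝ) / n) := by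
          have e : (T n ^ (β + d)) ^ 2 = T n ^ (2 * β + d) * T n ^ (d : ℝ) := by
            rw [← Real.rpow_natCast, ← Real.rpow_mul hT0.le, ← Real.rpow_add hT0]
            congr 1
            push_cast
            ring
          have e0 : T n ^ (2 * β + d) ≠ 0 := (Real.rpow_pos_of_pos hT0 _).ne'
          rw [mul_pow, mul_pow, e]
          field_simp
          norm_num

/-- The normalised bias of the estimator tends to zero. -/
lemma tendsto_bias_div {d k : ℕ} {β b : ℝ} {m R : ℕ → ℝ} (hβ : 0 ≤ β)
    (hp : 0 < p) (hpk : p * (4 * k + 2 * β + d) = 1) (hT : PowerOrder T p) (hc : 0 < c)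
    (hv : ∀ n : ℕ, 1 ≤ n → c * T n ^ (2 * β + d) ≤ v n) (hR : Tendsto R atTop (𝓝 0))
    (hm : ∀ n, ((⌊T n⌋₊ + 1 : ℕ) : ℝ) ^ (2 * k) * |m n - b| ≤ R (⌊T n⌋₊ + 1)) :
    Tendsto (fun n : ℕ => √(n : ℝ) * (m n - b) / √(v n)) atTop (𝓝 0) := by
  have hTt := hT.tendsto_atTop hp
  -- The exponent is half of `4k + 2β + d`: the part `2k` pays for the bias and the part `(2β +
  -- d)/2` for the standard deviation.
  obtain ⟨a, ha, hsq⟩ := hT.exists_sqrt_le (q := 2 * k + (2 * β + d) / 2) (by positivity)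
    (by linarith)
  have hRT : Tendsto (fun n => R (⌊T n⌋₊ + 1)) atTop (𝓝 0) :=
    hR.comp ((tendsto_add_atTop_nat 1).comp (tendsto_nat_floor_atTop.comp hTt))
  have hlim := hRT.const_mul (a / √c)
  rw [mul_zero] at hlim
  refine squeeze_zero_norm' ?_ hlim
  filter_upwards [eventually_ge_atTop 1, hTt.eventually_gt_atTop 0] with n hn hT0
  have h1 : √c * T n ^ ((2 * β + d) / 2) ≤ √(v n) := by
    refine le_trans (le_of_eq ?_) (Real.sqrt_le_sqrt (hv n hn))
    rw [Real.sqrt_mul hc.le, Real.sqrt_eq_rpow (T n ^ _), ← Real.rpow_mul hT0.le]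
    congr 2
    ring
  have h2 : T n ^ (2 * k) * |m n - b| ≤ R (⌊T n⌋₊ + 1) := by
    refine le_trans (mul_le_mul_of_nonneg_right ?_ (abs_nonneg _)) (hm n)
    -- The sum stops at degree `⌊T⌋`, so its tail starts at `⌊T⌋ + 1`, which exceeds `T`.
    refine pow_le_pow_left₀ hT0.le ?_ _
    push_cast
    exact (Nat.lt_floor_add_one (T n)).le
  have hpos : 0 < √c * T n ^ ((2 * β + d) / 2) := by positivity
  rw [Real.norm_eq_abs, abs_div, abs_mul, abs_of_nonneg (Real.sqrt_nonneg _),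
    abs_of_nonneg (Real.sqrt_nonneg _)]
  calc √(n : ℝ) * |m n - b| / √(v n)
      ≤ (a * T n ^ (2 * k + (2 * β + d) / 2)) * |m n - b| / (√c * T n ^ ((2 * β + d) / 2)) := by
        gcongr
        exact hsq n hn
    _ = a / √c * (T n ^ (2 * k) * |m n - b|) := by
        rw [Real.rpow_add hT0, show (2 * k : ℝ) = ((2 * k : ℕ) : ℝ) by push_cast; rfl,
          Real.rpow_natCast]
        field_simp
    _ ≤ a / √c * R (⌊T n⌋₊ + 1) := by gcongr

end Asymptotics

end SphereDeconv

end

/-! ### The main theorem -/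

theorem mainTheorem4 {d : ℕ} (hd : 1 ≤ d)
    -- an orthonormal basis of each space of spherical harmonics
    (B : HarmonicFamily d) (hB : ∀ l, IsHarmonicBasis d l (B l))
    {Ω : Type*} [MeasurableSpace Ω] (P : Measure Ω) [IsProbabilityMeasure P]
    -- the variable of interest, with its density
    (X : Ω → Sph d) (hX : Measurable X)
    (fX : Sph d → ℝ) (hfX_nonneg : ∀ x, 0 ≤ fX x)
    (hfX : P.map X = (surfaceMeasure d).withDensity fun x => ENNReal.ofReal (fX x))
    -- the measurement error, with its square integrable density
    (U : Ω → Rot d) (hU : Measurable U)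
    (fU : Rot d → ℝ) (hfU_nonneg : ∀ u, 0 ≤ fU u) (hfU_sq : MemLp fU 2 (haarRot d))
    (hfU : P.map U = (haarRot d).withDensity fun u => ENNReal.ofReal (fU u))
    (hUX : IndepFun U X P)
    (hinv : ∀ l, IsUnit (rotFourier B fU l))
    -- the observations: independent copies of `U X`
    (Z : ℕ → Ω → Sph d) (hZ_meas : ∀ i, Measurable (Z i)) (hZ_indep : iIndepFun Z P)
    (hZ_law : ∀ i, IdentDistrib (Z i) (fun ω => rotate (U ω) (X ω)) P P)
    -- ordinary smoothness of the error
    (β : ℝ) (hβ : 0 ≤ β) (hS : OrdinarySmoothUpper B fU β)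
    -- smoothness of the density of `X`
    (k : ℕ) (hk : (d : ℝ) / 4 < k)
    (hA : ContMDiff (𝓡 d) 𝓘(ℝ, ℝ) ((2 * k : ℕ) : WithTop ℕ∞) fX)
    -- the truncation level
    (T : ℕ → ℝ) (hT : PowerOrder T (1 / (4 * k + 2 * β + d)))
    -- the lower bound on the second moment of the kernel
    (hLow : SecondMomentLower B fU (P.map fun ω => rotate (U ω) (X ω)) T β d)
    -- absolute convergence of the Fourier-Laplace series of the iterated Laplacian
    (hAbs : ∀ x, Summable fun l => ‖fourierLaplaceTerm B (laplaceBeltrami^[k] fX) l x‖) :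
    ∀ x : Sph d,
      TendstoInDistribution
        (fun (n : ℕ) ω => √(n : ℝ) * (densityEst B fU (T n) n (fun i => Z i ω) x - fX x)
          / sdEst B fU (T n) n (fun i => Z i ω) x)
        atTop id (fun _ => P) (gaussianReal 0 1) ∧
      ∀ α : ℝ, 0 < α → α < 1 →
        Tendsto
          (fun n : ℕ => P.real {ω | fX x ∈ Set.Ioo
            (densityEst B fU (T n) n (fun i => Z i ω) x
              - normalUpperQuantile (α / 2) * (sdEst B fU (T n) n (fun i => Z i ω) x / √(n : ℝ)))
            (densityEst B fU (T n) n (fun i => Z i ω) x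
              + normalUpperQuantile (α / 2) * (sdEst B fU (T n) n (fun i => Z i ω) x / √(n : ℝ)))})
          atTop (𝓝 (1 - α)) := by
  intro x
  have hd0 : (0 : ℝ) < d := by exact_mod_cast hd
  have hk4 : d < 4 * k := by
    have : (d : ℝ) < 4 * k := by linarith
    exact_mod_cast this
  have hk0 : (0 : ℝ) < k := by linarith
  have hden : (0 : ℝ) < 4 * k + 2 * β + d := by positivity
  set p : ℝ := 1 / (4 * k + 2 * β + d)
  have hp : 0 < p := by positivity
  have hpk : p * (4 * k + 2 * β + d) = 1 := one_div_mul_cancel hden.ne'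
  -- Strict because `k > 0`: the spare `4k + 2β` in the denominator makes `T_n^d = o(n)`.
  have hpd : p * d < 1 := by
    rw [← hpk]
    exact mul_lt_mul_of_pos_left (by linarith) hp
  have hf : SphereContDiff (2 * k) fX := SphereContDiff.of_contMDiff hA
  have hrot : Measurable fun ω => rotate (U ω) (X ω) :=
    continuous_rotate.measurable.comp (hU.prodMk hX)
  have : IsProbabilityMeasure (P.map fun ω => rotate (U ω) (X ω)) :=
    Measure.isProbabilityMeasure_map hrot.aemeasurable
  obtain ⟨c, hc, hv⟩ := hLow x
  obtain ⟨M, hM, hbound⟩ := exists_norm_deconvKernel_le hd hB hβ hS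
  have hTt := hT.tendsto_atTop hp
  have hq : 0 < 2 * β + d := by positivity
  have hmean : ∀ n, ∫ z, (deconvKernel B fU (T n) x z).re ∂(P.map fun ω => rotate (U ω) (X ω))
      = (∑ l ∈ Finset.range (⌊T n⌋₊ + 1), fourierLaplaceTerm B fX l x).re := fun n => by
    rw [← integral_deconvKernel hB hX hfX_nonneg hf.continuous.measurable.aemeasurable hfX hU
      hfU_nonneg hfU_sq.1.aemeasurable hfU hUX hinv]
    exact integral_re ((continuous_deconvKernel hB fU (T n) x).integrable_of_hasCompactSupport
      (HasCompactSupport.of_compactSpace _))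
  have hlim : Tendsto (fun n => (∑ l ∈ Finset.range (⌊T n⌋₊ + 1), fourierLaplaceTerm B fX l x).re)
      atTop (𝓝 (fX x)) := by
    have h := ((hasSum_fourierLaplaceTerm hd hB hk4 hf x).tendsto_sum_nat.comp
      ((tendsto_add_atTop_nat 1).comp (tendsto_nat_floor_atTop.comp hTt)))
    exact (Complex.continuous_re.tendsto _).comp h
  have hbias : ∀ n, ((⌊T n⌋₊ + 1 : ℕ) : ℝ) ^ (2 * k)
      * |(∑ l ∈ Finset.range (⌊T n⌋₊ + 1), fourierLaplaceTerm B fX l x).re - fX x|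
      ≤ ∑' l, ‖fourierLaplaceTerm B (laplaceBeltrami^[k] fX) (l + (⌊T n⌋₊ + 1)) x‖ := fun n => by
    refine le_trans (mul_le_mul_of_nonneg_left ?_ (by positivity))
      (norm_sub_sum_fourierLaplaceTerm_le hd hB hk4 hf x (hAbs x) (⌊T n⌋₊ + 1))
    have h := Complex.abs_re_le_norm
      (∑ l ∈ Finset.range (⌊T n⌋₊ + 1), fourierLaplaceTerm B fX l x - (fX x : ℂ))
    rwa [Complex.sub_re, Complex.ofReal_re] at h
  have hclt := tendstoInDistribution_selfNormalised (P := P) hZ_meas hZ_indep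
    (fun i => (hZ_law i).map_eq) (g := fun n z => (deconvKernel B fU (T n) x z).re)
    (fun n => (Complex.continuous_re.comp (continuous_deconvKernel hB fU (T n) x)).measurable)
    (fun n z => (Complex.abs_re_le_norm _).trans (hbound (T n) x z))
    (fun n => rfl) (tendsto_atTop_of_rpow_le hTt hq hc hv) hmean
    -- The means converge to `fX x`, hence are eventually bounded by `|fX x| + 1`.
    (hlim.abs.eventually_le_const (lt_add_one _))
    (tendsto_bound_sq_div hβ hM hp hpd hT hc hv)
    (tendsto_bias_div hβ hp hpk hT hc hv
      (tendsto_sum_nat_add fun l => ‖fourierLaplaceTerm B (laplaceBeltrami^[k] fX) l x‖) hbias)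
  exact ⟨hclt.1, fun α hα0 hα1 =>
    tendsto_coverage (fun n ω => Real.sqrt_nonneg _) hclt.1 hclt.2 hα0 hα1⟩
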